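/- All graphs are finite and simple. A graph is *hypotraceable* if it has no Hamiltonian path, but the deletion of any single vertex yields a graph that has a Hamiltonian path; it is *planar* if it can be drawn in the plane with edges as simple arcs that meet one another only at common end vertices and pass through no other vertex. **Theorem.** There exists a planar hypotraceable graph on $130$ vertices, and for every integer $n \ge 154$ there exists a planar hypotraceable graph on $n$ vertices. -/

import Mathlib

namespace SimpleGraph

/-- A drawing of the graph `G` in the plane without crossings: the vertices are sent to distinct
points, every edge to a simple arc which joins the points of its two ends and passes through no
other vertex, and the arcs of two different edges meet only in end points. -/
structure PlaneDrawing {V : Type*} (G : SimpleGraph V) where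
  /-- the point that represents a vertex -/
  point : V → ℝ × ℝ
  /-- the curve that represents an edge -/
  arc : G.edgeSet → unitInterval → ℝ × ℝ
  point_injective : Function.Injective point
  arc_continuous : ∀ e, Continuous (arc e)
  arc_injective : ∀ e, Function.Injective (arc e)
  arc_ends : ∀ e, s(arc e 0, arc e 1) = Sym2.map point e.1
  /-- an arc meets the vertices only in its two end points -/
  arc_point : ∀ e t v, arc e t = point v → t = 0 ∨ t = 1
  /-- a common point of two different arcs is an end point of both -/
  arc_arc : ∀ e f, e ≠ f → ∀ s t, arc e s = arc f t → (s = 0 ∨ s = 1) ∧ (t = 0 ∨ t = 1)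

/-- A graph is planar if it can be drawn in the plane without crossings. -/
def IsPlanar {V : Type*} (G : SimpleGraph V) : Prop :=
  Nonempty G.PlaneDrawing

/-- A graph is traceable if it has a Hamiltonian path. -/
def IsTraceable {V : Type*} [DecidableEq V] (G : SimpleGraph V) : Prop :=
  ∃ (a b : V) (p : G.Walk a b), p.IsHamiltonian

/-- A graph is hypotraceable if it has no Hamiltonian path, but the deletion of any single vertex
gives a graph that has one. -/
def IsHypotraceable {V : Type*} [DecidableEq V] (G : SimpleGraph V) : Prop :=
  ¬ G.IsTraceable ∧ ∀ v : V, (G.induce {w : V | w ≠ v}).IsTraceable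

end SimpleGraph

/-!
The building block is a *fragment*: a graph with three pairwise nonadjacent terminals such that,
after a new vertex is joined to the terminals, the graph has no Hamiltonian cycle but gets one when
any old vertex is deleted. Stated without the new vertex, no two terminals are joined by a
Hamiltonian path, and after the deletion of any vertex some two are (`IsFragment`).

*The ring.* Four fragments are arranged cyclically; consecutive ones are joined, in turn, by
sharing a terminal, by two edges between the remaining terminals, by sharing a terminal and by two
edges again (`IsRing`). The result is hypotraceable. Suppose that it has a Hamiltonian path. Its
edges form a forest, and in a fragment that contains no end of the path, exactly one terminal meets
no path edge of the fragment, while the other two meet one (`IsFragment.exists_isolated`). This is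
the shared terminal, as only one edge leaves the fragment at each of the other two. It cannot happen
in both fragments at a shared terminal, so each of the two pairs of fragments contains one end of
the path. A count of degrees modulo two shows that each pair is then left by three path
edges, two of them at the fragment without an end (`IsFragment.pair_of_end`). Only four edges join
the pairs, so the fragments without ends are joined by two path edges, and the path closes up to a
cycle (`IsRing.not_hamPath`). After the deletion of a vertex, a path is put together from paths in
the fragments (`IsRing.exists_hamPath_erase`). With fragments on `m₁`, …, `m₄` vertices, the ring
has `m₁ + m₂ + m₃ + m₄ - 2`.

*Substitution.* An inner vertex of degree three of a fragment, if its neighbors are pairwise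
nonadjacent and no terminals, can be replaced by another fragment whose terminals are identified
with these neighbors; the result is again a fragment (`IsHost.subst`). With a suitable fragment on
33 vertices, this adds 29 vertices.

*Planarity.* All drawings have straight edges. A fragment is drawn in the triangle of its
terminals; affine maps move such triangles into a fixed plane picture of the ring
(`exists_planar_isHypotraceable`) or into the free triangle around a replaced vertex
(`IsDrawnHost.hasDrawnFragment`).

*Orders.* There are plane fragments on 33, 35, 36, 39 and 41 vertices. Explicit paths, coordinates
and an exhaustive search with a proof of its soundness (`searchPath_eq_true`) certify them by
evaluation in the kernel. The ring of four copies of the first one has `4 * 33 - 2 = 130` vertices,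
and with substitution all orders from 154 on are reached (`exists_four_orders`,
`exists_hasDrawnFragment_sum`).
-/

open Finset

set_option linter.unusedSectionVars false

variable {U : Type*} [DecidableEq U]

/-! ### Paths through a given vertex set -/

/-- `HamPath G P s t`: the graph `G` has a path from `s` to `t` whose vertex set is exactly the
finite set `P`. -/
inductive HamPath (G : SimpleGraph U) : Finset U → U → U → Prop
  | single (a : U) : HamPath G {a} a a
  | cons {P : Finset U} {a b t : U} :
      G.Adj a b → a ∉ P → HamPath G P b t → HamPath G (insert a P) a t

namespace HamPath

variable {G H : SimpleGraph U} {P Q A B : Finset U} {s t r u v y : U}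

theorem cast (h : HamPath G P s t) (e : P = Q) : HamPath G Q s t := e ▸ h

theorem left_mem (h : HamPath G P s t) : s ∈ P := by
  cases h <;> simp

theorem right_mem (h : HamPath G P s t) : t ∈ P := by
  induction h with
  | single a => simp
  | cons _ _ _ ih => exact mem_insert_of_mem ih

theorem congr (h : HamPath G P s t) (e : ∀ u ∈ P, ∀ v ∈ P, G.Adj u v → H.Adj u v) :
    HamPath H P s t := by
  induction h with
  | single a => exact .single a
  | cons hab ha hp ih =>
    exact .cons (e _ (by simp) _ (mem_insert_of_mem hp.left_mem) hab) ha
      (ih fun u hu v hv => e u (mem_insert_of_mem hu) v (mem_insert_of_mem hv))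

theorem trans (h : HamPath G P s t) (k : HamPath G Q t r) (d : ∀ v ∈ P, v ∈ Q → v = t) :
    HamPath G (P ∪ Q) s r := by
  induction h with
  | single a => exact k.cast (by simpa using (insert_eq_of_mem k.left_mem).symm)
  | @cons P a b t hab ha hp ih =>
    have haQ : a ∉ Q := fun h => ha (d a (by simp) h ▸ hp.right_mem)
    exact (HamPath.cons hab (by simp [ha, haQ])
      (ih k fun v hv => d v (mem_insert_of_mem hv))).cast (by simp)

/-- Two disjoint paths joined by an edge. -/
theorem link (h : HamPath G P s t) (a : G.Adj t u) (k : HamPath G Q u r) (d : Disjoint P Q) :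
    HamPath G (P ∪ Q) s r := by
  have h1 := disjoint_left.1 d h.right_mem
  refine (h.trans (.cons a h1 k) fun v hv hv' => ?_).cast ?_
  · rcases mem_insert.1 hv' with rfl | h'
    · rfl
    · exact absurd h' (disjoint_left.1 d hv)
  · rw [union_insert, insert_eq_of_mem (mem_union_left _ h.right_mem)]

theorem symm (h : HamPath G P s t) : HamPath G P t s := by
  induction h with
  | single a => exact .single a
  | cons hab ha _ ih =>
    exact (ih.link hab.symm (.single _) (by simpa using ha)).cast (by ext; simp)

theorem map {W : Type*} [DecidableEq W] (f : U ↪ W) (h : HamPath G P s t) :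
    HamPath (G.map f) (P.map f) (f s) (f t) := by
  induction h with
  | single a => exact (HamPath.single (f a)).cast (by simp)
  | cons hab ha _ ih =>
    exact (HamPath.cons (by simpa using hab) (by simpa using ha) ih).cast (by simp)

theorem of_map {W : Type*} [DecidableEq W] (f : U ↪ W) {R : Finset W} {x z : W}
    (h : HamPath (G.map f) R x z) : ∀ {P : Finset U} {s t : U}, R = P.map f → x = f s → z = f t →
      HamPath G P s t := by
  induction h with
  | single a =>
    intro P s t hP hs ht
    have hst : s = t := f.injective (hs.symm.trans ht)
    subst hst
    have : P = {s} := by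
      apply Finset.map_injective f
      rw [← hP, hs]; simp
    exact (HamPath.single s).cast this.symm
  | @cons R a b t' hab ha hp ih =>
    intro P s t hP hs ht
    subst hs
    obtain ⟨b', hb', rfl⟩ : ∃ b' ∈ P, f b' = b := by
      have : b ∈ P.map f := hP ▸ mem_insert_of_mem hp.left_mem
      simpa using this
    have hs : s ∈ P := by
      have : f s ∈ P.map f := hP ▸ mem_insert_self _ _
      simpa using this
    have hR : R = (P.erase s).map f := by
      rw [Finset.map_erase, ← hP, erase_insert ha]
    exact (HamPath.cons (by simpa using hab) (by simp) (ih hR rfl ht)).cast (insert_erase hs)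

/-- A path is cut at an inner vertex `y` into a part before `y` and a part after `y`. -/
theorem split (h : HamPath G P s t) (hy : y ∈ P) (hs : y ≠ s) (ht : y ≠ t) :
    ∃ A B p q, G.Adj p y ∧ G.Adj y q ∧ HamPath G A s p ∧ HamPath G B q t ∧ Disjoint A B ∧
      A ∪ B = P.erase y := by
  induction h with
  | single a => simp_all
  | @cons P a b t hab ha hp ih =>
    have hyP : y ∈ P := (mem_insert.1 hy).resolve_left hs
    by_cases hb : y = b
    · subst hb
      cases hp with
      | single _ => exact absurd rfl ht
      | @cons Q _ c _ hbc hb' hq =>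
        simp only [mem_insert, not_or] at ha
        refine ⟨{a}, Q, a, c, hab, hbc, .single a, hq, by simpa using ha.2, ?_⟩
        rw [erase_insert_of_ne (Ne.symm hs), erase_insert hb']; rfl
    · obtain ⟨A, B, p, q, h1, h2, h3, h4, h5, h6⟩ := ih hyP hb ht
      have haAB : a ∉ A ∪ B := by rw [h6]; simp [ha]
      simp only [mem_union, not_or] at haAB
      refine ⟨insert a A, B, p, q, h1, h2, .cons hab haAB.1 h3, h4, ?_, ?_⟩
      · exact disjoint_insert_left.2 ⟨haAB.2, h5⟩
      · rw [insert_union, h6, erase_insert_of_ne (Ne.symm hs)]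

end HamPath

/-! ### Forests -/

open scoped Classical in
/-- The number of neighbors of `v` in the set `Q`. -/
noncomputable def degIn (T : SimpleGraph U) (Q : Finset U) (v : U) : ℕ := #{w ∈ Q | T.Adj v w}

/-- A graph is treated as a forest if no nonempty finite set of vertices induces a subgraph of
minimum degree at least two. -/
def IsForest (T : SimpleGraph U) : Prop := ∀ C : Finset U, C.Nonempty → ∃ v ∈ C, degIn T C v ≤ 1

section degIn

open scoped Classical

variable {T T' : SimpleGraph U} {P Q A B C : Finset U} {s t u v w : U}

theorem degIn_mono (h : A ⊆ B) : degIn T A v ≤ degIn T B v :=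
  card_le_card (filter_subset_filter _ h)

theorem degIn_le_of_imp (h : ∀ w ∈ A, T.Adj v w → w ∈ B ∧ T'.Adj v w) :
    degIn T A v ≤ degIn T' B v :=
  card_le_card fun w hw => by
    have hw := mem_filter.1 hw
    exact mem_filter.2 (h w hw.1 hw.2)

theorem degIn_congr (h : ∀ w, (w ∈ A ∧ T.Adj v w) ↔ (w ∈ B ∧ T'.Adj v w)) :
    degIn T A v = degIn T' B v := by
  unfold degIn
  congr 1
  ext w
  simpa using h w

theorem degIn_eq_zero : degIn T A v = 0 ↔ ∀ w ∈ A, ¬ T.Adj v w := by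
  simp [degIn, filter_eq_empty_iff]

theorem degIn_pos : 0 < degIn T A v ↔ ∃ w ∈ A, T.Adj v w := by
  simp [degIn, card_pos, filter_nonempty_iff]

theorem degIn_singleton : degIn T {u} v ≤ 1 := by
  unfold degIn
  exact (card_filter_le _ _).trans (by simp)

theorem degIn_union_of (hA : A ⊆ P) (hB : B ⊆ P) (h : ∀ w ∈ P, T.Adj v w → w ∈ A ∨ w ∈ B)
    (d : ∀ w ∈ A, w ∈ B → ¬ T.Adj v w) : degIn T P v = degIn T A v + degIn T B v := by
  unfold degIn
  rw [← card_union_of_disjoint]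
  · congr 1
    ext w
    simp only [mem_filter, mem_union]
    constructor
    · rintro ⟨h1, h2⟩
      rcases h w h1 h2 with h3 | h3 <;> simp [h2, h3]
    · rintro (⟨h1, h2⟩ | ⟨h1, h2⟩)
      · exact ⟨hA h1, h2⟩
      · exact ⟨hB h1, h2⟩
  · rw [disjoint_left]
    intro w h1 h2
    simp only [mem_filter] at h1 h2
    exact d w h1.1 h2.1 h1.2

theorem degIn_insert (ha : u ∉ Q) :
    degIn T (insert u Q) v = degIn T Q v + (if T.Adj v u then 1 else 0) := by
  unfold degIn
  rw [filter_insert]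
  split_ifs with h
  · rw [card_insert_of_notMem (by simp [ha])]
  · rfl

/-- The handshake lemma. -/
theorem even_sum_degIn : Even (∑ v ∈ Q, degIn T Q v) := by
  induction Q using Finset.induction_on with
  | empty => simp
  | insert a Q ha ih =>
    rw [sum_insert ha, degIn_insert ha]
    simp only [SimpleGraph.irrefl, if_false, add_zero]
    have : ∑ v ∈ Q, degIn T (insert a Q) v = ∑ v ∈ Q, degIn T Q v + degIn T Q a := by
      simp only [degIn_insert ha, sum_add_distrib]
      congr 1
      rw [degIn, card_filter]
      exact sum_congr rfl fun v _ => by simp [T.adj_comm]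
    rw [this, add_left_comm]
    exact ih.add ⟨_, rfl⟩

theorem IsForest.false_of_two_le (hT : IsForest T) (hC : C.Nonempty)
    (h : ∀ v ∈ C, 2 ≤ degIn T C v) : False := by
  obtain ⟨v, hv, h'⟩ := hT C hC
  have := h v hv
  omega

/-- The edges of a Hamiltonian path form a forest in which every vertex has degree two, up to a
correction at the two ends. -/
theorem HamPath.exists_forest {G : SimpleGraph U} (h : HamPath G P s t) :
    ∃ T ≤ G, IsForest T ∧ (∀ u v, T.Adj u v → u ∈ P ∧ v ∈ P) ∧
      ∀ v ∈ P, degIn T P v + (if v = s then 1 else 0) + (if v = t then 1 else 0) = 2 := by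
  induction h with
  | single a =>
    refine ⟨⊥, bot_le, fun C ⟨v, hv⟩ => ⟨v, hv, by simp [degIn]⟩, by simp, ?_⟩
    simp [degIn]
  | @cons P a b t hab ha hp ih =>
    obtain ⟨T, hTG, hT, hTP, hd⟩ := ih
    have hbP := hp.left_mem
    have htP := hp.right_mem
    have hne : a ≠ b := hab.ne
    have hTa : ∀ w, ¬ T.Adj a w := fun w h => ha (hTP _ _ h).1
    have adj : ∀ u v, (T ⊔ SimpleGraph.edge a b).Adj u v ↔
        T.Adj u v ∨ (u = a ∧ v = b) ∨ (u = b ∧ v = a) := by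
      intro u v
      simp only [SimpleGraph.sup_adj, SimpleGraph.edge_adj]
      constructor
      · rintro (h | ⟨h | h, -⟩) <;> tauto
      · rintro (h | ⟨rfl, rfl⟩ | ⟨rfl, rfl⟩)
        exacts [.inl h, .inr ⟨by simp, hne⟩, .inr ⟨by simp, hne.symm⟩]
    refine ⟨T ⊔ SimpleGraph.edge a b, ?_, ?_, ?_, ?_⟩
    · intro u v h
      rcases (adj u v).1 h with h | ⟨rfl, rfl⟩ | ⟨rfl, rfl⟩
      exacts [hTG h, hab, hab.symm]
    · intro C hC
      by_cases haC : a ∈ C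
      · refine ⟨a, haC, ?_⟩
        calc degIn (T ⊔ SimpleGraph.edge a b) C a ≤ degIn (T ⊔ SimpleGraph.edge a b) {b} a :=
              degIn_le_of_imp fun w hw h => by
                refine ⟨?_, h⟩
                rcases (adj _ _).1 h with h | ⟨-, rfl⟩ | ⟨rfl, -⟩
                · exact absurd h (hTa w)
                · simp
                · exact absurd rfl hne
          _ ≤ 1 := degIn_singleton
      · obtain ⟨v, hv, h⟩ := hT C hC
        refine ⟨v, hv, le_trans (degIn_le_of_imp fun w hw h => ⟨hw, ?_⟩) h⟩
        rcases (adj _ _).1 h with h | ⟨rfl, -⟩ | ⟨-, rfl⟩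
        exacts [h, absurd hv haC, absurd hw haC]
    · intro u v h
      rcases (adj u v).1 h with h | ⟨rfl, rfl⟩ | ⟨rfl, rfl⟩
      · exact ⟨mem_insert_of_mem (hTP _ _ h).1, mem_insert_of_mem (hTP _ _ h).2⟩
      · exact ⟨mem_insert_self _ _, mem_insert_of_mem hbP⟩
      · exact ⟨mem_insert_of_mem hbP, mem_insert_self _ _⟩
    · intro v hv
      have hta : t ≠ a := fun h => ha (h ▸ htP)
      rw [degIn_insert ha]
      rcases mem_insert.1 hv with rfl | hv
      · have h1 : degIn (T ⊔ SimpleGraph.edge v b) P v = 1 := by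
          apply le_antisymm
          · refine le_trans (degIn_le_of_imp (B := {b}) fun w hw h => ⟨?_, h⟩) degIn_singleton
            rcases (adj _ _).1 h with h | ⟨-, rfl⟩ | ⟨rfl, -⟩
            · exact absurd h (hTa w)
            · simp
            · exact absurd rfl hne
          · exact degIn_pos.2 ⟨b, hbP, (adj _ _).2 (by simp)⟩
        simp [h1, hta.symm]
      · have hva : v ≠ a := fun h => ha (h ▸ hv)
        have h1 : degIn (T ⊔ SimpleGraph.edge a b) P v = degIn T P v :=
          degIn_congr fun w => and_congr_right fun hw => by
            rw [adj]
            constructor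
            · rintro (h | ⟨h, -⟩ | ⟨-, rfl⟩)
              exacts [h, absurd h hva, absurd hw ha]
            · exact Or.inl
        have h2 : (T ⊔ SimpleGraph.edge a b).Adj v a ↔ v = b := by
          rw [adj]
          constructor
          · rintro (h | ⟨h, -⟩ | ⟨h, -⟩)
            exacts [absurd h.symm (hTa v), absurd h hva, h]
          · intro h; exact Or.inr (Or.inr ⟨h, rfl⟩)
        rw [h1]
        simp only [h2, if_neg hva, add_zero]
        exact hd v hv

/-- Conversely, such a forest is the edge set of a Hamiltonian path. -/
theorem HamPath.of_forest {G : SimpleGraph U} (hT : IsForest T) :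
    ∀ {P : Finset U} {s t : U}, s ∈ P → t ∈ P → (∀ u ∈ P, ∀ v ∈ P, T.Adj u v → G.Adj u v) →
      (∀ v ∈ P, degIn T P v + (if v = s then 1 else 0) + (if v = t then 1 else 0) = 2) →
      HamPath G P s t := by
  intro P
  induction hn : #P generalizing P with
  | zero => intro s t hs; simp_all
  | succ n ih =>
    intro s t hs ht hG hd
    have hP : insert s (P.erase s) = P := insert_erase hs
    have key : ∀ v, degIn T P v = degIn T (P.erase s) v + (if T.Adj v s then 1 else 0) := by
      intro v
      conv_lhs => rw [← hP]
      exact degIn_insert (by simp)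
    by_cases hst : s = t
    · subst hst
      have h0 : degIn T P s = 0 := by have := hd s hs; simp at this; omega
      rw [degIn_eq_zero] at h0
      have : P.erase s = ∅ := by
        by_contra hne
        refine hT.false_of_two_le (nonempty_iff_ne_empty.2 hne) fun v hv => ?_
        have hv' := mem_erase.1 hv
        have h1 := hd v hv'.2
        have h2 : ¬ T.Adj v s := fun h => h0 v hv'.2 h.symm
        simp only [key, hv'.1, h2, if_false] at h1
        omega
      rw [this] at hP
      exact (HamPath.single s).cast (by simpa using hP)
    · have h1 : degIn T P s = 1 := by have := hd s hs; simp [hst] at this; omega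
      obtain ⟨b, hb⟩ := card_eq_one.1 h1
      have hsb : b ∈ P ∧ T.Adj s b := by
        have : b ∈ ({b} : Finset U) := mem_singleton_self b
        rw [← hb] at this
        simpa using this
      have huniq : ∀ w ∈ P, T.Adj s w → w = b := fun w hw h => by
        have : w ∈ ({b} : Finset U) := by rw [← hb]; simp [hw, h]
        simpa using this
      have hbs : b ≠ s := hsb.2.ne'
      rw [← hP]
      refine .cons (hG _ hs _ hsb.1 hsb.2) (by simp) (ih ?_ ?_ ?_ ?_ ?_)
      · rw [card_erase_of_mem hs, hn]; rfl
      · exact mem_erase.2 ⟨hbs, hsb.1⟩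
      · exact mem_erase.2 ⟨Ne.symm hst, ht⟩
      · exact fun u hu v hv => hG u (mem_of_mem_erase hu) v (mem_of_mem_erase hv)
      · intro v hv
        have hv' := mem_erase.1 hv
        have h2 := hd v hv'.2
        have h3 : T.Adj v s ↔ v = b :=
          ⟨fun h => huniq v hv'.2 h.symm, fun h => h ▸ hsb.2.symm⟩
        simp only [key, h3, hv'.1, if_false] at h2
        omega

end degIn

/-! ### Fragments -/

/-- A fragment of `G`, with vertex set `P` and three terminals `S`. If a new vertex is joined to
the terminals, then `no_path` says that the resulting graph is not Hamiltonian, `del` that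
it becomes Hamiltonian if a vertex other than the new one is deleted. Moreover, each terminal is an
end of a Hamiltonian path of the fragment (`start`). -/
structure IsFragment (G : SimpleGraph U) (P S : Finset U) : Prop where
  subset : S ⊆ P
  card_eq : #S = 3
  inner : ∃ v ∈ P, v ∉ S
  not_adj : ∀ s ∈ S, ∀ t ∈ S, ¬ G.Adj s t
  no_path : ∀ s ∈ S, ∀ t ∈ S, s ≠ t → ¬ HamPath G P s t
  del : ∀ v ∈ P, ∃ s ∈ S, ∃ t ∈ S, s ≠ t ∧ HamPath G (P.erase v) s t
  start : ∀ s ∈ S, ∃ t, HamPath G P s t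

theorem Finset.eq_triple_of_card {S : Finset U} (h : #S = 3) {p q : U} (hp : p ∈ S) (hq : q ∈ S)
    (hpq : p ≠ q) : ∃ r, r ≠ p ∧ r ≠ q ∧ S = {p, q, r} := by
  have h1 : #((S.erase p).erase q) = 1 := by
    rw [card_erase_of_mem (mem_erase.2 ⟨hpq.symm, hq⟩), card_erase_of_mem hp, h]
  obtain ⟨r, hr⟩ := card_eq_one.1 h1
  have hr' : r ∈ (S.erase p).erase q := by rw [hr]; simp
  simp only [mem_erase] at hr'
  refine ⟨r, hr'.2.1, hr'.1, ?_⟩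
  ext x
  have : x ∈ (S.erase p).erase q ↔ x ∈ ({r} : Finset U) := by rw [hr]
  simp only [mem_erase, mem_singleton] at this
  simp only [mem_insert, mem_singleton]
  by_cases h1 : x = p
  · simp [h1, hp]
  · by_cases h2 : x = q
    · simp [h2, hq]
    · simp only [h1, h2, false_or, ← this]; tauto

namespace IsFragment

variable {G H T : SimpleGraph U} {P S A : Finset U} {s t u v w y p q r : U}

theorem congr (h : IsFragment G P S) (e : ∀ u ∈ P, ∀ v ∈ P, G.Adj u v ↔ H.Adj u v) :
    IsFragment H P S where
  subset := h.subset
  card_eq := h.card_eq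
  inner := h.inner
  not_adj s hs t ht a := h.not_adj s hs t ht ((e s (h.subset hs) t (h.subset ht)).2 a)
  no_path s hs t ht hst k := h.no_path s hs t ht hst (k.congr fun u hu v hv => (e u hu v hv).2)
  del v hv := by
    obtain ⟨s, hs, t, ht, hst, k⟩ := h.del v hv
    exact ⟨s, hs, t, ht, hst, k.congr fun u hu v hv =>
      (e u (mem_of_mem_erase hu) v (mem_of_mem_erase hv)).1⟩
  start s hs := by
    obtain ⟨t, k⟩ := h.start s hs
    exact ⟨t, k.congr fun u hu v hv => (e u hu v hv).1⟩

theorem map {W : Type*} [DecidableEq W] (h : IsFragment G P S) (f : U ↪ W) :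
    IsFragment (G.map f) (P.map f) (S.map f) where
  subset := Finset.map_subset_map.2 h.subset
  card_eq := by rw [card_map, h.card_eq]
  inner := by
    obtain ⟨v, hv, hvS⟩ := h.inner
    exact ⟨f v, by simpa using hv, by simpa using hvS⟩
  not_adj := by
    simp only [mem_map, forall_exists_index, and_imp]
    rintro _ s hs rfl _ t ht rfl
    simpa using h.not_adj s hs t ht
  no_path := by
    simp only [mem_map, forall_exists_index, and_imp]
    rintro _ s hs rfl _ t ht rfl hst k
    exact h.no_path s hs t ht (fun e => hst (e ▸ rfl)) (k.of_map f rfl rfl rfl)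
  del := by
    simp only [mem_map, forall_exists_index, and_imp]
    rintro _ v hv rfl
    obtain ⟨s, hs, t, ht, hst, k⟩ := h.del v hv
    exact ⟨f s, ⟨s, hs, rfl⟩, f t, ⟨t, ht, rfl⟩, by simpa using hst,
      (k.map f).cast (by rw [Finset.map_erase])⟩
  start := by
    simp only [mem_map, forall_exists_index, and_imp]
    rintro _ s hs rfl
    obtain ⟨t, k⟩ := h.start s hs
    exact ⟨f t, k.map f⟩

/-- After the deletion of a terminal, the other two are joined by a Hamiltonian path. -/
theorem path_of_terminal (h : IsFragment G P S) (hS : S = {p, q, r}) :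
    HamPath G (P.erase r) p q := by
  have hr : r ∈ P := h.subset (by simp [hS])
  obtain ⟨s, hs, t, ht, hst, k⟩ := h.del r hr
  have h1 := (mem_erase.1 k.left_mem).1
  have h2 := (mem_erase.1 k.right_mem).1
  simp only [hS, mem_insert, mem_singleton] at hs ht
  rcases hs with rfl | rfl | rfl <;> rcases ht with rfl | rfl | rfl <;>
    first | exact k | exact k.symm | contradiction

/-- In a fragment which contains no end of a Hamiltonian path of the whole graph, the path misses
all edges at one terminal, and it joins the other two. -/
theorem exists_isolated (h : IsFragment G P S) (hT : IsForest T)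
    (hG : ∀ u ∈ P, ∀ v ∈ P, T.Adj u v → G.Adj u v) (hd : ∀ v ∈ P, v ∉ S → degIn T P v = 2)
    (hS : ∀ v ∈ S, degIn T P v ≤ 2) :
    ∃ p q r, S = {p, q, r} ∧ p ≠ q ∧ r ≠ p ∧ r ≠ q ∧ degIn T P p = 1 ∧ degIn T P q = 1 ∧
      degIn T P r = 0 := by
  -- not all terminals have degree zero or two, because the inner vertices have degree two
  have h02 : ¬ ∀ v ∈ S, degIn T P v = 0 ∨ degIn T P v = 2 := by
    intro h0
    obtain ⟨x, hx, hxS⟩ := h.inner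
    have hall : ∀ v ∈ P, degIn T P v = 0 ∨ degIn T P v = 2 := fun v hv => by
      by_cases hvS : v ∈ S
      exacts [h0 v hvS, Or.inr (hd v hv hvS)]
    refine hT.false_of_two_le (C := {v ∈ P | degIn T P v ≠ 0}) ⟨x, ?_⟩ fun v hv => ?_
    · simp [hx, hd x hx hxS]
    · have hv := mem_filter.1 hv
      have h2 : degIn T P v = 2 := (hall v hv.1).resolve_left hv.2
      rw [← h2]
      refine degIn_le_of_imp fun w hw a => ⟨mem_filter.2 ⟨hw, ?_⟩, a⟩
      exact (degIn_pos.2 ⟨v, hv.1, a.symm⟩).ne'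
  -- two terminals of degree one and one of degree two would give a forbidden path
  have h112 : ∀ p q r, S = {p, q, r} → p ≠ q → r ≠ p → r ≠ q → degIn T P p = 1 →
      degIn T P q = 1 → degIn T P r ≠ 2 := by
    intro p q r hS' hpq hrp hrq h1 h2 h3
    have hp : p ∈ S := by simp [hS']
    have hq : q ∈ S := by simp [hS']
    refine h.no_path p hp q hq hpq (HamPath.of_forest hT (h.subset hp) (h.subset hq) hG ?_)
    intro v hv
    by_cases hvS : v ∈ S
    · simp only [hS', mem_insert, mem_singleton] at hvS
      rcases hvS with rfl | rfl | rfl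
      · simp [h1, hpq]
      · simp [h2, hpq.symm]
      · simp [h3, hrp, hrq]
    · have h4 : v ≠ p := fun e => hvS (e ▸ hp)
      have h5 : v ≠ q := fun e => hvS (e ▸ hq)
      simp [h4, h5, hd v hv hvS]
  obtain ⟨x, y, z, hxy, hxz, hyz, rfl⟩ := card_eq_three.1 h.card_eq
  have hpar : Even (degIn T P x + degIn T P y + degIn T P z) := by
    have h1 := even_sum_degIn (T := T) (Q := P)
    rw [← sum_sdiff h.subset, sum_congr rfl (g := fun _ => 2)] at h1
    · rw [sum_insert (by simp [hxy, hxz]), sum_insert (by simp [hyz]), sum_singleton] at h1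
      rw [sum_const, smul_eq_mul, Nat.even_add] at h1
      rw [add_assoc]
      exact h1.1 (Even.mul_left even_two _)
    · intro v hv
      exact hd v (mem_sdiff.1 hv).1 (mem_sdiff.1 hv).2
  have hx := hS x (by simp)
  have hy := hS y (by simp)
  have hz := hS z (by simp)
  have e1 : ({x, y, z} : Finset U) = {x, z, y} := by ext; simp; tauto
  have e2 : ({x, y, z} : Finset U) = {y, z, x} := by ext; simp; tauto
  have h1 := h112 x y z rfl hxy hxz.symm hyz.symm
  have h2 := h112 x z y e1 hxz hxy.symm hyz
  have h3 := h112 y z x e2 hyz hxy hxz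
  simp only [mem_insert, mem_singleton, forall_eq_or_imp, forall_eq] at h02
  rw [Nat.even_iff] at hpar
  generalize hdx : degIn T P x = dx at *
  generalize hdy : degIn T P y = dy at *
  generalize hdz : degIn T P z = dz at *
  have : (dx = 1 ∧ dy = 1 ∧ dz = 0) ∨ (dx = 1 ∧ dz = 1 ∧ dy = 0) ∨
      (dy = 1 ∧ dz = 1 ∧ dx = 0) := by
    interval_cases dx <;> interval_cases dy <;> interval_cases dz <;> simp_all
  rcases this with ⟨a, b, c⟩ | ⟨a, b, c⟩ | ⟨a, b, c⟩
  · exact ⟨x, y, z, rfl, hxy, hxz.symm, hyz.symm, hdx.trans a, hdy.trans b, hdz.trans c⟩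
  · exact ⟨x, z, y, e1, hxz, hxy.symm, hyz, hdx.trans a, hdz.trans b, hdy.trans c⟩
  · exact ⟨y, z, x, e2, hyz, hxy, hxz, hdy.trans a, hdz.trans b, hdx.trans c⟩

end IsFragment

/-! ### Substitution of a fragment for a cubic vertex -/

/-- A fragment with an inner vertex `y` whose neighbors are the three vertices of `N`, to be
replaced by another fragment with terminals `N`. The path in `start_ne` does not end in `y`, so it
passes through two vertices of `N` next to `y` and can be rerouted through the new fragment. -/
structure IsHost (G : SimpleGraph U) (P S : Finset U) (y : U) (N : Finset U) : Prop
    extends IsFragment G P S where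
  mem : y ∈ P
  notMem : y ∉ S
  adj_iff : ∀ w ∈ P, G.Adj y w ↔ w ∈ N
  nbr_subset : N ⊆ P
  card_nbr : #N = 3
  disjoint : Disjoint S N
  nbr_not_adj : ∀ u ∈ N, ∀ v ∈ N, ¬ G.Adj u v
  start_ne : ∀ s ∈ S, ∃ t, t ≠ y ∧ HamPath G P s t

theorem IsHost.map {W : Type*} [DecidableEq W] {G : SimpleGraph U} {P S N : Finset U} {y : U}
    (h : IsHost G P S y N) (f : U ↪ W) :
    IsHost (G.map f) (P.map f) (S.map f) (f y) (N.map f) where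
  toIsFragment := h.toIsFragment.map f
  mem := by simpa using h.mem
  notMem := by simpa using h.notMem
  adj_iff := by
    simp only [mem_map, forall_exists_index, and_imp]
    rintro _ w hw rfl
    simpa using h.adj_iff w hw
  nbr_subset := Finset.map_subset_map.2 h.nbr_subset
  card_nbr := by rw [card_map, h.card_nbr]
  disjoint := (Finset.disjoint_map f).2 h.disjoint
  nbr_not_adj := by
    simp only [mem_map, forall_exists_index, and_imp]
    rintro _ s hs rfl _ t ht rfl
    simpa using h.nbr_not_adj s hs t ht
  start_ne := by
    simp only [mem_map, forall_exists_index, and_imp]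
    rintro _ s hs rfl
    obtain ⟨t, ht, k⟩ := h.start_ne s hs
    exact ⟨f t, by simpa using ht, k.map f⟩

/-- The graph `G` without the edges at `y`. -/
def SimpleGraph.isolate (G : SimpleGraph U) (y : U) : SimpleGraph U where
  Adj u v := G.Adj u v ∧ u ≠ y ∧ v ≠ y
  symm := ⟨fun _ _ h => ⟨h.1.symm, h.2.2, h.2.1⟩⟩
  loopless := ⟨fun _ h => h.1.ne rfl⟩

section subst

variable {G₁ G₂ : SimpleGraph U} {P₁ P₂ S N : Finset U} {y : U}

/-- A Hamiltonian path of a host through `y` enters and leaves `y` through two vertices `p` and `q`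
of `N`, and the passage through `y` may be replaced by any path from `p` to `q`. -/
theorem HamPath.reroute {G : SimpleGraph U} {Q : Finset U} {s t : U}
    (h : HamPath G₁ Q s t) (hy : y ∈ Q) (hs : s ≠ y) (ht : t ≠ y)
    (hadj : ∀ w ∈ Q, G₁.Adj y w → w ∈ N)
    (hG₁ : ∀ u ∈ Q, ∀ v ∈ Q, u ≠ y → v ≠ y → G₁.Adj u v → G.Adj u v) :
    ∃ p ∈ N, ∃ q ∈ N, p ∈ Q ∧ q ∈ Q ∧ p ≠ q ∧ ∀ R, HamPath G R p q →
      (∀ v ∈ R, v ∈ Q → v ≠ y → v = p ∨ v = q) → HamPath G (Q.erase y ∪ R) s t := by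
  obtain ⟨A, B, p, q, hp, hq, hA, hB, hAB, hun⟩ := h.split hy hs.symm ht.symm
  have hsub : ∀ v, v ∈ A ∨ v ∈ B → v ≠ y ∧ v ∈ Q := fun v hv => by
    have : v ∈ Q.erase y := by rw [← hun]; exact mem_union.2 hv
    exact mem_erase.1 this
  have hpA := hA.right_mem
  have hqB := hB.left_mem
  have hpq : p ≠ q := fun e => disjoint_left.1 hAB hpA (e ▸ hqB)
  have hA' : HamPath G A s p := hA.congr fun u hu v hv =>
    hG₁ u (hsub u (.inl hu)).2 v (hsub v (.inl hv)).2 (hsub u (.inl hu)).1 (hsub v (.inl hv)).1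
  have hB' : HamPath G B q t := hB.congr fun u hu v hv =>
    hG₁ u (hsub u (.inr hu)).2 v (hsub v (.inr hv)).2 (hsub u (.inr hu)).1 (hsub v (.inr hv)).1
  refine ⟨p, hadj p (hsub p (.inl hpA)).2 hp.symm, q, hadj q (hsub q (.inr hqB)).2 hq,
    (hsub p (.inl hpA)).2, (hsub q (.inr hqB)).2, hpq, fun R k hk => ?_⟩
  refine ((hA'.trans k fun v hv hv' => ?_).trans hB' fun v hv hv' => ?_).cast ?_
  · rcases hk v hv' (hsub v (.inl hv)).2 (hsub v (.inl hv)).1 with h | h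
    · exact h
    · exact absurd hqB (disjoint_left.1 hAB (h ▸ hv))
  · rcases mem_union.1 hv with hv | hv
    · exact absurd hv' (disjoint_left.1 hAB hv)
    · rcases hk v hv (hsub v (.inr hv')).2 (hsub v (.inr hv')).1 with h | h
      · exact absurd (h ▸ hv') (disjoint_left.1 hAB hpA)
      · exact h
  · rw [← hun]; ext x; simp only [mem_union]; tauto

theorem IsFragment.subst_adj_left (h₂ : IsFragment G₂ P₂ N)
    (supp₂ : ∀ u v, G₂.Adj u v → u ∈ P₂) (hN : ∀ v ∈ P₁, v ∈ P₂ → v ≠ y → v ∈ N) :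
    ∀ u ∈ P₁, ∀ v ∈ P₁, u ≠ y → v ≠ y → ((G₁.isolate y ⊔ G₂).Adj u v ↔ G₁.Adj u v) := by
  intro u hu v hv huy hvy
  refine ⟨?_, fun h => .inl ⟨h, huy, hvy⟩⟩
  rintro (h | h)
  · exact h.1
  · exact absurd h (h₂.not_adj u (hN u hu (supp₂ _ _ h) huy) v
      (hN v hv (supp₂ _ _ h.symm) hvy))

theorem IsHost.subst_adj_right (h₁ : IsHost G₁ P₁ S y N)
    (supp₁ : ∀ u v, G₁.Adj u v → u ∈ P₁) (hN : ∀ v ∈ P₁, v ∈ P₂ → v ≠ y → v ∈ N) :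
    ∀ u ∈ P₂, ∀ v ∈ P₂, ((G₁.isolate y ⊔ G₂).Adj u v ↔ G₂.Adj u v) := by
  intro u hu v hv
  refine ⟨?_, .inr⟩
  rintro (h | h)
  · exact absurd h.1 (h₁.nbr_not_adj u (hN u (supp₁ _ _ h.1) hu h.2.1) v
      (hN v (supp₁ _ _ h.1.symm) hv h.2.2))
  · exact h

theorem IsHost.mem_erase_of_mem_nbr (h₁ : IsHost G₁ P₁ S y N) {v : U} (hv : v ∈ N) :
    v ≠ y ∧ v ∈ P₁ :=
  ⟨fun e => (h₁.adj_iff y h₁.mem).2 (e ▸ hv) |>.ne rfl, h₁.nbr_subset hv⟩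

/-- No two terminals of the host are joined by a Hamiltonian path after `y` has been replaced: the
ends of such a path lie outside the new fragment, so the path leaves one vertex `r` of `N` isolated
in the fragment and passes through the rest of it between the other two, `p` and `q`. Contracting
this part to the path `p`, `y`, `q` gives a forbidden path of the host. -/
theorem IsHost.subst_no_path (h₁ : IsHost G₁ P₁ S y N) (h₂ : IsFragment G₂ P₂ N)
    (supp₁ : ∀ u v, G₁.Adj u v → u ∈ P₁) (supp₂ : ∀ u v, G₂.Adj u v → u ∈ P₂)
    (hN : ∀ v ∈ P₁, v ∈ P₂ → v ≠ y → v ∈ N) :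
    ∀ s ∈ S, ∀ t ∈ S, s ≠ t → ¬ HamPath (G₁.isolate y ⊔ G₂) (P₁.erase y ∪ P₂) s t := by
  have hyN : y ∉ N := fun h => (h₁.adj_iff y h₁.mem).2 h |>.ne rfl
  have adj₁ := h₂.subst_adj_left (G₁ := G₁) supp₂ hN
  have h₂' : IsFragment (G₁.isolate y ⊔ G₂) P₂ N := h₂.congr fun u hu v hv =>
    (h₁.subst_adj_right supp₁ hN u hu v hv).symm
  have hSy : ∀ s ∈ S, s ≠ y := fun s hs e => h₁.notMem (e ▸ hs)
  have hSP₂ : ∀ s ∈ S, s ∉ P₂ := fun s hs h =>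
    disjoint_left.1 h₁.disjoint hs (hN s (h₁.subset hs) h (hSy s hs))
  have hNy : ∀ v ∈ N, v ∈ P₁.erase y := fun v hv => mem_erase.2 (h₁.mem_erase_of_mem_nbr hv)
  intro s hs t ht hst k
  obtain ⟨T, hTG, hT, -, hd⟩ := k.exists_forest
  have hTadj : ∀ {u v}, T.Adj u v → (G₁.isolate y).Adj u v ∨ G₂.Adj u v := fun h => hTG h
  have hmono : ∀ v, degIn T P₂ v ≤ degIn T (P₁.erase y ∪ P₂) v := fun v =>
    degIn_mono subset_union_right
  have hdle : ∀ v ∈ P₂, degIn T P₂ v ≤ 2 := fun v hv => by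
    have := hd v (mem_union_right _ hv)
    have := hmono v
    omega
  have hPN : ∀ v ∈ P₂, v ∉ N → ∀ w, T.Adj v w → w ∈ P₂ := by
    intro v hv hvN w a
    rcases hTadj a with a | a
    · exact absurd (hN v (supp₁ _ _ a.1) hv a.2.1) hvN
    · exact supp₂ _ _ a.symm
  have hPN₁ : ∀ v ∈ P₁.erase y, v ∉ N → ∀ w, T.Adj v w → w ∈ P₁.erase y := by
    intro v hv hvN w a
    have hv' := mem_erase.1 hv
    rcases hTadj a with a | a
    · exact mem_erase.2 ⟨a.2.2, supp₁ _ _ a.1.symm⟩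
    · exact absurd (hN v hv'.2 (supp₂ _ _ a) hv'.1) hvN
  obtain ⟨p, q, r, hNe, hpq, hrp, hrq, hp1, hq1, hr0⟩ := h₂'.exists_isolated hT
    (fun u _ v _ a => hTG a) (fun v hv hvN => by
      have h1 := hd v (mem_union_right _ hv)
      have h2 : v ≠ s := fun e => hSP₂ s hs (e ▸ hv)
      have h3 : v ≠ t := fun e => hSP₂ t ht (e ▸ hv)
      rw [if_neg h2, if_neg h3] at h1
      rw [← h1]
      exact degIn_congr fun w => and_congr_left fun a =>
        ⟨fun h => mem_union_right _ h, fun _ => hPN v hv hvN w a⟩)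
    (fun v hv => hdle v (h₂.subset hv))
  have hpN : p ∈ N := by simp [hNe]
  have hqN : q ∈ N := by simp [hNe]
  have hrN : r ∈ N := by simp [hNe]
  have hpy : p ≠ y := fun e => hyN (e ▸ hpN)
  have hqy : q ≠ y := fun e => hyN (e ▸ hqN)
  -- the edges of the path outside the new fragment, together with the edges `yp` and `yq`
  let T₁ : SimpleGraph U :=
    { Adj u v := (T.Adj u v ∧ u ∈ P₁.erase y ∧ v ∈ P₁.erase y) ∨
        (u = y ∧ (v = p ∨ v = q)) ∨ (v = y ∧ (u = p ∨ u = q))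
      symm := ⟨fun u v h => by
        rcases h with ⟨h1, h2, h3⟩ | h | h
        exacts [.inl ⟨h1.symm, h3, h2⟩, .inr (.inr h), .inr (.inl h)]⟩
      loopless := ⟨fun u h => by
        rcases h with ⟨h1, -⟩ | ⟨rfl, h | h⟩ | ⟨rfl, h | h⟩
        exacts [h1.ne rfl, hpy h.symm, hqy h.symm, hpy h.symm, hqy h.symm]⟩ }
  have hT₁y : ∀ w, T₁.Adj y w ↔ w = p ∨ w = q := fun w => by
    constructor
    · rintro (⟨-, h, -⟩ | ⟨-, h⟩ | ⟨rfl, h | h⟩)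
      exacts [absurd rfl (mem_erase.1 h).1, h, absurd h.symm hpy, absurd h.symm hqy]
    · exact fun h => .inr (.inl ⟨rfl, h⟩)
  have hT₁ne : ∀ {u v}, u ≠ y → v ≠ y → T₁.Adj u v →
      T.Adj u v ∧ u ∈ P₁.erase y ∧ v ∈ P₁.erase y := by
    rintro u v hu hv (h | ⟨h, -⟩ | ⟨h, -⟩)
    exacts [h, absurd h hu, absurd h hv]
  have hT₁v : ∀ v ∈ P₁.erase y, degIn T₁ P₁ v =
      degIn T (P₁.erase y) v + (if v = p ∨ v = q then 1 else 0) := by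
    intro v hv
    have hvy := (mem_erase.1 hv).1
    have : P₁ = insert y (P₁.erase y) := (insert_erase h₁.mem).symm
    conv_lhs => rw [this]
    rw [degIn_insert (by simp)]
    congr 1
    · exact degIn_congr fun w => and_congr_right fun hw =>
        ⟨fun h => (hT₁ne hvy (mem_erase.1 hw).1 h).1, fun h => .inl ⟨h, hv, hw⟩⟩
    · have : T₁.Adj v y ↔ v = p ∨ v = q := by rw [T₁.adj_comm]; exact hT₁y v
      simp only [this]
  have hdeg : ∀ v ∈ N, degIn T (P₁.erase y ∪ P₂) v =
      degIn T (P₁.erase y) v + degIn T P₂ v := by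
    intro v hv
    refine degIn_union_of subset_union_left subset_union_right (fun w hw _ => mem_union.1 hw) ?_
    intro w hw hw' a
    have hw2 := mem_erase.1 hw
    have hwN := hN w hw2.2 hw' hw2.1
    exact h₂'.not_adj v hv w hwN (hTG a)
  -- a cycle through `y` would be a cycle of the path once `y` is replaced by the new fragment
  -- without `r`; other cycles are in `T` already
  have hTT₁ : IsForest T₁ := by
    intro C hC
    by_contra! hlt
    by_cases hyC : y ∈ C
    · have hpqC : p ∈ C ∧ q ∈ C := by
        have h1 := hlt y hyC
        by_contra hne
        have : degIn T₁ C y ≤ 1 := by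
          by_cases hpC : p ∈ C
          · refine le_trans (degIn_le_of_imp (B := {p}) fun w hw a => ⟨?_, a⟩) degIn_singleton
            rcases (hT₁y w).1 a with rfl | rfl
            exacts [by simp, absurd ⟨hpC, hw⟩ hne]
          · refine le_trans (degIn_le_of_imp (B := {q}) fun w hw a => ⟨?_, a⟩) degIn_singleton
            rcases (hT₁y w).1 a with rfl | rfl
            exacts [absurd hw hpC, by simp]
        omega
      refine hT.false_of_two_le (C := C.erase y ∪ P₂.erase r)
        ⟨p, mem_union_left _ (mem_erase.2 ⟨hpy, hpqC.1⟩)⟩ ?_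
      -- no edge of the path inside the fragment ends in `r`
      have hr : ∀ v ∈ P₂, ∀ w ∈ P₂, T.Adj v w → w ∈ P₂.erase r := fun v hv w hw a =>
        mem_erase.2 ⟨fun e => degIn_eq_zero.1 hr0 v hv (e ▸ a.symm), hw⟩
      have hpq' : ∀ v, v = p ∨ v = q → v ∈ C → degIn T P₂ v = 1 →
          2 ≤ degIn T (C.erase y ∪ P₂.erase r) v := by
        intro v hvpq hvC hv1
        have hvN : v ∈ N := by rcases hvpq with rfl | rfl <;> assumption
        have hvy := (mem_erase.1 (hNy v hvN)).1
        have h1 := hlt v hvC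
        rw [← insert_erase hyC, degIn_insert (by simp)] at h1
        have h2 : degIn T₁ (C.erase y) v ≤ degIn T (C.erase y ∩ P₁) v :=
          degIn_le_of_imp fun w hw a => by
            have h3 := hT₁ne hvy (mem_erase.1 hw).1 a
            exact ⟨mem_inter.2 ⟨hw, (mem_erase.1 h3.2.2).2⟩, h3.1⟩
        have h3 : degIn T P₂ v ≤ degIn T (P₂.erase r) v := degIn_le_of_imp fun w hw a =>
          ⟨hr v (h₂.subset hvN) w hw a, a⟩
        have h4 : degIn T (C.erase y ∩ P₁ ∪ P₂.erase r) v =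
            degIn T (C.erase y ∩ P₁) v + degIn T (P₂.erase r) v := by
          refine degIn_union_of subset_union_left subset_union_right
            (fun w hw _ => mem_union.1 hw) ?_
          intro w hw hw' a
          have hw2 := mem_inter.1 hw
          have hwN := hN w hw2.2 (mem_of_mem_erase hw') (mem_erase.1 hw2.1).1
          exact h₂'.not_adj v hvN w hwN (hTG a)
        have h5 : degIn T (C.erase y ∩ P₁ ∪ P₂.erase r) v ≤
            degIn T (C.erase y ∪ P₂.erase r) v :=
          degIn_mono (union_subset_union inter_subset_left (Subset.refl _))
        split_ifs at h1 <;> omega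
      intro v hv
      by_cases hvpq : v = p ∨ v = q
      · rcases hvpq with rfl | rfl
        · exact hpq' v (.inl rfl) hpqC.1 hp1
        · exact hpq' v (.inr rfl) hpqC.2 hq1
      · rcases mem_union.1 hv with hv | hv
        · have hv' := mem_erase.1 hv
          refine le_trans (hlt v hv'.2) (degIn_le_of_imp fun w hw a => ?_)
          have hwy : w ≠ y := fun e => hvpq ((hT₁y v).1 (e ▸ a.symm))
          exact ⟨mem_union_left _ (mem_erase.2 ⟨hwy, hw⟩), (hT₁ne hv'.1 hwy a).1⟩
        · have hv' := mem_erase.1 hv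
          have hvN : v ∉ N := fun h => by
            simp only [hNe, mem_insert, mem_singleton] at h
            tauto
          have h1 := hd v (mem_union_right _ hv'.2)
          have h2 : v ≠ s := fun e => hSP₂ s hs (e ▸ hv'.2)
          have h3 : v ≠ t := fun e => hSP₂ t ht (e ▸ hv'.2)
          rw [if_neg h2, if_neg h3] at h1
          refine le_trans h1.ge (degIn_le_of_imp fun w hw a => ?_)
          exact ⟨mem_union_right _ (hr v hv'.2 w (hPN v hv'.2 hvN w a) a), a⟩
    · refine hT.false_of_two_le hC fun v hv => le_trans (hlt v hv) ?_
      have hvy : v ≠ y := fun e => hyC (e ▸ hv)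
      exact degIn_le_of_imp fun w hw a => ⟨hw, (hT₁ne hvy (fun e => hyC (e ▸ hw)) a).1⟩
  refine h₁.no_path s hs t ht hst
    (HamPath.of_forest hTT₁ (h₁.subset hs) (h₁.subset ht) ?_ ?_)
  · intro u hu v hv a
    rcases a with ⟨a, hu', hv'⟩ | ⟨rfl, h⟩ | ⟨rfl, h⟩
    · exact (adj₁ u hu v hv (mem_erase.1 hu').1 (mem_erase.1 hv').1).1 (hTG a)
    · exact (h₁.adj_iff v hv).2 (by rcases h with rfl | rfl <;> assumption)
    · exact ((h₁.adj_iff u hu).2 (by rcases h with rfl | rfl <;> assumption)).symm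
  · intro v hv
    by_cases hvy : v = y
    · subst hvy
      rw [if_neg (hSy s hs).symm, if_neg (hSy t ht).symm]
      have : degIn T₁ P₁ v = #({p, q} : Finset U) := by
        unfold degIn
        congr 1
        ext w
        simp only [mem_filter, hT₁y, mem_insert, mem_singleton, and_iff_right_iff_imp]
        rintro (rfl | rfl)
        exacts [h₁.nbr_subset hpN, h₁.nbr_subset hqN]
      rw [this, card_pair hpq]
    · have hv' : v ∈ P₁.erase y := mem_erase.2 ⟨hvy, hv⟩
      have h1 := hd v (mem_union_left _ hv')
      rw [hT₁v v hv']
      by_cases hvN : v ∈ N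
      · rw [hdeg v hvN] at h1
        simp only [hNe, mem_insert, mem_singleton] at hvN
        rcases hvN with rfl | rfl | rfl
        · rw [hp1] at h1; simpa using h1
        · rw [hq1] at h1; simpa using h1
        · rw [hr0] at h1; simpa [hrp, hrq] using h1
      · have h2 : ¬ (v = p ∨ v = q) := by rintro (rfl | rfl) <;> contradiction
        have h3 : degIn T (P₁.erase y ∪ P₂) v = degIn T (P₁.erase y) v :=
          degIn_congr fun w => and_congr_left fun a =>
            ⟨fun _ => hPN₁ v hv' hvN w a, fun h => mem_union_left _ h⟩
        rw [if_neg h2, ← h3]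
        exact h1

/-- Replacing a cubic vertex of a fragment by a fragment gives a fragment. -/
theorem IsHost.subst (h₁ : IsHost G₁ P₁ S y N) (h₂ : IsFragment G₂ P₂ N)
    (supp₁ : ∀ u v, G₁.Adj u v → u ∈ P₁) (supp₂ : ∀ u v, G₂.Adj u v → u ∈ P₂)
    (hN : ∀ v ∈ P₁, v ∈ P₂ → v ≠ y → v ∈ N) :
    IsFragment (G₁.isolate y ⊔ G₂) (P₁.erase y ∪ P₂) S := by
  have adj₁ := h₂.subst_adj_left (G₁ := G₁) supp₂ hN
  have h₂' : IsFragment (G₁.isolate y ⊔ G₂) P₂ N := h₂.congr fun u hu v hv =>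
    (h₁.subst_adj_right supp₁ hN u hu v hv).symm
  have hSy : ∀ s ∈ S, s ≠ y := fun s hs e => h₁.notMem (e ▸ hs)
  have hNy : ∀ v ∈ N, v ∈ P₁.erase y := fun v hv => mem_erase.2 (h₁.mem_erase_of_mem_nbr hv)
  have reroute : ∀ Q ⊆ P₁, y ∈ Q → ∀ s t, HamPath G₁ Q s t → s ≠ y → t ≠ y →
      ∃ p ∈ N, ∃ q ∈ N, p ∈ Q ∧ q ∈ Q ∧ p ≠ q ∧ ∀ R, HamPath (G₁.isolate y ⊔ G₂) R p q →
        (∀ v ∈ R, v ∈ Q → v ≠ y → v = p ∨ v = q) →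
        HamPath (G₁.isolate y ⊔ G₂) (Q.erase y ∪ R) s t :=
    fun Q hQ hyQ s t k hs ht => k.reroute hyQ hs ht
      (fun w hw a => (h₁.adj_iff w (hQ hw)).1 a)
      (fun u hu v hv huy hvy => (adj₁ u (hQ hu) v (hQ hv) huy hvy).2)
  refine ⟨?_, h₁.card_eq, ?_, ?_, h₁.subst_no_path h₂ supp₁ supp₂ hN, ?_, ?_⟩
  · exact fun s hs => mem_union_left _ (mem_erase.2 ⟨hSy s hs, h₁.subset hs⟩)
  · obtain ⟨v, hv⟩ := card_pos.1 (by rw [h₁.card_nbr]; norm_num : 0 < #N)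
    exact ⟨v, mem_union_left _ (hNy v hv), fun h => disjoint_left.1 h₁.disjoint h hv⟩
  · intro s hs t ht a
    exact h₁.not_adj s hs t ht
      ((adj₁ s (h₁.subset hs) t (h₁.subset ht) (hSy s hs) (hSy t ht)).1 a)
  · intro v hv
    by_cases hv₁ : v ∈ P₁.erase y
    · -- a vertex of the host is deleted: pass through the fragment without its third terminal
      have hv' := mem_erase.1 hv₁
      obtain ⟨s, hs, t, ht, hst, k⟩ := h₁.del v hv'.2
      refine ⟨s, hs, t, ht, hst, ?_⟩
      obtain ⟨p, hp, q, hq, hpQ, hqQ, hpq, h⟩ := reroute _ (erase_subset v P₁)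
        (mem_erase.2 ⟨Ne.symm hv'.1, h₁.mem⟩) s t k (hSy s hs) (hSy t ht)
      obtain ⟨r, hrp, hrq, hNe⟩ := Finset.eq_triple_of_card h₁.card_nbr hp hq hpq
      have hrN : r ∈ N := by simp [hNe]
      have hr := mem_erase.1 (hNy r hrN)
      refine (h _ (h₂'.path_of_terminal hNe) fun x hx hxQ hxy => ?_).cast ?_
      · have hx' := mem_erase.1 hx
        have h2 := hN x (mem_of_mem_erase hxQ) hx'.2 hxy
        simp only [hNe, mem_insert, mem_singleton] at h2
        exact h2.imp_right fun h3 => h3.resolve_right hx'.1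
      · have hv₂ : v ∈ P₂ → v = r := fun h => by
          have h2 := hN v hv'.2 h hv'.1
          simp only [hNe, mem_insert, mem_singleton] at h2
          rcases h2 with e | e | e
          exacts [absurd e (mem_erase.1 hpQ).1.symm, absurd e (mem_erase.1 hqQ).1.symm, e]
        ext x
        simp only [mem_union, mem_erase]
        constructor
        · rintro (⟨h3, h4, h5⟩ | ⟨h3, h4⟩)
          · exact ⟨h4, .inl ⟨h3, h5⟩⟩
          · exact ⟨fun e => h3 (e.trans (hv₂ (e ▸ h4))), .inr h4⟩
        · rintro ⟨h3, ⟨h4, h5⟩ | h4⟩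
          · exact .inl ⟨h4, h3, h5⟩
          · by_cases hxr : x = r
            · exact .inl ⟨hxr ▸ hr.1, h3, hxr ▸ hr.2⟩
            · exact .inr ⟨hxr, h4⟩
    · -- an inner vertex of the fragment is deleted: the host path avoids the third terminal
      have hv₂ : v ∈ P₂ := (mem_union.1 hv).resolve_left hv₁
      obtain ⟨p, hp, q, hq, hpq, k⟩ := h₂'.del v hv₂
      obtain ⟨r, hrp, hrq, hNe⟩ := Finset.eq_triple_of_card h₁.card_nbr hp hq hpq
      have hrN : r ∈ N := by simp [hNe]
      have hr := mem_erase.1 (hNy r hrN)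
      obtain ⟨s, hs, t, ht, hst, k'⟩ := h₁.del r hr.2
      refine ⟨s, hs, t, ht, hst, ?_⟩
      obtain ⟨p', hp', q', hq', hpQ, hqQ, hpq', h⟩ := reroute _ (erase_subset r P₁)
        (mem_erase.2 ⟨hr.1.symm, h₁.mem⟩) s t k' (hSy s hs) (hSy t ht)
      have hpr := (mem_erase.1 hpQ).1
      have hqr := (mem_erase.1 hqQ).1
      have hpq'' : (p' = p ∧ q' = q) ∨ (p' = q ∧ q' = p) := by
        simp only [hNe, mem_insert, mem_singleton] at hp' hq'
        rcases hp' with rfl | rfl | rfl <;> rcases hq' with rfl | rfl | rfl <;> tauto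
      have hk : HamPath (G₁.isolate y ⊔ G₂) (P₂.erase v) p' q' := by
        rcases hpq'' with ⟨rfl, rfl⟩ | ⟨rfl, rfl⟩
        exacts [k, k.symm]
      refine (h _ hk fun x hx hxQ hxy => ?_).cast ?_
      · have h2 := hN x (mem_of_mem_erase hxQ) (mem_of_mem_erase hx) hxy
        have h3 := (mem_erase.1 hxQ).1
        simp only [hNe, mem_insert, mem_singleton] at h2
        rcases hpq'' with ⟨rfl, rfl⟩ | ⟨rfl, rfl⟩ <;> tauto
      · have hrv : r ≠ v := fun e => hv₁ (e ▸ hNy r hrN)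
        have hrP₂ := h₂.subset hrN
        ext x
        simp only [mem_union, mem_erase]
        constructor
        · rintro (⟨h3, h4, h5⟩ | ⟨h3, h4⟩)
          · exact ⟨fun e => hv₁ (e ▸ mem_erase.2 ⟨h3, h5⟩), .inl ⟨h3, h5⟩⟩
          · exact ⟨h3, .inr h4⟩
        · rintro ⟨h3, ⟨h4, h5⟩ | h4⟩
          · by_cases hxr : x = r
            · exact .inr ⟨h3, hxr ▸ hrP₂⟩
            · exact .inl ⟨h4, hxr, h5⟩
          · exact .inr ⟨h3, h4⟩
  · -- a path from a terminal: again the fragment is passed without its third terminal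
    intro s hs
    obtain ⟨t, hty, k⟩ := h₁.start_ne s hs
    refine ⟨t, ?_⟩
    obtain ⟨p, hp, q, hq, hpQ, hqQ, hpq, h⟩ := reroute _ (Subset.refl _) h₁.mem s t k (hSy s hs) hty
    obtain ⟨r, hrp, hrq, hNe⟩ := Finset.eq_triple_of_card h₁.card_nbr hp hq hpq
    have hr := mem_erase.1 (hNy r (by simp [hNe]))
    refine (h _ (h₂'.path_of_terminal hNe) fun x hx hxQ hxy => ?_).cast ?_
    · have hx' := mem_erase.1 hx
      have h2 := hN x hxQ hx'.2 hxy
      simp only [hNe, mem_insert, mem_singleton] at h2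
      exact h2.imp_right fun h3 => h3.resolve_right hx'.1
    · ext x
      simp only [mem_union, mem_erase]
      by_cases hxr : x = r
      · subst hxr; tauto
      · tauto

end subst

/-! ### Rings of four fragments -/

/-- Four fragments in cyclic order `P₁`, `P₂`, `P₄`, `P₃`: the first two share the terminal `α`,
the last two the terminal `β`, and two edges join `P₁` to `P₃` and `P₂` to `P₄`. -/
structure IsRing (G : SimpleGraph U) (P P₁ P₂ P₃ P₄ : Finset U)
    (α β b₁ c₁ b₂ c₂ b₃ c₃ b₄ c₄ : U) : Prop where
  mem_iff : ∀ v, v ∈ P ↔ (v ∈ P₁ ∨ v ∈ P₂) ∨ (v ∈ P₃ ∨ v ∈ P₄)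
  frag₁ : IsFragment G P₁ {α, b₁, c₁}
  frag₂ : IsFragment G P₂ {α, b₂, c₂}
  frag₃ : IsFragment G P₃ {β, b₃, c₃}
  frag₄ : IsFragment G P₄ {β, b₄, c₄}
  inter₁₂ : ∀ v ∈ P₁, v ∈ P₂ → v = α
  inter₃₄ : ∀ v ∈ P₃, v ∈ P₄ → v = β
  disj : ∀ v, v ∈ P₁ ∨ v ∈ P₂ → v ∈ P₃ ∨ v ∈ P₄ → False
  adj_b₁ : G.Adj b₁ b₃
  adj_c₁ : G.Adj c₁ c₃
  adj_b₂ : G.Adj b₂ b₄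
  adj_c₂ : G.Adj c₂ c₄
  adj : ∀ u v, G.Adj u v → (u ∈ P₁ ∧ v ∈ P₁) ∨ (u ∈ P₂ ∧ v ∈ P₂) ∨ (u ∈ P₃ ∧ v ∈ P₃) ∨
    (u ∈ P₄ ∧ v ∈ P₄) ∨ s(u, v) = s(b₁, b₃) ∨ s(u, v) = s(c₁, c₃) ∨ s(u, v) = s(b₂, b₄) ∨
    s(u, v) = s(c₂, c₄)

theorem IsFragment.ne_of_triple {G : SimpleGraph U} {P : Finset U} {a b c : U}
    (h : IsFragment G P {a, b, c}) : a ≠ b ∧ a ≠ c ∧ b ≠ c := by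
  refine ⟨?_, ?_, ?_⟩ <;> rintro rfl
  · have := h.card_eq.symm.le.trans (by simpa using card_le_two (a := a) (b := c)); omega
  · have : ({a, b, a} : Finset U) = {a, b} := by ext; simp [or_comm]
    have := h.card_eq.symm.le.trans (this ▸ card_le_two); omega
  · have := h.card_eq.symm.le.trans (by simpa using card_le_two (a := a) (b := b)); omega

/-- A fragment without ends of the path, given the number of path edges that leave it. -/
theorem IsFragment.isolated_of_no_end {G T : SimpleGraph U} {P : Finset U} {α b c : U}
    (frag : IsFragment G P {α, b, c}) (hT : IsForest T) (hTG : T ≤ G)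
    (hin : ∀ v ∈ P, v ∉ ({α, b, c} : Finset U) → degIn T P v = 2)
    (hb : 1 ≤ degIn T P b) (hc : 1 ≤ degIn T P c) (hb' : degIn T P b ≤ 2) (hc' : degIn T P c ≤ 2)
    (hα : degIn T P α ≤ 2) :
    degIn T P α = 0 ∧ degIn T P b = 1 ∧ degIn T P c = 1 := by
  obtain ⟨h1, h2, h3⟩ := frag.ne_of_triple
  obtain ⟨p, q, r, hS, hpq, hrp, hrq, hp, hq, hr⟩ := frag.exists_isolated hT
    (fun u _ v _ a => hTG a) hin (by simp [hα, hb', hc'])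
  have hα' : r = α := by
    have : r ∈ ({α, b, c} : Finset U) := by simp [hS]
    simp only [mem_insert, mem_singleton] at this
    rcases this with rfl | rfl | rfl
    · rfl
    · omega
    · omega
  subst hα'
  have hb : b ∈ ({p, q, r} : Finset U) := by simp [← hS]
  have hc : c ∈ ({p, q, r} : Finset U) := by simp [← hS]
  simp only [mem_insert, mem_singleton] at hb hc
  refine ⟨hr, ?_, ?_⟩
  · rcases hb with rfl | rfl | rfl
    exacts [hp, hq, absurd rfl h1]
  · rcases hc with rfl | rfl | rfl
    exacts [hp, hq, absurd rfl h2]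

/-- The case of `IsFragment.pair_of_end` in which the end of the path is in the first fragment. -/
theorem IsFragment.pair_of_end_left {G T : SimpleGraph U} {P₁ P₂ : Finset U}
    {α b₁ c₁ b₂ c₂ u : U} (frag₁ : IsFragment G P₁ {α, b₁, c₁})
    (frag₂ : IsFragment G P₂ {α, b₂, c₂}) (inter : ∀ v ∈ P₁, v ∈ P₂ → v = α)
    (hT : IsForest T) (hTG : T ≤ G) {ε : U → ℕ}
    {e₁ f₁ e₂ f₂ : ℕ} (he₁ : e₁ ≤ 1) (hf₁ : f₁ ≤ 1) (he₂ : e₂ ≤ 1) (hf₂ : f₂ ≤ 1)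
    (in₁ : ∀ v ∈ P₁, v ∉ ({α, b₁, c₁} : Finset U) → degIn T P₁ v + ε v = 2)
    (in₂ : ∀ v ∈ P₂, v ∉ ({α, b₂, c₂} : Finset U) → degIn T P₂ v + ε v = 2)
    (hb₁ : degIn T P₁ b₁ + e₁ + ε b₁ = 2) (hc₁ : degIn T P₁ c₁ + f₁ + ε c₁ = 2)
    (hb₂ : degIn T P₂ b₂ + e₂ + ε b₂ = 2) (hc₂ : degIn T P₂ c₂ + f₂ + ε c₂ = 2)
    (hα : degIn T P₁ α + degIn T P₂ α + ε α = 2) (hu : u ∈ P₁) (hu1 : ε u = 1)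
    (h0 : ∀ v, v ∈ P₁ ∨ v ∈ P₂ → v ≠ u → ε v = 0) :
    degIn T P₂ α = 0 ∧ (∀ v ∈ P₂, ε v = 0) ∧ e₂ = 1 ∧ f₂ = 1 ∧ e₁ + f₁ = 1 := by
  obtain ⟨d1, d2, d3⟩ := frag₁.ne_of_triple
  obtain ⟨d4, d5, d6⟩ := frag₂.ne_of_triple
  have hb₁P : b₁ ∈ P₁ := frag₁.subset (by simp)
  have hc₁P : c₁ ∈ P₁ := frag₁.subset (by simp)
  have hb₂P : b₂ ∈ P₂ := frag₂.subset (by simp)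
  have hc₂P : c₂ ∈ P₂ := frag₂.subset (by simp)
  have hαP : α ∈ P₁ := frag₁.subset (by simp)
  have hz₂ : ∀ v ∈ P₂, v ≠ α → ε v = 0 := fun v hv hvα =>
    h0 v (.inr hv) fun e => hvα (inter v (e ▸ hu) hv)
  have zb₂ := hz₂ b₂ hb₂P d4.symm
  have zc₂ := hz₂ c₂ hc₂P d5.symm
  obtain ⟨r1, r2, r3⟩ := frag₂.isolated_of_no_end hT hTG (fun v hv hvS => by
    have := in₂ v hv hvS
    rwa [hz₂ v hv (fun e => hvS (by simp [e])), add_zero] at this)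
    (by omega) (by omega) (by omega) (by omega) (by omega)
  -- otherwise `α` is isolated in both fragments, but as an end it meets one edge of the path
  have huα : u ≠ α := by
    rintro rfl
    have zb := h0 b₁ (.inl hb₁P) d1.symm
    have zc := h0 c₁ (.inl hc₁P) d2.symm
    obtain ⟨s1, -, -⟩ := frag₁.isolated_of_no_end hT hTG (fun v hv hvS => by
      have := in₁ v hv hvS
      rwa [h0 v (.inl hv) (fun e => hvS (by simp [e])), add_zero] at this)
      (by omega) (by omega) (by omega) (by omega) (by omega)
    omega
  have zα := h0 α (.inl hαP) huα.symm
  refine ⟨r1, fun v hv => ?_, by omega, by omega, ?_⟩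
  · by_cases hvα : v = α
    exacts [hvα ▸ zα, hz₂ v hv hvα]
  have hα2 : degIn T P₁ α = 2 := by omega
  -- otherwise no inner vertex of the first fragment is an end, and then no terminal can have
  -- degree two in the fragment, as `α` does
  have huS : u ∉ ({α, b₁, c₁} : Finset U) := by
    intro huS
    obtain ⟨p, q, r, hS, -, -, -, hp, hq, hr⟩ := frag₁.exists_isolated hT
      (fun u _ v _ a => hTG a) (fun v hv hvS => by
        have := in₁ v hv hvS
        rwa [h0 v (.inl hv) (fun e => hvS (e ▸ huS)), add_zero] at this)
      (by simp only [mem_insert, mem_singleton, forall_eq_or_imp, forall_eq]; omega)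
    have : α ∈ ({p, q, r} : Finset U) := by simp [← hS]
    simp only [mem_insert, mem_singleton] at this
    rcases this with rfl | rfl | rfl <;> omega
  have zb : ε b₁ = 0 := h0 b₁ (.inl hb₁P) fun e => huS (by simp [← e])
  have zc : ε c₁ = 0 := h0 c₁ (.inl hc₁P) fun e => huS (by simp [← e])
  -- parity of the sum of the degrees in the first fragment
  have hpar := even_sum_degIn (T := T) (Q := P₁)
  have hsum : ∑ v ∈ P₁ \ {α, b₁, c₁}, (degIn T P₁ v + ε v) = 2 * #(P₁ \ {α, b₁, c₁}) := by
    rw [sum_congr rfl (g := fun _ => 2) fun v hv =>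
      in₁ v (mem_sdiff.1 hv).1 (mem_sdiff.1 hv).2]
    simp [mul_comm]
  have hε : ∑ v ∈ P₁ \ {α, b₁, c₁}, ε v = 1 := by
    rw [sum_eq_single u, hu1]
    · exact fun v hv hvu => h0 v (.inl (mem_sdiff.1 hv).1) hvu
    · exact fun h => absurd (mem_sdiff.2 ⟨hu, huS⟩) h
  rw [sum_add_distrib, hε] at hsum
  rw [← sum_sdiff frag₁.subset, sum_insert (by simp [d1, d2]), sum_insert (by simp [d3]),
    sum_singleton, Nat.even_iff] at hpar
  omega

/-- The two fragments at `α` that contain exactly one end of a Hamiltonian path: the other two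
terminals of one of them are used in full by the path, and exactly one terminal of the other is
used. Here `ε v` counts how often `v` is an end, and `e₁`, `f₁`, `e₂`, `f₂` count the path edges
that leave the fragments at `b₁`, `c₁`, `b₂`, `c₂`. -/
theorem IsFragment.pair_of_end {G T : SimpleGraph U} {P₁ P₂ : Finset U} {α b₁ c₁ b₂ c₂ u : U}
    (frag₁ : IsFragment G P₁ {α, b₁, c₁}) (frag₂ : IsFragment G P₂ {α, b₂, c₂})
    (inter : ∀ v ∈ P₁, v ∈ P₂ → v = α) (hT : IsForest T) (hTG : T ≤ G) {ε : U → ℕ}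
    {e₁ f₁ e₂ f₂ : ℕ} (he₁ : e₁ ≤ 1) (hf₁ : f₁ ≤ 1) (he₂ : e₂ ≤ 1) (hf₂ : f₂ ≤ 1)
    (in₁ : ∀ v ∈ P₁, v ∉ ({α, b₁, c₁} : Finset U) → degIn T P₁ v + ε v = 2)
    (in₂ : ∀ v ∈ P₂, v ∉ ({α, b₂, c₂} : Finset U) → degIn T P₂ v + ε v = 2)
    (hb₁ : degIn T P₁ b₁ + e₁ + ε b₁ = 2) (hc₁ : degIn T P₁ c₁ + f₁ + ε c₁ = 2)
    (hb₂ : degIn T P₂ b₂ + e₂ + ε b₂ = 2) (hc₂ : degIn T P₂ c₂ + f₂ + ε c₂ = 2)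
    (hα : degIn T P₁ α + degIn T P₂ α + ε α = 2) :
    (∃ v, (v ∈ P₁ ∨ v ∈ P₂) ∧ 0 < ε v) ∧
    (u ∈ P₁ ∨ u ∈ P₂ → ε u = 1 → (∀ v, v ∈ P₁ ∨ v ∈ P₂ → v ≠ u → ε v = 0) →
      (degIn T P₁ α = 0 ∧ (∀ v ∈ P₁, ε v = 0) ∧ e₁ = 1 ∧ f₁ = 1 ∧ e₂ + f₂ = 1) ∨
      (degIn T P₂ α = 0 ∧ (∀ v ∈ P₂, ε v = 0) ∧ e₂ = 1 ∧ f₂ = 1 ∧ e₁ + f₁ = 1)) := by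
  refine ⟨?_, fun hu hu1 h0 => ?_⟩
  · by_contra! hne
    have z₁ : ∀ v ∈ P₁, ε v = 0 := fun v hv => Nat.le_zero.1 (hne v (.inl hv))
    have z₂ : ∀ v ∈ P₂, ε v = 0 := fun v hv => Nat.le_zero.1 (hne v (.inr hv))
    have zα := z₁ α (frag₁.subset (by simp))
    have zb₁ := z₁ b₁ (frag₁.subset (by simp))
    have zc₁ := z₁ c₁ (frag₁.subset (by simp))
    have zb₂ := z₂ b₂ (frag₂.subset (by simp))
    have zc₂ := z₂ c₂ (frag₂.subset (by simp))
    have r₁ := frag₁.isolated_of_no_end hT hTG (fun v hv hvS => by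
      have := in₁ v hv hvS
      rwa [z₁ v hv, add_zero] at this)
      (by omega) (by omega) (by omega) (by omega) (by omega)
    have r₂ := frag₂.isolated_of_no_end hT hTG (fun v hv hvS => by
      have := in₂ v hv hvS
      rwa [z₂ v hv, add_zero] at this)
      (by omega) (by omega) (by omega) (by omega) (by omega)
    omega
  · rcases hu with hu | hu
    · exact .inr (frag₁.pair_of_end_left frag₂ inter hT hTG he₁ hf₁ he₂ hf₂ in₁ in₂ hb₁ hc₁ hb₂ hc₂
        hα hu hu1 h0)
    · exact .inl (frag₂.pair_of_end_left frag₁ (fun v h1 h2 => inter v h2 h1) hT hTG he₂ hf₂ he₁ hf₁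
        in₂ in₁ hb₂ hc₂ hb₁ hc₁ (by rwa [add_comm (degIn T P₂ α)]) hu hu1
        fun v hv => h0 v hv.symm)

namespace IsRing

variable {G : SimpleGraph U} {P P₁ P₂ P₃ P₄ : Finset U} {α β b₁ c₁ b₂ c₂ b₃ c₃ b₄ c₄ : U}

/-- The reflection of the ring that exchanges the two fragments at `α` and those at `β`. -/
theorem swap (h : IsRing G P P₁ P₂ P₃ P₄ α β b₁ c₁ b₂ c₂ b₃ c₃ b₄ c₄) :
    IsRing G P P₂ P₁ P₄ P₃ α β b₂ c₂ b₁ c₁ b₄ c₄ b₃ c₃ where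
  mem_iff v := by rw [h.mem_iff, or_comm (a := v ∈ P₁), or_comm (a := v ∈ P₃)]
  frag₁ := h.frag₂
  frag₂ := h.frag₁
  frag₃ := h.frag₄
  frag₄ := h.frag₃
  inter₁₂ v h1 h2 := h.inter₁₂ v h2 h1
  inter₃₄ v h1 h2 := h.inter₃₄ v h2 h1
  disj v h1 h2 := h.disj v h1.symm h2.symm
  adj_b₁ := h.adj_b₂
  adj_c₁ := h.adj_c₂
  adj_b₂ := h.adj_b₁
  adj_c₂ := h.adj_c₁
  adj u v a := by rcases h.adj u v a with h | h | h | h | h | h | h | h <;> simp [h]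

/-- The reflection of the ring that exchanges `α` and `β`. -/
theorem flip (h : IsRing G P P₁ P₂ P₃ P₄ α β b₁ c₁ b₂ c₂ b₃ c₃ b₄ c₄) :
    IsRing G P P₃ P₄ P₁ P₂ β α b₃ c₃ b₄ c₄ b₁ c₁ b₂ c₂ where
  mem_iff v := by rw [h.mem_iff, or_comm]
  frag₁ := h.frag₃
  frag₂ := h.frag₄
  frag₃ := h.frag₁
  frag₄ := h.frag₂
  inter₁₂ := h.inter₃₄
  inter₃₄ := h.inter₁₂
  disj v h1 h2 := h.disj v h2 h1
  adj_b₁ := h.adj_b₁.symm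
  adj_c₁ := h.adj_c₁.symm
  adj_b₂ := h.adj_b₂.symm
  adj_c₂ := h.adj_c₂.symm
  adj u v a := by
    rw [Sym2.eq_swap (a := b₃), Sym2.eq_swap (a := c₃), Sym2.eq_swap (a := b₄),
      Sym2.eq_swap (a := c₄)]
    rcases h.adj u v a with h | h | h | h | h | h | h | h <;> simp [h]

/-- The two terminals of a fragment that are not shared play the same role. -/
theorem mirror (h : IsRing G P P₁ P₂ P₃ P₄ α β b₁ c₁ b₂ c₂ b₃ c₃ b₄ c₄) :
    IsRing G P P₁ P₂ P₃ P₄ α β c₁ b₁ c₂ b₂ c₃ b₃ c₄ b₄ where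
  mem_iff := h.mem_iff
  frag₁ := by rw [pair_comm]; exact h.frag₁
  frag₂ := by rw [pair_comm]; exact h.frag₂
  frag₃ := by rw [pair_comm]; exact h.frag₃
  frag₄ := by rw [pair_comm]; exact h.frag₄
  inter₁₂ := h.inter₁₂
  inter₃₄ := h.inter₃₄
  disj := h.disj
  adj_b₁ := h.adj_c₁
  adj_c₁ := h.adj_b₁
  adj_b₂ := h.adj_c₂
  adj_c₂ := h.adj_b₂
  adj u v a := by rcases h.adj u v a with h | h | h | h | h | h | h | h <;> simp [h]

variable (h : IsRing G P P₁ P₂ P₃ P₄ α β b₁ c₁ b₂ c₂ b₃ c₃ b₄ c₄)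
include h

theorem mem₁ : α ∈ P₁ ∧ b₁ ∈ P₁ ∧ c₁ ∈ P₁ :=
  ⟨h.frag₁.subset (by simp), h.frag₁.subset (by simp), h.frag₁.subset (by simp)⟩

theorem subset₁ : P₁ ⊆ P := fun v hv => (h.mem_iff v).2 (.inl (.inl hv))

theorem notMem₂ {v : U} (hv : v ∈ P₁) (hα : v ≠ α) : v ∉ P₂ := fun h2 => hα (h.inter₁₂ v hv h2)

theorem notMem₃ {v : U} (hv : v ∈ P₁) : v ∉ P₃ := fun h2 => h.disj v (.inl hv) (.inl h2)

theorem notMem₄ {v : U} (hv : v ∈ P₁) : v ∉ P₄ := fun h2 => h.disj v (.inl hv) (.inr h2)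

/-- Where an edge from a vertex of the first fragment other than `α` can lead. -/
theorem nbr {v w : U} (hv : v ∈ P₁) (hα : v ≠ α) (a : G.Adj v w) :
    w ∈ P₁ ∨ (v = b₁ ∧ w = b₃) ∨ (v = c₁ ∧ w = c₃) := by
  have h3 := h.flip.mem₁
  have h4 := h.swap.flip.mem₁
  have h2 := h.swap.mem₁
  have n2 := h.notMem₂ hv hα
  have n3 := h.notMem₃ hv
  have n4 := h.notMem₄ hv
  rcases h.adj v w a with h' | h' | h' | h' | h' | h' | h' | h'
  · exact .inl h'.2
  · exact absurd h'.1 n2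
  · exact absurd h'.1 n3
  · exact absurd h'.1 n4
  all_goals
    rcases Sym2.eq_iff.1 h' with ⟨rfl, rfl⟩ | ⟨rfl, rfl⟩
  · simp
  · exact absurd h3.2.1 n3
  · simp
  · exact absurd h3.2.2 n3
  · exact absurd h2.2.1 n2
  · exact absurd h4.2.1 n4
  · exact absurd h2.2.2 n2
  · exact absurd h4.2.2 n4

theorem nbr_shared {w : U} (a : G.Adj α w) : w ∈ P₁ ∨ w ∈ P₂ := by
  have h1 := h.mem₁
  have h3 := h.flip.mem₁
  have h4 := h.swap.flip.mem₁
  have n3 := h.notMem₃ h1.1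
  have n4 := h.notMem₄ h1.1
  obtain ⟨d1, d2, -⟩ := h.frag₁.ne_of_triple
  obtain ⟨d3, d4, -⟩ := h.frag₂.ne_of_triple
  rcases h.adj α w a with h' | h' | h' | h' | h' | h' | h' | h'
  · exact .inl h'.2
  · exact .inr h'.2
  · exact absurd h'.1 n3
  · exact absurd h'.1 n4
  all_goals
    rcases Sym2.eq_iff.1 h' with ⟨rfl, rfl⟩ | ⟨rfl, rfl⟩
  · exact absurd rfl d1
  · exact absurd h3.2.1 n3
  · exact absurd rfl d2
  · exact absurd h3.2.2 n3
  · exact absurd rfl d3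
  · exact absurd h4.2.1 n4
  · exact absurd rfl d4
  · exact absurd h4.2.2 n4

variable {T : SimpleGraph U} (hTG : T ≤ G)
include hTG

theorem degIn_inner {v : U} (hv : v ∈ P₁) (hS : v ∉ ({α, b₁, c₁} : Finset U)) :
    degIn T P v = degIn T P₁ v := by
  simp only [mem_insert, mem_singleton, not_or] at hS
  refine degIn_congr fun w => and_congr_left fun a => ⟨fun _ => ?_, fun hw => h.subset₁ hw⟩
  rcases h.nbr hv hS.1 (hTG a) with h' | h' | h'
  exacts [h', absurd h'.1 hS.2.1, absurd h'.1 hS.2.2]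

open scoped Classical in
theorem degIn_b₁ : degIn T P b₁ = degIn T P₁ b₁ + (if T.Adj b₁ b₃ then 1 else 0) := by
  obtain ⟨d1, d2, d3⟩ := h.frag₁.ne_of_triple
  have hb₃ := h.flip.mem₁.2.1
  have : degIn T {b₃} b₁ = if T.Adj b₁ b₃ then 1 else 0 := by
    unfold degIn
    rw [filter_singleton]
    split_ifs <;> simp
  rw [← this]
  refine degIn_union_of h.subset₁ (singleton_subset_iff.2 (h.flip.subset₁ hb₃)) ?_ ?_
  · intro w _ a
    rcases h.nbr h.mem₁.2.1 d1.symm (hTG a) with h' | h' | h'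
    exacts [.inl h', .inr (by simp [h'.2]), absurd h'.1 d3]
  · intro w hw hw' _
    rw [mem_singleton] at hw'
    exact h.notMem₃ hw (hw' ▸ hb₃)

open scoped Classical in
theorem degIn_c₁ : degIn T P c₁ = degIn T P₁ c₁ + (if T.Adj c₁ c₃ then 1 else 0) :=
  h.mirror.degIn_b₁ hTG

theorem degIn_α : degIn T P α = degIn T P₁ α + degIn T P₂ α := by
  refine degIn_union_of h.subset₁ h.swap.subset₁ (fun w _ a => h.nbr_shared (hTG a)) ?_
  intro w hw hw' a
  exact a.ne (h.inter₁₂ w hw hw').symm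

omit hTG

/-- A ring of four fragments has no Hamiltonian path: the two fragments at `α` contain exactly one
end of the path, and the two at `β` the other one. So three of the four edges between the two
pairs are used, and the path closes up in the two fragments that are joined by two of them. -/
theorem not_hamPath (s t : U) : ¬ HamPath G P s t := by
  classical
  intro k
  obtain ⟨T, hTG, hT, -, hd⟩ := k.exists_forest
  set ε : U → ℕ := fun v => (if v = s then 1 else 0) + (if v = t then 1 else 0) with hε
  have hd' : ∀ v ∈ P, degIn T P v + ε v = 2 := fun v hv => by rw [hε, ← hd v hv, add_assoc]
  have hif : ∀ p : Prop, [Decidable p] → (if p then 1 else 0) ≤ 1 := fun p _ => by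
    split_ifs <;> simp
  have deg : ∀ {Q₁ Q₂ Q₃ Q₄ : Finset U} {α β b₁ c₁ b₂ c₂ b₃ c₃ b₄ c₄ : U},
      IsRing G P Q₁ Q₂ Q₃ Q₄ α β b₁ c₁ b₂ c₂ b₃ c₃ b₄ c₄ →
      (∀ v ∈ Q₁, v ∉ ({α, b₁, c₁} : Finset U) → degIn T Q₁ v + ε v = 2) ∧
      degIn T Q₁ b₁ + (if T.Adj b₁ b₃ then 1 else 0) + ε b₁ = 2 ∧
      degIn T Q₁ c₁ + (if T.Adj c₁ c₃ then 1 else 0) + ε c₁ = 2 ∧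
      degIn T Q₁ α + degIn T Q₂ α + ε α = 2 := by
    intro Q₁ Q₂ Q₃ Q₄ α β b₁ c₁ b₂ c₂ b₃ c₃ b₄ c₄ h
    refine ⟨fun v hv hS => ?_, ?_, ?_, ?_⟩
    · rw [← h.degIn_inner hTG hv hS]; exact hd' v (h.subset₁ hv)
    · rw [← h.degIn_b₁ hTG]; exact hd' _ (h.subset₁ h.mem₁.2.1)
    · rw [← h.degIn_c₁ hTG]; exact hd' _ (h.subset₁ h.mem₁.2.2)
    · rw [← h.degIn_α hTG]; exact hd' _ (h.subset₁ h.mem₁.1)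
  have D₁ := deg h
  have D₂ := deg h.swap
  have D₃ := deg h.flip
  have D₄ := deg h.swap.flip
  have L := fun u => h.frag₁.pair_of_end (u := u) h.frag₂ h.inter₁₂ hT hTG (hif (T.Adj b₁ b₃))
    (hif (T.Adj c₁ c₃)) (hif (T.Adj b₂ b₄)) (hif (T.Adj c₂ c₄)) D₁.1 D₂.1 D₁.2.1 D₁.2.2.1 D₂.2.1
    D₂.2.2.1 D₁.2.2.2
  have R := fun u => h.frag₃.pair_of_end (u := u) h.frag₄ h.inter₃₄ hT hTG (hif (T.Adj b₃ b₁))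
    (hif (T.Adj c₃ c₁)) (hif (T.Adj b₄ b₂)) (hif (T.Adj c₄ c₂)) D₃.1 D₄.1 D₃.2.1 D₃.2.2.1 D₄.2.1
    D₄.2.2.1 D₃.2.2.2
  obtain ⟨u, hu, hu0⟩ := (L s).1
  obtain ⟨w, hw, hw0⟩ := (R s).1
  have huw : u ≠ w := fun e => h.disj u hu (e ▸ hw)
  have hst : (u = s ∧ w = t) ∨ (u = t ∧ w = s) := by
    simp only [hε] at hu0 hw0
    by_cases h1 : u = s
    · by_cases h2 : w = t
      · exact .inl ⟨h1, h2⟩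
      · have h3 : w = s := by
          by_contra h3
          simp [h2, h3] at hw0
        exact absurd (h1.trans h3.symm) huw
    · have h2 : u = t := by
        by_contra h3
        simp [h1, h3] at hu0
      by_cases h3 : w = s
      · exact .inr ⟨h2, h3⟩
      · have h4 : w = t := by
          by_contra h4
          simp [h3, h4] at hw0
        exact absurd (h2.trans h4.symm) huw
  have hu1 : ε u = 1 := by
    rcases hst with ⟨rfl, rfl⟩ | ⟨rfl, rfl⟩ <;> simp [hε, huw]
  have hw1 : ε w = 1 := by
    rcases hst with ⟨rfl, rfl⟩ | ⟨rfl, rfl⟩ <;> simp [hε, huw.symm]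
  have h0 : ∀ v, v ≠ u → v ≠ w → ε v = 0 := fun v h1 h2 => by
    rcases hst with ⟨rfl, rfl⟩ | ⟨rfl, rfl⟩ <;> simp [hε, h1, h2]
  have L' := (L u).2 hu hu1 fun v hv hvu => h0 v hvu fun e => h.disj v hv (e ▸ hw)
  have R' := (R w).2 hw hw1 fun v hv hvw => h0 v (fun e => h.disj v (e ▸ hu) hv) hvw
  -- the two fragments that are used in full are joined by two edges: this closes a cycle
  have cyc : ∀ {Q₁ Q₂ Q₃ Q₄ : Finset U} {α β b₁ c₁ b₂ c₂ b₃ c₃ b₄ c₄ : U},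
      IsRing G P Q₁ Q₂ Q₃ Q₄ α β b₁ c₁ b₂ c₂ b₃ c₃ b₄ c₄ →
      degIn T Q₁ α = 0 → (∀ v ∈ Q₁, ε v = 0) → degIn T Q₃ β = 0 → (∀ v ∈ Q₃, ε v = 0) →
      False := by
    intro Q₁ Q₂ Q₃ Q₄ α β b₁ c₁ b₂ c₂ b₃ c₃ b₄ c₄ h h1 h2 h3 h4
    have aux : ∀ {Q₁ Q₂ Q₃ Q₄ : Finset U} {α β b₁ c₁ b₂ c₂ b₃ c₃ b₄ c₄ : U},
        IsRing G P Q₁ Q₂ Q₃ Q₄ α β b₁ c₁ b₂ c₂ b₃ c₃ b₄ c₄ →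
        degIn T Q₁ α = 0 → (∀ v ∈ Q₁, ε v = 0) →
        ∀ v ∈ Q₁.erase α, 2 ≤ degIn T (Q₁.erase α ∪ Q₃.erase β) v := by
      intro Q₁ Q₂ Q₃ Q₄ α β b₁ c₁ b₂ c₂ b₃ c₃ b₄ c₄ h h1 h2 v hv
      have hv' := mem_erase.1 hv
      have h5 := hd' v (h.subset₁ hv'.2)
      rw [h2 v hv'.2] at h5
      rw [← h5, add_zero]
      refine degIn_le_of_imp fun w hw a => ⟨?_, a⟩
      obtain ⟨d1, d2, -⟩ := h.flip.frag₁.ne_of_triple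
      rcases h.nbr hv'.2 hv'.1 (hTG a) with h6 | ⟨-, rfl⟩ | ⟨-, rfl⟩
      · refine mem_union_left _ (mem_erase.2 ⟨?_, h6⟩)
        rintro rfl
        exact degIn_eq_zero.1 h1 v hv'.2 a.symm
      · exact mem_union_right _ (mem_erase.2 ⟨d1.symm, h.flip.mem₁.2.1⟩)
      · exact mem_union_right _ (mem_erase.2 ⟨d2.symm, h.flip.mem₁.2.2⟩)
    obtain ⟨d1, -⟩ := h.frag₁.ne_of_triple
    refine hT.false_of_two_le (C := Q₁.erase α ∪ Q₃.erase β)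
      ⟨b₁, mem_union_left _ (mem_erase.2 ⟨d1.symm, h.mem₁.2.1⟩)⟩ fun v hv => ?_
    rcases mem_union.1 hv with hv | hv
    · exact aux h h1 h2 v hv
    · rw [union_comm]; exact aux h.flip h3 h4 v hv
  simp only [T.adj_comm b₃ b₁, T.adj_comm c₃ c₁, T.adj_comm b₄ b₂, T.adj_comm c₄ c₂] at R'
  rcases L' with ⟨l1, l2, l3, l4, l5⟩ | ⟨l1, l2, l3, l4, l5⟩ <;>
    rcases R' with ⟨r1, r2, r3, r4, r5⟩ | ⟨r1, r2, r3, r4, r5⟩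
  · exact cyc h l1 l2 r1 r2
  · omega
  · omega
  · exact cyc h.swap l1 l2 r1 r2

/-- The path after the deletion of a vertex `v` of the first fragment, if the rest of that fragment
has a path between the terminals `b₁` and `c₁`. -/
theorem hamPath_erase_of_bc {v : U} (hv : v ∈ P₁) (k : HamPath G (P₁.erase v) b₁ c₁) :
    HamPath G (P.erase v) b₃ b₄ := by
  obtain ⟨hα₁, hb₁, hc₁⟩ := h.mem₁
  obtain ⟨hα₂, hb₂, hc₂⟩ := h.swap.mem₁
  obtain ⟨hβ₃, hb₃, hc₃⟩ := h.flip.mem₁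
  obtain ⟨hβ₄, hb₄, hc₄⟩ := h.swap.flip.mem₁
  obtain ⟨d1, d2, d3⟩ := h.frag₃.ne_of_triple
  obtain ⟨d4, d5, d6⟩ := h.frag₄.ne_of_triple
  have k₃ : HamPath G (P₃.erase b₃) c₃ β := h.frag₃.path_of_terminal (by ext; simp; tauto)
  have k₄ : HamPath G (P₄.erase b₄) β c₄ := h.frag₄.path_of_terminal (by ext; simp; tauto)
  have k₂ : HamPath G (P₂.erase α) c₂ b₂ := h.frag₂.path_of_terminal (by ext; simp; tauto)
  have i12 := h.inter₁₂
  have i34 := h.inter₃₄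
  have dis := h.disj
  have hP := h.mem_iff
  refine ((((((HamPath.single b₃).link h.adj_b₁.symm k ?_).link h.adj_c₁ k₃ ?_).trans k₄ ?_).link
    h.adj_c₂.symm k₂ ?_).link h.adj_b₂ (.single b₄) ?_).cast ?_
  · rw [disjoint_left]; grind
  · rw [disjoint_left]; grind
  · grind
  · rw [disjoint_left]; grind
  · rw [disjoint_left]; grind
  · ext x; grind

/-- The path after the deletion of a vertex `v` of the first fragment, if the rest of that fragment
has a path between the terminals `α` and `b₁`. -/
theorem exists_hamPath_erase_of_αb {v : U} (hv : v ∈ P₁) (k : HamPath G (P₁.erase v) α b₁) :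
    ∃ t, HamPath G (P.erase v) c₂ t := by
  obtain ⟨hα₁, hb₁, hc₁⟩ := h.mem₁
  obtain ⟨hα₂, hb₂, hc₂⟩ := h.swap.mem₁
  obtain ⟨hβ₃, hb₃, hc₃⟩ := h.flip.mem₁
  obtain ⟨hβ₄, hb₄, hc₄⟩ := h.swap.flip.mem₁
  have hvα : v ≠ α := (mem_erase.1 k.left_mem).1.symm
  obtain ⟨t, k₃⟩ := h.frag₃.start b₃ (by simp)
  have k₄ : HamPath G (P₄.erase β) c₄ b₄ := h.frag₄.path_of_terminal (by ext; simp; tauto)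
  have k₂ : HamPath G (P₂.erase c₂) b₂ α := h.frag₂.path_of_terminal (by ext; simp; tauto)
  have i12 := h.inter₁₂
  have i34 := h.inter₃₄
  have dis := h.disj
  have hP := h.mem_iff
  refine ⟨t, ((((((HamPath.single c₂).link h.adj_c₂ k₄ ?_).link h.adj_b₂.symm k₂ ?_).trans k ?_).link
    h.adj_b₁ k₃ ?_)).cast ?_⟩
  · rw [disjoint_left]; grind
  · rw [disjoint_left]; grind
  · grind
  · rw [disjoint_left]; grind
  · ext x; grind

theorem exists_hamPath_erase_of_mem₁ {v : U} (hv : v ∈ P₁) : ∃ s t, HamPath G (P.erase v) s t := by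
  obtain ⟨s, hs, t, ht, hst, k⟩ := h.frag₁.del v hv
  simp only [mem_insert, mem_singleton] at hs ht
  rcases hs with rfl | rfl | rfl <;> rcases ht with rfl | rfl | rfl
  · exact absurd rfl hst
  · exact ⟨_, h.exists_hamPath_erase_of_αb hv k⟩
  · exact ⟨_, h.mirror.exists_hamPath_erase_of_αb hv k⟩
  · exact ⟨_, h.exists_hamPath_erase_of_αb hv k.symm⟩
  · exact absurd rfl hst
  · exact ⟨_, _, h.hamPath_erase_of_bc hv k⟩
  · exact ⟨_, h.mirror.exists_hamPath_erase_of_αb hv k.symm⟩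
  · exact ⟨_, _, h.hamPath_erase_of_bc hv k.symm⟩
  · exact absurd rfl hst

theorem exists_hamPath_erase {v : U} (hv : v ∈ P) : ∃ s t, HamPath G (P.erase v) s t := by
  rcases (h.mem_iff v).1 hv with (h' | h') | (h' | h')
  · exact h.exists_hamPath_erase_of_mem₁ h'
  · exact h.swap.exists_hamPath_erase_of_mem₁ h'
  · exact h.flip.exists_hamPath_erase_of_mem₁ h'
  · exact h.swap.flip.exists_hamPath_erase_of_mem₁ h'

end IsRing

/-! ### Hamiltonian paths as walks -/

namespace SimpleGraph

variable {V : Type*} [DecidableEq V] {G : SimpleGraph V}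

theorem Walk.IsPath.hamPath {s t : V} {p : G.Walk s t} (hp : p.IsPath) :
    HamPath G p.support.toFinset s t := by
  induction p with
  | nil => simpa using HamPath.single _
  | cons h p ih =>
    rw [Walk.cons_isPath_iff] at hp
    rw [Walk.support_cons, List.toFinset_cons]
    exact .cons h (by simpa using hp.2) (ih hp.1)

theorem _root_.HamPath.exists_walk {P : Finset V} {s t : V} (h : HamPath G P s t) :
    ∃ p : G.Walk s t, p.IsPath ∧ p.support.toFinset = P := by
  induction h with
  | single a => exact ⟨.nil, by simp, by simp⟩
  | cons hab ha _ ih =>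
    obtain ⟨p, hp, rfl⟩ := ih
    exact ⟨.cons hab p, by simpa [Walk.cons_isPath_iff, hp] using ha, by simp⟩

theorem isTraceable_iff [Fintype V] : G.IsTraceable ↔ ∃ s t, HamPath G univ s t := by
  refine exists_congr fun s => exists_congr fun t => ⟨?_, fun h => ?_⟩
  · rintro ⟨p, hp⟩
    exact hp.isPath.hamPath.cast hp.toFinset_support
  · obtain ⟨p, hp, e⟩ := h.exists_walk
    refine ⟨p, hp.isHamiltonian_iff.2 fun w => ?_⟩
    rw [← List.mem_toFinset, e]
    exact mem_univ w

/-- Traceability of a graph that is induced along an embedding `f`. -/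
theorem isTraceable_comap_iff [Fintype V] (H : SimpleGraph U) (f : V ↪ U) :
    (H.comap f).IsTraceable ↔ ∃ s t, HamPath H (univ.map f) s t := by
  rw [isTraceable_iff]
  constructor
  · rintro ⟨s, t, h⟩
    exact ⟨f s, f t, (h.map f).congr fun u _ v _ huv => map_comap_le f H huv⟩
  · rintro ⟨x, z, h⟩
    obtain ⟨s, -, rfl⟩ := mem_map.1 h.left_mem
    obtain ⟨t, -, rfl⟩ := mem_map.1 h.right_mem
    refine ⟨s, t, (h.congr (H := (H.comap f).map f) fun u hu v hv huv => ?_).of_map f rfl rfl rfl⟩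
    obtain ⟨u, -, rfl⟩ := mem_map.1 hu
    obtain ⟨v, -, rfl⟩ := mem_map.1 hv
    exact (map_adj_apply ..).2 huv

end SimpleGraph

theorem isHypotraceable_comap {n : ℕ} {G : SimpleGraph U} {P : Finset U} (e : Fin n ≃ P)
    (h₁ : ∀ s t, ¬ HamPath G P s t) (h₂ : ∀ v ∈ P, ∃ s t, HamPath G (P.erase v) s t) :
    (G.comap fun i => (e i : U)).IsHypotraceable := by
  let f : Fin n ↪ U := ⟨fun i => (e i : U), fun i j hij => e.injective (Subtype.ext hij)⟩
  have hf : univ.map f = P := by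
    ext w
    simp only [mem_map, mem_univ, true_and]
    exact ⟨by rintro ⟨i, rfl⟩; exact (e i).2, fun hw => ⟨e.symm ⟨w, hw⟩,
      congrArg Subtype.val (e.apply_symm_apply ⟨w, hw⟩)⟩⟩
  refine ⟨fun h => ?_, fun v => ?_⟩
  · obtain ⟨s, t, h⟩ := (SimpleGraph.isTraceable_comap_iff G f).1 h
    exact h₁ s t (hf ▸ h)
  · obtain ⟨s, t, h⟩ := h₂ (f v) (hf ▸ mem_map_of_mem f (mem_univ v))
    refine (SimpleGraph.isTraceable_comap_iff G ((Function.Embedding.subtype _).trans f)).2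
      ⟨s, t, h.cast ?_⟩
    rw [← hf]
    ext w
    simp only [mem_erase, mem_map, mem_univ, true_and]
    constructor
    · rintro ⟨hw, i, rfl⟩
      exact ⟨⟨i, fun e => hw (e ▸ rfl)⟩, rfl⟩
    · rintro ⟨⟨i, hi⟩, rfl⟩
      exact ⟨fun e => hi (f.injective e), i, rfl⟩

/-! ### Straight-line drawings -/

/-- A graph on points of the plane, with vertex set `P`, which is drawn without crossings when each
edge is drawn as a segment: a point of `P` on an edge is an end of it, and different edges have no
common points outside `P`. -/
structure IsStraightPlane (G : SimpleGraph (ℝ × ℝ)) (P : Finset (ℝ × ℝ)) : Prop where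
  mem : ∀ ⦃a b⦄, G.Adj a b → a ∈ P
  eq_or_eq : ∀ ⦃a b v⦄, G.Adj a b → v ∈ P → v ∈ segment ℝ a b → v = a ∨ v = b
  cross : ∀ ⦃a b c d p⦄, G.Adj a b → G.Adj c d → s(a, b) ≠ s(c, d) → p ∈ segment ℝ a b →
    p ∈ segment ℝ c d → p ∈ P

/-- The set of points that the straight-line drawing of a graph covers. -/
def drawnSet (G : SimpleGraph (ℝ × ℝ)) (P : Finset (ℝ × ℝ)) : Set (ℝ × ℝ) :=
  P ∪ {p | ∃ a b, G.Adj a b ∧ p ∈ segment ℝ a b}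

namespace IsStraightPlane

variable {G H : SimpleGraph (ℝ × ℝ)} {P Q : Finset (ℝ × ℝ)} {a b : ℝ × ℝ}

theorem isPlanar_comap (h : IsStraightPlane G P) {n : ℕ} (ε : Fin n ≃ P) :
    (G.comap fun i => (ε i : ℝ × ℝ)).IsPlanar := by
  let f : Fin n → ℝ × ℝ := fun i => (ε i : ℝ × ℝ)
  have hf : Function.Injective f := fun i j hij => ε.injective (Subtype.ext hij)
  let A : (G.comap f).edgeSet → Fin n := fun e => (Quot.out e.1).1
  let B : (G.comap f).edgeSet → Fin n := fun e => (Quot.out e.1).2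
  have hAB : ∀ e, s(A e, B e) = e.1 := fun e => Quot.out_eq e.1
  have hadj : ∀ e, G.Adj (f (A e)) (f (B e)) := fun e => by
    have := e.2
    rw [← hAB e] at this
    exact this
  have hinj : ∀ e, Function.Injective
      (fun t : unitInterval => AffineMap.lineMap (f (A e)) (f (B e)) (t : ℝ)) := fun e =>
    (AffineMap.lineMap_injective ℝ (hadj e).ne).comp Subtype.val_injective
  have hseg : ∀ e (t : unitInterval),
      AffineMap.lineMap (f (A e)) (f (B e)) (t : ℝ) ∈ segment ℝ (f (A e)) (f (B e)) :=
    fun e t => by rw [segment_eq_image_lineMap]; exact ⟨t, t.2, rfl⟩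
  have hpt : ∀ e (t : unitInterval) v,
      AffineMap.lineMap (f (A e)) (f (B e)) (t : ℝ) = f v → t = 0 ∨ t = 1 := by
    intro e t v hv
    rcases h.eq_or_eq (hadj e) (v := f v) (Subtype.prop _) (hv ▸ hseg e t) with h0 | h1
    · left; apply hinj e; simpa [h0] using hv
    · right; apply hinj e; simpa [h1] using hv
  refine ⟨{ point := f, arc := fun e t => AffineMap.lineMap (f (A e)) (f (B e)) (t : ℝ)
            point_injective := hf
            arc_continuous := fun e => by
              exact AffineMap.lineMap_continuous.comp continuous_subtype_val
            arc_injective := hinj, arc_ends := fun e => ?_, arc_point := hpt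
            arc_arc := fun e e' hne s t hst => ?_ }⟩
  · rw [← hAB e]; simp
  · obtain ⟨v, hv⟩ : ∃ v, f v = AffineMap.lineMap (f (A e)) (f (B e)) (s : ℝ) := by
      have hP := h.cross (hadj e) (hadj e') (fun hs => hne (Subtype.ext ?_)) (hseg e s)
        (hst ▸ hseg e' t)
      · exact ⟨ε.symm ⟨_, hP⟩, congrArg Subtype.val (ε.apply_symm_apply ⟨_, hP⟩)⟩
      · rw [← hAB e, ← hAB e']
        exact Sym2.map.injective hf hs
    exact ⟨hpt e s v hv.symm, hpt e' t v (hst ▸ hv.symm)⟩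

theorem mem_right (h : IsStraightPlane G P) (hab : G.Adj a b) : b ∈ P := h.mem hab.symm

/-- Two drawings that meet only in common vertices form one drawing. -/
theorem sup (h : IsStraightPlane G P) (k : IsStraightPlane H Q)
    (d : ∀ p ∈ drawnSet G P, p ∈ drawnSet H Q → p ∈ P ∧ p ∈ Q) :
    IsStraightPlane (G ⊔ H) (P ∪ Q) where
  mem a b hab := mem_union.2 (hab.imp (fun e => h.mem e) fun e => k.mem e)
  eq_or_eq a b v hab hv hs := by
    rcases hab with e | e <;> rcases mem_union.1 hv with hv | hv
    · exact h.eq_or_eq e hv hs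
    · exact h.eq_or_eq e (d v (.inr ⟨a, b, e, hs⟩) (.inl hv)).1 hs
    · exact k.eq_or_eq e (d v (.inl hv) (.inr ⟨a, b, e, hs⟩)).2 hs
    · exact k.eq_or_eq e hv hs
  cross a b c e p hab hce hne hp hp' := by
    rw [mem_union]
    rcases hab with i | i <;> rcases hce with j | j
    · exact .inl (h.cross i j hne hp hp')
    · exact .inl (d p (.inr ⟨_, _, i, hp⟩) (.inr ⟨_, _, j, hp'⟩)).1
    · exact .inl (d p (.inr ⟨_, _, j, hp'⟩) (.inr ⟨_, _, i, hp⟩)).1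
    · exact .inr (k.cross i j hne hp hp')

theorem drawnSet_sup : drawnSet (G ⊔ H) (P ∪ Q) ⊆ drawnSet G P ∪ drawnSet H Q := by
  rintro p (hp | ⟨a, b, e | e, hp⟩)
  · exact (mem_union.1 hp).imp .inl .inl
  · exact .inl (.inr ⟨a, b, e, hp⟩)
  · exact .inr (.inr ⟨a, b, e, hp⟩)

theorem drawnSet_edge (hab : a ≠ b) : drawnSet (SimpleGraph.edge a b) {a, b} = segment ℝ a b := by
  ext p
  constructor
  · rintro (hp | ⟨c, d, e, hp⟩)
    · simp only [coe_insert, coe_singleton, Set.mem_insert_iff, Set.mem_singleton_iff] at hp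
      rcases hp with rfl | rfl
      · exact left_mem_segment ..
      · exact right_mem_segment ..
    · rw [SimpleGraph.edge_adj] at e
      rcases e.1 with ⟨rfl, rfl⟩ | ⟨rfl, rfl⟩
      · exact hp
      · rwa [segment_symm]
  · exact fun hp => .inr ⟨a, b, by simp [SimpleGraph.edge_adj, hab], hp⟩

theorem edge (hab : a ≠ b) : IsStraightPlane (SimpleGraph.edge a b) {a, b} where
  mem c d e := by
    rw [SimpleGraph.edge_adj] at e
    rcases e.1 with ⟨rfl, rfl⟩ | ⟨rfl, rfl⟩ <;> simp
  eq_or_eq c d v e hv _ := by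
    simp only [SimpleGraph.edge_adj] at e
    rw [mem_insert, mem_singleton] at hv
    rcases e.1 with ⟨rfl, rfl⟩ | ⟨rfl, rfl⟩
    · exact hv
    · exact hv.symm
  cross c d c' d' p e e' hne := by
    simp only [SimpleGraph.edge_adj] at e e'
    exfalso
    apply hne
    rcases e.1 with ⟨rfl, rfl⟩ | ⟨rfl, rfl⟩ <;> rcases e'.1 with ⟨rfl, rfl⟩ | ⟨rfl, rfl⟩ <;>
      simp

/-- A segment between two vertices is added to a drawing which it does not meet otherwise. -/
theorem sup_edge (h : IsStraightPlane G P) (hab : a ≠ b) (ha : a ∈ P) (hb : b ∈ P)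
    (d : ∀ p ∈ drawnSet G P, p ∈ segment ℝ a b → p = a ∨ p = b) :
    IsStraightPlane (G ⊔ SimpleGraph.edge a b) P := by
  have := h.sup (edge hab) fun p hp hp' => by
    rw [drawnSet_edge hab] at hp'
    rcases d p hp hp' with rfl | rfl <;> simp [ha, hb]
  rwa [union_eq_left.2 (by simp [insert_subset_iff, ha, hb])] at this

theorem drawnSet_sup_edge (hab : a ≠ b) (ha : a ∈ P) (hb : b ∈ P) :
    drawnSet (G ⊔ SimpleGraph.edge a b) P ⊆ drawnSet G P ∪ segment ℝ a b := by
  have := drawnSet_sup (G := G) (H := SimpleGraph.edge a b) (P := P) (Q := {a, b})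
  rwa [union_eq_left.2 (by simp [insert_subset_iff, ha, hb]), drawnSet_edge hab] at this

theorem drawnSet_subset {C : Set (ℝ × ℝ)} (h : IsStraightPlane G P) (hC : Convex ℝ C)
    (hP : (P : Set (ℝ × ℝ)) ⊆ C) : drawnSet G P ⊆ C := by
  rintro p (hp | ⟨a, b, e, hp⟩)
  · exact hP hp
  · exact hC.segment_subset (hP (h.mem e)) (hP (h.mem_right e)) hp

theorem map (h : IsStraightPlane G P) (φ : (ℝ × ℝ) →ᵃ[ℝ] ℝ × ℝ) (hφ : Function.Injective φ) :
    IsStraightPlane (G.map φ) (P.map ⟨φ, hφ⟩) where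
  mem := by
    rintro _ _ ⟨-, a, b, e, rfl, rfl⟩
    exact mem_map_of_mem ⟨φ, hφ⟩ (h.mem e)
  eq_or_eq := by
    rintro _ _ v ⟨-, a, b, e, rfl, rfl⟩ hv hs
    obtain ⟨v, hvP, rfl⟩ := mem_map.1 hv
    rw [← image_segment ℝ φ, Function.Embedding.coeFn_mk, hφ.mem_set_image] at hs
    exact (h.eq_or_eq e hvP hs).imp (congrArg φ) (congrArg φ)
  cross := by
    rintro _ _ _ _ p ⟨-, a, b, e, rfl, rfl⟩ ⟨-, c, d, e', rfl, rfl⟩ hne hp hp'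
    rw [← image_segment ℝ φ] at hp hp'
    obtain ⟨p, hp, rfl⟩ := hp
    rw [hφ.mem_set_image] at hp'
    exact mem_map_of_mem ⟨φ, hφ⟩ (h.cross e e' (fun hs => hne (congrArg (Sym2.map φ) hs)) hp hp')

end IsStraightPlane

/-! ### Fragments in triangles -/

/-- The signed area of the parallelogram that `b - a` and `p - a` span. -/
def area (a b p : ℝ × ℝ) : ℝ := (b.1 - a.1) * (p.2 - a.2) - (b.2 - a.2) * (p.1 - a.1)

/-- A straight-line drawing of a fragment in the triangle whose corners are the terminals. -/
structure IsDrawnFragment (G : SimpleGraph (ℝ × ℝ)) (P : Finset (ℝ × ℝ)) (a b c : ℝ × ℝ) :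
    Prop where
  frag : IsFragment G P {a, b, c}
  plane : IsStraightPlane G P
  subset : (P : Set (ℝ × ℝ)) ⊆ convexHull ℝ {a, b, c}

/-- The affine map that sends the triangle with corners `(0, 0)`, `(r, 0)`, `(0, r)` to the triangle
with corners `a`, `b`, `c`. -/
noncomputable def triangleMap (r : ℝ) (a b c : ℝ × ℝ) : (ℝ × ℝ) →ᵃ[ℝ] ℝ × ℝ :=
  ((LinearMap.fst ℝ ℝ ℝ).smulRight (r⁻¹ • (b - a)) +
    (LinearMap.snd ℝ ℝ ℝ).smulRight (r⁻¹ • (c - a))).toAffineMap + AffineMap.const ℝ (ℝ × ℝ) a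

theorem triangleMap_apply (r : ℝ) (a b c p : ℝ × ℝ) :
    triangleMap r a b c p = (a.1 + (p.1 * (b.1 - a.1) + p.2 * (c.1 - a.1)) / r,
      a.2 + (p.1 * (b.2 - a.2) + p.2 * (c.2 - a.2)) / r) := by
  ext <;> simp [triangleMap] <;> ring

section triangleMap

variable {r : ℝ} {a b c : ℝ × ℝ}

theorem triangleMap_zero : triangleMap r a b c (0, 0) = a := by
  simp [triangleMap_apply]

theorem triangleMap_fst (hr : 0 < r) : triangleMap r a b c (r, 0) = b := by
  rw [triangleMap_apply]; ext <;> simp <;> field_simp <;> ring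

theorem triangleMap_snd (hr : 0 < r) : triangleMap r a b c (0, r) = c := by
  rw [triangleMap_apply]; ext <;> simp <;> field_simp <;> ring

theorem triangleMap_injective (hr : 0 < r) (h : area a b c ≠ 0) :
    Function.Injective (triangleMap r a b c) := by
  intro p q hpq
  simp only [triangleMap_apply, Prod.mk.injEq, add_right_inj, div_left_inj' hr.ne'] at hpq
  obtain ⟨h1, h2⟩ := hpq
  unfold area at h
  ext
  · apply mul_right_cancel₀ h
    linear_combination (c.2 - a.2) * h1 - (c.1 - a.1) * h2
  · apply mul_right_cancel₀ h
    linear_combination (b.1 - a.1) * h2 - (b.2 - a.2) * h1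

end triangleMap

namespace IsDrawnFragment

variable {G H : SimpleGraph (ℝ × ℝ)} {P Q : Finset (ℝ × ℝ)} {a b c : ℝ × ℝ} {r : ℝ}

theorem drawnSet_subset (h : IsDrawnFragment G P a b c) :
    drawnSet G P ⊆ convexHull ℝ {a, b, c} :=
  h.plane.drawnSet_subset (convex_convexHull ..) h.subset

theorem image_subset {f : (ℝ × ℝ) →ᵃ[ℝ] ℝ × ℝ} (hf : Function.Injective f)
    (h : (P : Set (ℝ × ℝ)) ⊆ convexHull ℝ {a, b, c}) :
    ((P.map ⟨f, hf⟩ : Finset (ℝ × ℝ)) : Set (ℝ × ℝ)) ⊆ convexHull ℝ {f a, f b, f c} := by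
  have e : ({f a, f b, f c} : Set (ℝ × ℝ)) = f '' {a, b, c} := by simp [Set.image_insert_eq]
  rw [coe_map, e, ← f.image_convexHull]
  exact Set.image_mono h

/-- A drawn fragment is moved to another triangle by an affine map. -/
theorem transfer (h : IsDrawnFragment G P (0, 0) (r, 0) (0, r)) (hr : 0 < r)
    (habc : area a b c ≠ 0) : ∃ H Q, #Q = #P ∧ IsDrawnFragment H Q a b c := by
  have hf := triangleMap_injective hr habc
  refine ⟨_, P.map ⟨_, hf⟩, card_map _, ?_, h.plane.map _ hf, ?_⟩
  · simpa [triangleMap_zero, triangleMap_fst hr, triangleMap_snd hr] using h.frag.map ⟨_, hf⟩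
  · simpa [triangleMap_zero, triangleMap_fst hr, triangleMap_snd hr] using image_subset hf h.subset

end IsDrawnFragment

/-- There is a drawn fragment on `m` vertices. -/
def HasDrawnFragment (m : ℕ) : Prop :=
  ∃ (r : ℝ) (G : SimpleGraph (ℝ × ℝ)) (P : Finset (ℝ × ℝ)),
    0 < r ∧ #P = m ∧ IsDrawnFragment G P (0, 0) (r, 0) (0, r)

theorem HasDrawnFragment.exists_triangle {m : ℕ} (h : HasDrawnFragment m) {a b c : ℝ × ℝ}
    (habc : area a b c ≠ 0) : ∃ G P, #P = m ∧ IsDrawnFragment G P a b c := by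
  obtain ⟨r, G, P, hr, rfl, h⟩ := h
  exact h.transfer hr habc

/-- A host in which the exceptional vertex `y` is not drawn: the triangle of its neighbors `p`, `q`,
`r` is free for the drawing of another fragment. -/
structure IsDrawnHost (G : SimpleGraph (ℝ × ℝ)) (P : Finset (ℝ × ℝ)) (a b c y p q r : ℝ × ℝ) :
    Prop where
  host : IsHost G P {a, b, c} y {p, q, r}
  mem : ∀ u v, G.Adj u v → u ∈ P
  plane : IsStraightPlane (G.isolate y) (P.erase y)
  subset : ((P.erase y : Finset (ℝ × ℝ)) : Set (ℝ × ℝ)) ⊆ convexHull ℝ {a, b, c}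
  free : ∀ z ∈ drawnSet (G.isolate y) (P.erase y), z ∈ convexHull ℝ {p, q, r} →
    z ∈ ({p, q, r} : Finset (ℝ × ℝ))
  area_ne : area p q r ≠ 0

theorem IsDrawnHost.hasDrawnFragment {G : SimpleGraph (ℝ × ℝ)} {P : Finset (ℝ × ℝ)}
    {y p q r : ℝ × ℝ} {l : ℝ} (hl : 0 < l) (h : IsDrawnHost G P (0, 0) (l, 0) (0, l) y p q r)
    {m : ℕ} (hm : HasDrawnFragment m) : HasDrawnFragment (#P + m - 4) := by
  obtain ⟨H, Q, rfl, k⟩ := hm.exists_triangle h.area_ne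
  have hN : ({p, q, r} : Finset (ℝ × ℝ)) ⊆ P.erase y := fun v hv =>
    mem_erase.2 (h.host.mem_erase_of_mem_nbr hv)
  have hPQ : ∀ v ∈ P.erase y, v ∈ Q → v ∈ ({p, q, r} : Finset (ℝ × ℝ)) := fun v hv hv' =>
    h.free v (.inl hv) (k.subset hv')
  have hinter : P.erase y ∩ Q = {p, q, r} :=
    subset_antisymm (fun v hv => hPQ v (mem_inter.1 hv).1 (mem_inter.1 hv).2)
      (subset_inter hN k.frag.subset)
  refine ⟨l, G.isolate y ⊔ H, P.erase y ∪ Q, hl, ?_, ?_, ?_, ?_⟩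
  · have := card_union_add_card_inter (P.erase y) Q
    rw [hinter, card_erase_of_mem h.host.mem, h.host.card_nbr] at this
    have := card_pos.2 ⟨y, h.host.mem⟩
    omega
  · exact h.host.subst k.frag (fun u v e => h.mem u v e) (fun u v e => k.plane.mem e)
      fun v hv hv' hy => hPQ v (mem_erase.2 ⟨hy, hv⟩) hv'
  · refine h.plane.sup k.plane fun z hz hz' => ?_
    have := h.free z hz (k.drawnSet_subset hz')
    exact ⟨hN this, k.frag.subset this⟩
  · rw [coe_union, Set.union_subset_iff]
    refine ⟨h.subset, k.subset.trans (convexHull_min ?_ (convex_convexHull ..))⟩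
    have : (({p, q, r} : Finset (ℝ × ℝ)) : Set (ℝ × ℝ)) ⊆ ((P.erase y : Finset _) : Set (ℝ × ℝ)) :=
      coe_subset.2 hN
    simpa using this.trans h.subset

/-- A linear inequality holds in a triangle if it holds at the corners. -/
theorem le_of_mem_triangle {a b c p : ℝ × ℝ} (u v w : ℝ) (hp : p ∈ convexHull ℝ {a, b, c})
    (ha : u * a.1 + v * a.2 ≤ w) (hb : u * b.1 + v * b.2 ≤ w) (hc : u * c.1 + v * c.2 ≤ w) :
    u * p.1 + v * p.2 ≤ w := by
  have hconv : Convex ℝ {z : ℝ × ℝ | u * z.1 + v * z.2 ≤ w} :=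
    convex_halfSpace_le (f := fun z : ℝ × ℝ => u * z.1 + v * z.2)
      ⟨fun x y => by simp; ring, fun t x => by simp; ring⟩ w
  refine convexHull_min (fun z hz => ?_) hconv hp
  simp only [Set.mem_insert_iff, Set.mem_singleton_iff] at hz
  rcases hz with rfl | rfl | rfl <;> assumption

theorem vertical_of_mem_segment {x s t : ℝ} {p : ℝ × ℝ} (hst : t ≤ s)
    (hp : p ∈ segment ℝ (x, s) (x, t)) : p.1 = x ∧ t ≤ p.2 ∧ p.2 ≤ s := by
  obtain ⟨i, j, hi, hj, hij, rfl⟩ := hp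
  obtain rfl : i = 1 - j := by linarith
  refine ⟨?_, ?_, ?_⟩ <;> simp <;> nlinarith

/-! ### The plane ring -/

/-- Four triangles, of which the upper two share the corner `(0, 2)` and the lower two the corner
`(0, -2)`, carry the fragments; four vertical segments carry the edges between them. -/
theorem exists_planar_isHypotraceable {m₁ m₂ m₃ m₄ : ℕ} (h₁ : HasDrawnFragment m₁)
    (h₂ : HasDrawnFragment m₂) (h₃ : HasDrawnFragment m₃) (h₄ : HasDrawnFragment m₄) {n : ℕ}
    (hn : n + 2 = m₁ + m₂ + m₃ + m₄) :
    ∃ G : SimpleGraph (Fin n), G.IsPlanar ∧ G.IsHypotraceable := by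
  obtain ⟨G₁, P₁, rfl, k₁⟩ := h₁.exists_triangle (a := (0, 2)) (b := (-3, 1)) (c := (-1, 1))
    (by norm_num [area])
  obtain ⟨G₂, P₂, rfl, k₂⟩ := h₂.exists_triangle (a := (0, 2)) (b := (3, 1)) (c := (1, 1))
    (by norm_num [area])
  obtain ⟨G₃, P₃, rfl, k₃⟩ := h₃.exists_triangle (a := (0, -2)) (b := (-3, -1)) (c := (-1, -1))
    (by norm_num [area])
  obtain ⟨G₄, P₄, rfl, k₄⟩ := h₄.exists_triangle (a := (0, -2)) (b := (3, -1)) (c := (1, -1))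
    (by norm_num [area])
  -- each drawing lies in a strip and a half-plane, and for the two drawings with a common corner
  -- these regions meet only in that corner
  have T₁ : ∀ p ∈ drawnSet G₁ P₁, 1 ≤ p.2 ∧ p.2 ≤ 2 ∧ 2 + p.1 ≤ p.2 := fun p hp => by
    have h := k₁.drawnSet_subset hp
    have i := le_of_mem_triangle 0 (-1) (-1) h (by norm_num) (by norm_num) (by norm_num)
    have j := le_of_mem_triangle 0 1 2 h (by norm_num) (by norm_num) (by norm_num)
    have k := le_of_mem_triangle 1 (-1) (-2) h (by norm_num) (by norm_num) (by norm_num)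
    refine ⟨?_, ?_, ?_⟩ <;> linarith
  have T₂ : ∀ p ∈ drawnSet G₂ P₂, 1 ≤ p.2 ∧ p.2 ≤ 2 ∧ 2 - p.1 ≤ p.2 := fun p hp => by
    have h := k₂.drawnSet_subset hp
    have i := le_of_mem_triangle 0 (-1) (-1) h (by norm_num) (by norm_num) (by norm_num)
    have j := le_of_mem_triangle 0 1 2 h (by norm_num) (by norm_num) (by norm_num)
    have k := le_of_mem_triangle (-1) (-1) (-2) h (by norm_num) (by norm_num) (by norm_num)
    refine ⟨?_, ?_, ?_⟩ <;> linarith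
  have T₃ : ∀ p ∈ drawnSet G₃ P₃, p.2 ≤ -1 ∧ -2 ≤ p.2 ∧ p.2 ≤ -2 - p.1 := fun p hp => by
    have h := k₃.drawnSet_subset hp
    have i := le_of_mem_triangle 0 1 (-1) h (by norm_num) (by norm_num) (by norm_num)
    have j := le_of_mem_triangle 0 (-1) 2 h (by norm_num) (by norm_num) (by norm_num)
    have k := le_of_mem_triangle 1 1 (-2) h (by norm_num) (by norm_num) (by norm_num)
    refine ⟨?_, ?_, ?_⟩ <;> linarith
  have T₄ : ∀ p ∈ drawnSet G₄ P₄, p.2 ≤ -1 ∧ -2 ≤ p.2 ∧ p.2 ≤ -2 + p.1 := fun p hp => by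
    have h := k₄.drawnSet_subset hp
    have i := le_of_mem_triangle 0 1 (-1) h (by norm_num) (by norm_num) (by norm_num)
    have j := le_of_mem_triangle 0 (-1) 2 h (by norm_num) (by norm_num) (by norm_num)
    have k := le_of_mem_triangle (-1) 1 (-2) h (by norm_num) (by norm_num) (by norm_num)
    refine ⟨?_, ?_, ?_⟩ <;> linarith
  have i₁₂ : ∀ p ∈ drawnSet G₁ P₁, p ∈ drawnSet G₂ P₂ → p = (0, 2) := fun p hp hp' => by
    have := T₁ p hp; have := T₂ p hp'
    ext <;> dsimp only <;> linarith
  have i₃₄ : ∀ p ∈ drawnSet G₃ P₃, p ∈ drawnSet G₄ P₄ → p = (0, -2) := fun p hp hp' => by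
    have := T₃ p hp; have := T₄ p hp'
    ext <;> dsimp only <;> linarith
  have up : ∀ p ∈ drawnSet (G₁ ⊔ G₂) (P₁ ∪ P₂), 1 ≤ p.2 := fun p hp =>
    (IsStraightPlane.drawnSet_sup hp).elim (fun h => (T₁ p h).1) fun h => (T₂ p h).1
  have dn : ∀ p ∈ drawnSet (G₃ ⊔ G₄) (P₃ ∪ P₄), p.2 ≤ -1 := fun p hp =>
    (IsStraightPlane.drawnSet_sup hp).elim (fun h => (T₃ p h).1) fun h => (T₄ p h).1
  have hP₁ : ∀ v ∈ ({(0, 2), (-3, 1), (-1, 1)} : Finset (ℝ × ℝ)), v ∈ P₁ :=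
    fun v hv => k₁.frag.subset hv
  have hP₂ : ∀ v ∈ ({(0, 2), (3, 1), (1, 1)} : Finset (ℝ × ℝ)), v ∈ P₂ :=
    fun v hv => k₂.frag.subset hv
  have hP₃ : ∀ v ∈ ({(0, -2), (-3, -1), (-1, -1)} : Finset (ℝ × ℝ)), v ∈ P₃ :=
    fun v hv => k₃.frag.subset hv
  have hP₄ : ∀ v ∈ ({(0, -2), (3, -1), (1, -1)} : Finset (ℝ × ℝ)), v ∈ P₄ :=
    fun v hv => k₄.frag.subset hv
  have α₁ := hP₁ (0, 2) (by simp)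
  have α₂ := hP₂ (0, 2) (by simp)
  have β₃ := hP₃ (0, -2) (by simp)
  have β₄ := hP₄ (0, -2) (by simp)
  have b₁ := hP₁ (-3, 1) (by simp)
  have c₁ := hP₁ (-1, 1) (by simp)
  have b₂ := hP₂ (3, 1) (by simp)
  have c₂ := hP₂ (1, 1) (by simp)
  have b₃ := hP₃ (-3, -1) (by simp)
  have c₃ := hP₃ (-1, -1) (by simp)
  have b₄ := hP₄ (3, -1) (by simp)
  have c₄ := hP₄ (1, -1) (by simp)
  set P := (P₁ ∪ P₂) ∪ (P₃ ∪ P₄) with hP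
  have plane₀ : IsStraightPlane ((G₁ ⊔ G₂) ⊔ (G₃ ⊔ G₄)) P := by
    refine (k₁.plane.sup k₂.plane fun p hp hp' => ?_).sup
      (k₃.plane.sup k₄.plane fun p hp hp' => ?_) fun p hp hp' => ?_
    · rw [i₁₂ p hp hp']; exact ⟨α₁, α₂⟩
    · rw [i₃₄ p hp hp']; exact ⟨β₃, β₄⟩
    · have := up p hp; have := dn p hp'; linarith
  have fourParts : ∀ p ∈ drawnSet ((G₁ ⊔ G₂) ⊔ (G₃ ⊔ G₄)) P,
      (1 ≤ p.2 ∧ p.2 ≤ 2 ∧ 2 + p.1 ≤ p.2 ∨ 1 ≤ p.2 ∧ p.2 ≤ 2 ∧ 2 - p.1 ≤ p.2) ∨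
      (p.2 ≤ -1 ∧ -2 ≤ p.2 ∧ p.2 ≤ -2 - p.1 ∨ p.2 ≤ -1 ∧ -2 ≤ p.2 ∧ p.2 ≤ -2 + p.1) :=
    fun p hp => (IsStraightPlane.drawnSet_sup hp).imp
      (fun h => (IsStraightPlane.drawnSet_sup h).imp (T₁ p) (T₂ p))
      (fun h => (IsStraightPlane.drawnSet_sup h).imp (T₃ p) (T₄ p))
  -- the vertical segments meet the drawings at most in their ends
  have meet : ∀ x : ℝ, ∀ p ∈ drawnSet ((G₁ ⊔ G₂) ⊔ (G₃ ⊔ G₄)) P,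
      p ∈ segment ℝ (x, (1 : ℝ)) (x, -1) → p = (x, 1) ∨ p = (x, -1) := fun x p hp hs => by
    obtain ⟨h1, h2, h3⟩ := vertical_of_mem_segment (by norm_num) hs
    rcases fourParts p hp with (h | h) | (h | h)
    · left; ext <;> dsimp only <;> linarith
    · left; ext <;> dsimp only <;> linarith
    · right; ext <;> dsimp only <;> linarith
    · right; ext <;> dsimp only <;> linarith
  have ne : ∀ x : ℝ, (x, (1 : ℝ)) ≠ (x, -1) := fun x => by norm_num
  have apart : ∀ x x' : ℝ, x ≠ x' → ∀ p ∈ segment ℝ (x, (1 : ℝ)) (x, -1),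
      p ∉ segment ℝ (x', (1 : ℝ)) (x', -1) := fun x x' hx p hp hp' =>
    hx ((vertical_of_mem_segment (by norm_num) hp).1.symm.trans
      (vertical_of_mem_segment (by norm_num) hp').1)
  have b₁P : ((-3, 1) : ℝ × ℝ) ∈ P := by simp [hP, b₁]
  have c₁P : ((-1, 1) : ℝ × ℝ) ∈ P := by simp [hP, c₁]
  have b₂P : ((3, 1) : ℝ × ℝ) ∈ P := by simp [hP, b₂]
  have c₂P : ((1, 1) : ℝ × ℝ) ∈ P := by simp [hP, c₂]
  have b₃P : ((-3, -1) : ℝ × ℝ) ∈ P := by simp [hP, b₃]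
  have c₃P : ((-1, -1) : ℝ × ℝ) ∈ P := by simp [hP, c₃]
  have b₄P : ((3, -1) : ℝ × ℝ) ∈ P := by simp [hP, b₄]
  have c₄P : ((1, -1) : ℝ × ℝ) ∈ P := by simp [hP, c₄]
  have plane₁ := plane₀.sup_edge (ne (-3)) b₁P b₃P (meet (-3))
  have plane₂ := plane₁.sup_edge (ne (-1)) c₁P c₃P fun p hp hs =>
    (IsStraightPlane.drawnSet_sup_edge (ne _) b₁P b₃P hp).elim (fun h => meet _ p h hs)
      fun h => absurd hs (apart _ _ (by norm_num) p h)
  have plane₃ := plane₂.sup_edge (ne 3) b₂P b₄P fun p hp hs =>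
    (IsStraightPlane.drawnSet_sup_edge (ne _) c₁P c₃P hp).elim
      (fun h => (IsStraightPlane.drawnSet_sup_edge (ne _) b₁P b₃P h).elim (fun h => meet _ p h hs)
        fun h => absurd hs (apart _ _ (by norm_num) p h))
      fun h => absurd hs (apart _ _ (by norm_num) p h)
  have plane₄ := plane₃.sup_edge (ne 1) c₂P c₄P fun p hp hs =>
    (IsStraightPlane.drawnSet_sup_edge (ne _) b₂P b₄P hp).elim
      (fun h => (IsStraightPlane.drawnSet_sup_edge (ne _) c₁P c₃P h).elim
        (fun h => (IsStraightPlane.drawnSet_sup_edge (ne _) b₁P b₃P h).elim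
          (fun h => meet _ p h hs) fun h => absurd hs (apart _ _ (by norm_num) p h))
        fun h => absurd hs (apart _ _ (by norm_num) p h))
      fun h => absurd hs (apart _ _ (by norm_num) p h)
  have v₁₂ : ∀ v ∈ P₁, v ∈ P₂ → v = (0, 2) := fun v hv hv' => i₁₂ v (.inl hv) (.inl hv')
  have v₃₄ : ∀ v ∈ P₃, v ∈ P₄ → v = (0, -2) := fun v hv hv' => i₃₄ v (.inl hv) (.inl hv')
  have up₁ : ∀ v ∈ P₁, 1 ≤ v.2 := fun v hv => (T₁ v (.inl hv)).1
  have up₂ : ∀ v ∈ P₂, 1 ≤ v.2 := fun v hv => (T₂ v (.inl hv)).1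
  have dn₃ : ∀ v ∈ P₃, v.2 ≤ -1 := fun v hv => (T₃ v (.inl hv)).1
  have dn₄ : ∀ v ∈ P₄, v.2 ≤ -1 := fun v hv => (T₄ v (.inl hv)).1
  have disj : ∀ v, v ∈ P₁ ∨ v ∈ P₂ → v ∈ P₃ ∨ v ∈ P₄ → False := fun v h h' => by
    have := h.elim (up₁ v) (up₂ v)
    have := h'.elim (dn₃ v) (dn₄ v)
    linarith
  set G := (G₁ ⊔ G₂) ⊔ (G₃ ⊔ G₄) ⊔ SimpleGraph.edge (-3, 1) (-3, -1) ⊔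
    SimpleGraph.edge (-1, 1) (-1, -1) ⊔ SimpleGraph.edge (3, 1) (3, -1) ⊔
    SimpleGraph.edge (1, 1) (1, -1) with hG
  have hGadj : ∀ u v, G.Adj u v ↔ (((((G₁.Adj u v ∨ G₂.Adj u v) ∨ (G₃.Adj u v ∨ G₄.Adj u v)) ∨
      (SimpleGraph.edge (-3, 1) (-3, -1)).Adj u v) ∨ (SimpleGraph.edge (-1, 1) (-1, -1)).Adj u v) ∨
      (SimpleGraph.edge (3, 1) (3, -1)).Adj u v) ∨ (SimpleGraph.edge (1, 1) (1, -1)).Adj u v :=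
    fun u v => Iff.rfl
  have noEdge : ∀ x : ℝ, ∀ u v : ℝ × ℝ, (1 ≤ u.2 ∧ 1 ≤ v.2 ∨ u.2 ≤ -1 ∧ v.2 ≤ -1) →
      ¬ (SimpleGraph.edge (x, (1 : ℝ)) (x, -1)).Adj u v := fun x u v h e => by
    rw [SimpleGraph.edge_adj] at e
    rcases e.1 with ⟨rfl, rfl⟩ | ⟨rfl, rfl⟩ <;> norm_num at h
  have ring : IsRing G P P₁ P₂ P₃ P₄ (0, 2) (0, -2) (-3, 1) (-1, 1) (3, 1) (1, 1) (-3, -1) (-1, -1)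
      (3, -1) (1, -1) := by
    have edgeSym : ∀ (x : ℝ) (u v : ℝ × ℝ), (SimpleGraph.edge (x, (1 : ℝ)) (x, -1)).Adj u v →
        s(u, v) = s((x, 1), (x, -1)) := fun x u v e => by
      rw [SimpleGraph.edge_adj] at e
      rcases e.1 with ⟨rfl, rfl⟩ | ⟨rfl, rfl⟩ <;> simp
    refine ⟨fun v => by simp [hP, or_assoc], k₁.frag.congr fun u hu v hv => ?_,
      k₂.frag.congr fun u hu v hv => ?_, k₃.frag.congr fun u hu v hv => ?_,
      k₄.frag.congr fun u hu v hv => ?_, v₁₂, v₃₄, disj, ?_, ?_, ?_, ?_, fun u v e => ?_⟩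
    · have h := fun x => noEdge x u v (.inl ⟨up₁ u hu, up₁ v hv⟩)
      simp only [hGadj, h, or_false]
      refine ⟨fun e => .inl (.inl e), ?_⟩
      rintro ((e | e) | (e | e))
      · exact e
      · exact absurd ((v₁₂ u hu (k₂.plane.mem e)).trans
          (v₁₂ v hv (k₂.plane.mem_right e)).symm) e.ne
      · exact (disj u (.inl hu) (.inl (k₃.plane.mem e))).elim
      · exact (disj u (.inl hu) (.inr (k₄.plane.mem e))).elim
    · have h := fun x => noEdge x u v (.inl ⟨up₂ u hu, up₂ v hv⟩)
      simp only [hGadj, h, or_false]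
      refine ⟨fun e => .inl (.inr e), ?_⟩
      rintro ((e | e) | (e | e))
      · exact absurd ((v₁₂ u (k₁.plane.mem e) hu).trans
          (v₁₂ v (k₁.plane.mem_right e) hv).symm) e.ne
      · exact e
      · exact (disj u (.inr hu) (.inl (k₃.plane.mem e))).elim
      · exact (disj u (.inr hu) (.inr (k₄.plane.mem e))).elim
    · have h := fun x => noEdge x u v (.inr ⟨dn₃ u hu, dn₃ v hv⟩)
      simp only [hGadj, h, or_false]
      refine ⟨fun e => .inr (.inl e), ?_⟩
      rintro ((e | e) | (e | e))
      · exact (disj u (.inl (k₁.plane.mem e)) (.inl hu)).elim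
      · exact (disj u (.inr (k₂.plane.mem e)) (.inl hu)).elim
      · exact e
      · exact absurd ((v₃₄ u hu (k₄.plane.mem e)).trans
          (v₃₄ v hv (k₄.plane.mem_right e)).symm) e.ne
    · have h := fun x => noEdge x u v (.inr ⟨dn₄ u hu, dn₄ v hv⟩)
      simp only [hGadj, h, or_false]
      refine ⟨fun e => .inr (.inr e), ?_⟩
      rintro ((e | e) | (e | e))
      · exact (disj u (.inl (k₁.plane.mem e)) (.inr hu)).elim
      · exact (disj u (.inr (k₂.plane.mem e)) (.inr hu)).elim
      · exact absurd ((v₃₄ u (k₃.plane.mem e) hu).trans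
          (v₃₄ v (k₃.plane.mem_right e) hv).symm) e.ne
      · exact e
    · exact (hGadj _ _).2 (.inl (.inl (.inl (.inr (by norm_num [SimpleGraph.edge_adj])))))
    · exact (hGadj _ _).2 (.inl (.inl (.inr (by norm_num [SimpleGraph.edge_adj]))))
    · exact (hGadj _ _).2 (.inl (.inr (by norm_num [SimpleGraph.edge_adj])))
    · exact (hGadj _ _).2 (.inr (by norm_num [SimpleGraph.edge_adj]))
    · rcases (hGadj u v).1 e with ((((((e | e) | (e | e)) | e) | e) | e) | e)
      · exact .inl ⟨k₁.plane.mem e, k₁.plane.mem_right e⟩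
      · exact .inr (.inl ⟨k₂.plane.mem e, k₂.plane.mem_right e⟩)
      · exact .inr (.inr (.inl ⟨k₃.plane.mem e, k₃.plane.mem_right e⟩))
      · exact .inr (.inr (.inr (.inl ⟨k₄.plane.mem e, k₄.plane.mem_right e⟩)))
      · exact .inr (.inr (.inr (.inr (.inl (edgeSym _ u v e)))))
      · exact .inr (.inr (.inr (.inr (.inr (.inl (edgeSym _ u v e))))))
      · exact .inr (.inr (.inr (.inr (.inr (.inr (.inl (edgeSym _ u v e)))))))
      · exact .inr (.inr (.inr (.inr (.inr (.inr (.inr (edgeSym _ u v e)))))))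
  have card : #P = n := by
    have e₁ : P₁ ∩ P₂ = {(0, 2)} := by
      ext v
      simp only [mem_inter, mem_singleton]
      exact ⟨fun h => v₁₂ v h.1 h.2, by rintro rfl; exact ⟨α₁, α₂⟩⟩
    have e₂ : P₃ ∩ P₄ = {(0, -2)} := by
      ext v
      simp only [mem_inter, mem_singleton]
      exact ⟨fun h => v₃₄ v h.1 h.2, by rintro rfl; exact ⟨β₃, β₄⟩⟩
    have e₃ : Disjoint (P₁ ∪ P₂) (P₃ ∪ P₄) :=
      disjoint_left.2 fun v h h' => disj v (mem_union.1 h) (mem_union.1 h')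
    have c₁ := card_union_add_card_inter P₁ P₂
    have c₂ := card_union_add_card_inter P₃ P₄
    rw [e₁, card_singleton] at c₁
    rw [e₂, card_singleton] at c₂
    rw [hP, card_union_of_disjoint e₃]
    omega
  let ε : Fin n ≃ P := (P.equivFinOfCardEq card).symm
  exact ⟨_, plane₄.isPlanar_comap ε, isHypotraceable_comap ε ring.not_hamPath
    fun v hv => ring.exists_hamPath_erase hv⟩

/-! ### Exhaustive search for Hamiltonian paths -/

/-- The graph on the natural numbers with a given list of edges. -/
def listGraph (E : List (ℕ × ℕ)) : SimpleGraph ℕ := .fromRel fun u v => (u, v) ∈ E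

/-- The adjacency matrix of `listGraph E`, with rows of 64 bits, in one number. -/
def adjTable (E : List (ℕ × ℕ)) : ℕ :=
  E.foldr (fun e T => T ||| 2 ^ (64 * e.1 + e.2) ||| 2 ^ (64 * e.2 + e.1)) 0

/-- The neighbors of `u` in the set with characteristic bits `m`. -/
def nbrBits (T u m : ℕ) : ℕ := Nat.land (Nat.shiftRight T (Nat.mul 64 u)) m

/-- The elements `w ≠ t` of the bit set `c` that have at most one neighbor in `m`. (Here and below,
explicit recursors on numbers force the evaluation of an argument in the kernel; the first argument
bounds the number of elements of `c` that are examined.) -/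
def forcedBits (T t m : ℕ) : ℕ → ℕ → ℕ :=
  Nat.rec (fun _ => 0) fun _ next c => Nat.rec 0 (fun c' _ =>
    (fun w rest => cond (Nat.beq w t) rest <|
      Nat.rec (Nat.lor rest (Nat.pow 2 w))
        (fun d _ => cond (Nat.beq (Nat.land (Nat.succ d) d) 0) (Nat.lor rest (Nat.pow 2 w)) rest)
        (nbrBits T w m))
      (Nat.log2 (Nat.succ c')) (next (Nat.xor (Nat.succ c') (Nat.pow 2 (Nat.log2 (Nat.succ c')))))) c

/-- Whether `f` holds for an element of the bit set `c`; `true` if the bound on the number of steps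
is exhausted. -/
def anyBit (f : ℕ → Bool) : ℕ → ℕ → Bool :=
  Nat.rec (fun _ => true) fun _ next c => Nat.rec false (fun c' _ =>
    (fun w => cond (f w) true (next (Nat.xor (Nat.succ c') (Nat.pow 2 w))))
      (Nat.log2 (Nat.succ c'))) c

/-- Depth-first search for a path from `u` to `t` whose further vertices are those of the bit set
`m`. A neighbor of `u` which is not chosen as the next vertex is an inner vertex of the remaining
path or equal to `t`, so a neighbor with at most one neighbor in `m` has to be chosen. -/
def searchPath (T t : ℕ) : ℕ → ℕ → ℕ → Bool :=
  Nat.rec (fun _ _ => true) fun _ next u m => Nat.rec (Nat.beq u t) (fun m' _ =>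
    cond (Nat.beq u t) false <|
      (fun c go => Nat.rec (go c)
        (fun f _ => cond (Nat.beq (Nat.land (Nat.succ f) f) 0) (go (Nat.succ f)) false)
        (forcedBits T t (Nat.succ m') 64 c))
      (nbrBits T u (Nat.succ m'))
      (anyBit (fun w => next w (Nat.xor (Nat.succ m') (Nat.pow 2 w))) 64)) m

section bits

theorem testBit_adjTable {E : List (ℕ × ℕ)} (hE : ∀ e ∈ E, e.1 < 64 ∧ e.2 < 64) {u v : ℕ}
    (hv : v < 64) : (adjTable E).testBit (64 * u + v) = true ↔ (u, v) ∈ E ∨ (v, u) ∈ E := by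
  induction E with
  | nil => simp [adjTable]
  | cons e E ih =>
    have h : e.1 < 64 ∧ e.2 < 64 := hE e List.mem_cons_self
    have ih := ih fun e' he' => hE e' (List.mem_cons_of_mem _ he')
    have key : (adjTable (e :: E)).testBit (64 * u + v) = true ↔
        ((adjTable E).testBit (64 * u + v) = true ∨ 64 * e.1 + e.2 = 64 * u + v) ∨
          64 * e.2 + e.1 = 64 * u + v := by
      change (adjTable E ||| 2 ^ (64 * e.1 + e.2) ||| 2 ^ (64 * e.2 + e.1)).testBit _ = true ↔ _
      rw [Nat.testBit_or, Nat.testBit_or, Bool.or_eq_true, Bool.or_eq_true, Nat.testBit_two_pow,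
        Nat.testBit_two_pow, decide_eq_true_eq, decide_eq_true_eq]
    have e₁ : 64 * e.1 + e.2 = 64 * u + v ↔ (u, v) = e := by
      rw [Prod.ext_iff]; dsimp only; omega
    have e₂ : 64 * e.2 + e.1 = 64 * u + v ↔ (v, u) = e := by
      rw [Prod.ext_iff]; dsimp only; omega
    rw [key, ih, e₁, e₂, List.mem_cons, List.mem_cons, or_assoc, or_or_or_comm, or_comm (a := (u, v) ∈ E),
      or_comm (a := (v, u) ∈ E)]

theorem testBit_of_listGraph_adj {E : List (ℕ × ℕ)} (hE : ∀ e ∈ E, e.1 < 64 ∧ e.2 < 64) {u v : ℕ}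
    (h : (listGraph E).Adj u v) : (adjTable E).testBit (64 * u + v) = true := by
  rw [listGraph, SimpleGraph.fromRel_adj] at h
  exact (testBit_adjTable hE (h.2.elim (fun h => (hE _ h).2) fun h => (hE _ h).1)).2 h.2

theorem testBit_nbrBits {T u m w : ℕ} :
    (nbrBits T u m).testBit w = (T.testBit (64 * u + w) && m.testBit w) := by
  change ((T >>> (64 * u)) &&& m).testBit w = _
  rw [Nat.testBit_and, Nat.testBit_shiftRight]

theorem testBit_xor_two_pow {c w : ℕ} (hc : c.testBit w = true) (i : ℕ) :
    (Nat.xor c (Nat.pow 2 w)).testBit i = true ↔ c.testBit i = true ∧ i ≠ w := by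
  change (c ^^^ 2 ^ w).testBit i = true ↔ _
  rw [Nat.testBit_xor, Nat.testBit_two_pow]
  by_cases hj : w = i
  · subst hj; simp [hc]
  · simp [hj, Ne.symm hj]

theorem land_pred_eq_zero_iff {f : ℕ} :
    Nat.land (f + 1) f = 0 ↔ ∃ b, f + 1 = 2 ^ b :=
  Nat.and_sub_one_eq_zero_iff_isPowerOfTwo (Nat.succ_ne_zero f)

theorem anyBit_of_testBit {f : ℕ → Bool} {w : ℕ} (hf : f w = true) :
    ∀ k c, c.testBit w = true → anyBit f k c = true
  | 0, _, _ => rfl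
  | _ + 1, 0, h => by simp at h
  | k + 1, c + 1, h => by
    change cond (f (c + 1).log2) true (anyBit f k (Nat.xor (c + 1) (Nat.pow 2 (c + 1).log2))) = true
    rw [Bool.cond_true_left, Bool.or_eq_true]
    by_cases hw : w = (c + 1).log2
    · exact .inl (hw ▸ hf)
    · exact .inr (anyBit_of_testBit hf k _
        ((testBit_xor_two_pow (Nat.testBit_log2 (Nat.succ_ne_zero c)) w).2 ⟨h, hw⟩))

theorem testBit_forcedBits {T t m z : ℕ} : ∀ k c, (forcedBits T t m k c).testBit z = true →
    c.testBit z = true ∧ z ≠ t ∧ ∀ a b, (nbrBits T z m).testBit a = true →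
      (nbrBits T z m).testBit b = true → a = b
  | 0, _, h => by simp [forcedBits] at h
  | _ + 1, 0, h => by simp [forcedBits] at h
  | k + 1, c + 1, h => by
    have hw := Nat.testBit_log2 (Nat.succ_ne_zero c)
    set w := (c + 1).log2 with hw_def
    set rest := forcedBits T t m k (Nat.xor (c + 1) (Nat.pow 2 w)) with hrest
    have of_rest : rest.testBit z = true → _ := fun h =>
      have := testBit_forcedBits k _ h
      (⟨((testBit_xor_two_pow hw z).1 this.1).1, this.2⟩ :
        (c + 1).testBit z = true ∧ z ≠ t ∧ ∀ a b, (nbrBits T z m).testBit a = true →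
          (nbrBits T z m).testBit b = true → a = b)
    have of_or : (Nat.lor rest (Nat.pow 2 w)).testBit z = true → rest.testBit z = true ∨ w = z :=
      fun h => by
        change (rest ||| 2 ^ w).testBit z = true at h
        rwa [Nat.testBit_or, Bool.or_eq_true, Nat.testBit_two_pow, decide_eq_true_eq] at h
    change (cond (Nat.beq w t) rest (Nat.rec (Nat.lor rest (Nat.pow 2 w))
      (fun d _ => cond (Nat.beq (Nat.land (Nat.succ d) d) 0) (Nat.lor rest (Nat.pow 2 w)) rest)
      (nbrBits T w m))).testBit z = true at h
    by_cases hwt : w = t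
    · rw [hwt, Nat.beq_refl, cond_true] at h
      exact of_rest h
    have hwt' : Nat.beq w t = false := by
      rw [← Bool.not_eq_true, Nat.beq_eq]; exact hwt
    rw [hwt', cond_false] at h
    rcases hd : nbrBits T w m with _ | d
    · rw [hd] at h
      rcases of_or h with h | rfl
      · exact of_rest h
      · exact ⟨hw, hwt, fun a b ha => by simp [hd] at ha⟩
    · rw [hd] at h
      change (cond (Nat.beq (Nat.land (d + 1) d) 0) (Nat.lor rest (Nat.pow 2 w)) rest).testBit z =
        true at h
      rcases hb : Nat.beq (Nat.land (d + 1) d) 0 with _ | _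
      · rw [hb] at h; exact of_rest h
      · rw [hb] at h
        rcases of_or h with h | rfl
        · exact of_rest h
        · obtain ⟨e, he⟩ := land_pred_eq_zero_iff.1 (Nat.eq_of_beq_eq_true hb)
          refine ⟨hw, hwt, fun a b ha hb => ?_⟩
          rw [hd, he, Nat.testBit_two_pow, decide_eq_true_eq] at ha hb
          exact ha.symm.trans hb

end bits

/-- An inner vertex of a path has two neighbors on the path. -/
theorem HamPath.exists_two_nbrs {G : SimpleGraph U} {P : Finset U} {s t z : U}
    (h : HamPath G P s t) (hz : z ∈ P) (hs : z ≠ s) (ht : z ≠ t) :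
    ∃ a ∈ P, ∃ b ∈ P, a ≠ b ∧ G.Adj z a ∧ G.Adj z b := by
  induction h with
  | single a => simp [hs] at hz
  | @cons P a b t hab ha h ih =>
    have hz' : z ∈ P := (mem_insert.1 hz).resolve_left hs
    by_cases hzb : z = b
    · subst hzb
      cases h with
      | single => exact absurd rfl ht
      | @cons P' _ c _ hzc hz'' h' =>
        have hc := h'.left_mem
        exact ⟨a, mem_insert_self .., c, by simp [hc], fun e => ha (by simp [e, hc]), hab.symm, hzc⟩
    · obtain ⟨x, hx, y, hy, h⟩ := ih hz' hzb ht
      exact ⟨x, mem_insert_of_mem hx, y, mem_insert_of_mem hy, h⟩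

/-- The search does not miss a path. -/
theorem searchPath_eq_true {G : SimpleGraph ℕ} {T t : ℕ}
    (hT : ∀ u v, G.Adj u v → T.testBit (64 * u + v) = true) : ∀ k u m (Q : Finset ℕ),
      (∀ i, m.testBit i = true ↔ i ∈ Q ∧ i ≠ u) → HamPath G Q u t → searchPath T t k u m = true
  | 0, _, _, _, _, _ => rfl
  | k + 1, u, 0, Q, hm, h => by
    cases h with
    | single => exact Nat.beq_refl _
    | @cons P _ b _ hab ha h =>
      have := (hm b).2 ⟨by simp [h.left_mem], hab.ne'⟩
      simp at this
  | k + 1, u, m + 1, Q, hm, h => by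
    cases h with
    | single =>
      have := (hm _).1 (Nat.testBit_log2 (Nat.succ_ne_zero m))
      simp at this
    | @cons P _ b _ hab ha h =>
      have hm' : ∀ i, (m + 1).testBit i = true ↔ i ∈ P := fun i => by
        rw [hm, mem_insert]
        exact ⟨fun h => h.1.resolve_left h.2, fun h => ⟨.inr h, fun e => ha (e ▸ h)⟩⟩
      have hut : Nat.beq u t = false := by
        rw [← Bool.not_eq_true, Nat.beq_eq]
        rintro rfl
        exact ha h.right_mem
      have hbm := (hm' b).2 h.left_mem
      have hb : (nbrBits T u (m + 1)).testBit b = true := by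
        rw [testBit_nbrBits, hT u b hab, hbm]; rfl
      have next : searchPath T t k b (Nat.xor (m + 1) (Nat.pow 2 b)) = true :=
        searchPath_eq_true hT k b _ P (fun i => by rw [testBit_xor_two_pow hbm, hm']) h
      let go := anyBit (fun w => searchPath T t k w (Nat.xor (m + 1) (Nat.pow 2 w))) 64
      have hgo : ∀ c, c.testBit b = true → go c = true := fun c hc =>
        anyBit_of_testBit (w := b) next 64 c hc
      change cond (Nat.beq u t) false (Nat.rec (go (nbrBits T u (m + 1)))
        (fun f _ => cond (Nat.beq (Nat.land (Nat.succ f) f) 0) (go (Nat.succ f)) false)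
        (forcedBits T t (m + 1) 64 (nbrBits T u (m + 1)))) = true
      rw [hut, cond_false]
      have forced : ∀ z, (forcedBits T t (m + 1) 64 (nbrBits T u (m + 1))).testBit z = true →
          z = b := fun z hz => by
        obtain ⟨h1, h2, h3⟩ := testBit_forcedBits _ _ hz
        by_contra hzb
        rw [testBit_nbrBits, Bool.and_eq_true, hm'] at h1
        obtain ⟨x, hx, y, hy, hxy, ax, ay⟩ := h.exists_two_nbrs h1.2 hzb h2
        exact hxy (h3 x y (by rw [testBit_nbrBits, hT _ _ ax, (hm' x).2 hx]; rfl)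
          (by rw [testBit_nbrBits, hT _ _ ay, (hm' y).2 hy]; rfl))
      generalize forcedBits T t (m + 1) 64 (nbrBits T u (m + 1)) = F at forced ⊢
      rcases F with _ | f
      · exact hgo _ hb
      · have hf : (f + 1).testBit b = true := by
          have := Nat.testBit_log2 (Nat.succ_ne_zero f)
          rwa [forced _ this] at this
        have : Nat.land (f + 1) f = 0 := land_pred_eq_zero_iff.2 ⟨b, by
          apply Nat.eq_of_testBit_eq
          intro i
          rw [Nat.testBit_two_pow]
          by_cases hi : b = i
          · subst hi; simpa using hf
          · have : ¬ (f + 1).testBit i = true := fun h => hi (forced i h).symm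
            simpa [hi] using this⟩
        change cond (Nat.beq (Nat.land (f + 1) f) 0) (go (f + 1)) false = true
        rw [this, Nat.beq_refl, cond_true]
        exact hgo _ hf

/-! ### Certificates for fragments -/

/-- `f n`, evaluated by the kernel with a numeral in the place of `n`. -/
def withNumeral (f : ℕ → Bool) : ℕ → Bool := Nat.rec (f 0) fun k _ => f (Nat.succ k)

theorem withNumeral_eq (f : ℕ → Bool) : ∀ n, withNumeral f n = f n
  | 0 => rfl
  | _ + 1 => rfl

/-- Whether the list, after `u`, is a path to `t` through all vertices of the bit set `m`. -/
def checkTail (T t : ℕ) : ℕ → ℕ → List ℕ → Bool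
  | u, m, [] => Nat.beq m 0 && Nat.beq u t
  | u, m, w :: l =>
    T.testBit (64 * u + w) && m.testBit w && checkTail T t w (Nat.xor m (Nat.pow 2 w)) l

/-- Whether the list is a path from `s` to `t` through all vertices of the bit set `m`. -/
def checkPath (T m s t : ℕ) : List ℕ → Bool
  | [] => false
  | u :: l => Nat.beq u s && m.testBit u && checkTail T t u (Nat.xor m (Nat.pow 2 u)) l

/-- The bit set of the numbers below `n`. -/
def fullBits (n : ℕ) : ℕ := 2 ^ n - 1

/-- Whether the lists, for the vertices from `v` on, are paths between two terminals through all
other vertices. -/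
def checkDel (T n : ℕ) : ℕ → List (List ℕ) → Bool
  | v, [] => Nat.beq v n
  | v, l :: L => Nat.blt (l.headD 0) 3 && Nat.blt (l.getLastD 0) 3 &&
      !Nat.beq (l.headD 0) (l.getLastD 0) &&
      checkPath T (Nat.xor (fullBits n) (Nat.pow 2 v)) (l.headD 0) (l.getLastD 0) l &&
      checkDel T n (v + 1) L

/-- Whether the lists are Hamiltonian paths that start in the terminals from `s` on and do not end
in `n - 1`. -/
def checkStart (T n : ℕ) : ℕ → List (List ℕ) → Bool
  | s, [] => Nat.beq s 3
  | s, l :: L => checkPath T (fullBits n) s (l.getLastD 0) l && !Nat.beq (l.getLastD 0 + 1) n &&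
      checkStart T n (s + 1) L

/-- Whether `E` is a list of pairs `i < j < n` none of which joins two of `0`, `1`, `2`. -/
def checkEdges (n : ℕ) (E : List (ℕ × ℕ)) : Bool :=
  Nat.blt 3 n && Nat.ble n 64 &&
    E.all fun e => Nat.blt e.1 e.2 && Nat.blt e.2 n && Nat.ble 3 e.2

/-- A certificate that `E` is the edge list of a fragment on `0, …, n - 1` with terminals `0`, `1`,
`2`: a list of paths that avoid one vertex, a list of Hamiltonian paths from the terminals, and an
exhaustive search for Hamiltonian paths between terminals. -/
def checkFragment (n : ℕ) (E : List (ℕ × ℕ)) (del start : List (List ℕ)) : Bool :=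
  checkEdges n E && withNumeral (fun T => checkDel T n 0 del && checkStart T n 0 start &&
    !searchPath T 1 64 0 (Nat.xor (fullBits n) 1) && !searchPath T 2 64 0 (Nat.xor (fullBits n) 1) &&
    !searchPath T 2 64 1 (Nat.xor (fullBits n) 2)) (adjTable E)

section

variable {n : ℕ} {E : List (ℕ × ℕ)} {del start : List (List ℕ)}

theorem listGraph_adj {u v : ℕ} :
    (listGraph E).Adj u v ↔ u ≠ v ∧ ((u, v) ∈ E ∨ (v, u) ∈ E) := by
  rw [listGraph, SimpleGraph.fromRel_adj]

theorem testBit_fullBits {i : ℕ} : (fullBits n).testBit i = true ↔ i < n := by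
  rw [fullBits, Nat.testBit_two_pow_sub_one, decide_eq_true_eq]

theorem of_checkEdges (h : checkEdges n E = true) :
    3 < n ∧ n ≤ 64 ∧ ∀ e ∈ E, e.1 < e.2 ∧ e.2 < n ∧ 3 ≤ e.2 := by
  simp only [checkEdges, Bool.and_eq_true, Nat.blt_eq, Nat.ble_eq, List.all_eq_true] at h
  exact ⟨h.1.1, h.1.2, fun e he => ⟨(h.2 e he).1.1, (h.2 e he).1.2, (h.2 e he).2⟩⟩

theorem checkEdges_lt (h : checkEdges n E = true) : ∀ e ∈ E, e.1 < 64 ∧ e.2 < 64 := fun e he => by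
  obtain ⟨_, h1, h2⟩ := of_checkEdges h
  have := h2 e he
  omega

theorem hamPath_of_checkTail (hE : ∀ e ∈ E, e.1 < 64 ∧ e.2 < 64) {t : ℕ} :
    ∀ (l : List ℕ) (u m : ℕ) (Q : Finset ℕ), (∀ i, m.testBit i = true → i < 64) →
      (∀ i, i ∈ Q ↔ m.testBit i = true) → u ∉ Q → checkTail (adjTable E) t u m l = true →
      HamPath (listGraph E) (insert u Q) u t
  | [], u, m, Q, _, hQ, hu, h => by
    simp only [checkTail, Bool.and_eq_true, Nat.beq_eq] at h
    obtain ⟨rfl, rfl⟩ := h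
    refine (HamPath.single u).cast ?_
    ext i
    simp [hQ]
  | w :: l, u, m, Q, hm, hQ, hu, h => by
    simp only [checkTail, Bool.and_eq_true] at h
    obtain ⟨⟨h1, h2⟩, h3⟩ := h
    have hw : w ∈ Q := (hQ w).2 h2
    have key := hamPath_of_checkTail hE l w _ (Q.erase w)
      (fun i hi => hm i ((testBit_xor_two_pow h2 i).1 hi).1)
      (fun i => by rw [testBit_xor_two_pow h2, mem_erase, hQ, and_comm]) (by simp) h3
    rw [insert_erase hw] at key
    exact .cons (listGraph_adj.2 ⟨fun e => hu (e ▸ hw), (testBit_adjTable hE (hm w h2)).1 h1⟩) hu key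

theorem hamPath_of_checkPath (hE : ∀ e ∈ E, e.1 < 64 ∧ e.2 < 64) {l : List ℕ} {m s t : ℕ}
    {Q : Finset ℕ} (hm : ∀ i, m.testBit i = true → i < 64) (hQ : ∀ i, i ∈ Q ↔ m.testBit i = true)
    (h : checkPath (adjTable E) m s t l = true) : HamPath (listGraph E) Q s t := by
  cases l with
  | nil => simp [checkPath] at h
  | cons u l =>
    simp only [checkPath, Bool.and_eq_true, Nat.beq_eq] at h
    obtain ⟨⟨rfl, h2⟩, h3⟩ := h
    have key := hamPath_of_checkTail hE l u _ (Q.erase u)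
      (fun i hi => hm i ((testBit_xor_two_pow h2 i).1 hi).1)
      (fun i => by rw [testBit_xor_two_pow h2, mem_erase, hQ, and_comm]) (by simp) h3
    rwa [insert_erase ((hQ u).2 h2)] at key

theorem of_checkDel (hE : ∀ e ∈ E, e.1 < 64 ∧ e.2 < 64) (hn : n ≤ 64) :
    ∀ (L : List (List ℕ)) (v : ℕ), checkDel (adjTable E) n v L = true → ∀ w, v ≤ w → w < n →
      ∃ s < 3, ∃ t < 3, s ≠ t ∧ HamPath (listGraph E) ((range n).erase w) s t
  | [], v, h, w, hv, hw => by
    rw [checkDel, Nat.beq_eq] at h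
    omega
  | l :: L, v, h, w, hv, hw => by
    simp only [checkDel, Bool.and_eq_true, Nat.blt_eq, Bool.not_eq_true', ← Bool.not_eq_true,
      Nat.beq_eq] at h
    obtain ⟨⟨⟨⟨h1, h2⟩, h3⟩, h4⟩, h5⟩ := h
    rcases hv.eq_or_lt with rfl | hv
    · have hb := testBit_xor_two_pow (testBit_fullBits.2 hw)
      refine ⟨_, h1, _, h2, h3, hamPath_of_checkPath hE (fun i hi => ?_) (fun i => ?_) h4⟩
      · exact (testBit_fullBits.1 ((hb i).1 hi).1).trans_le hn
      · rw [hb, testBit_fullBits, mem_erase, mem_range, and_comm]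
    · exact of_checkDel hE hn L (v + 1) h5 w hv hw

theorem of_checkStart (hE : ∀ e ∈ E, e.1 < 64 ∧ e.2 < 64) (hn : n ≤ 64) :
    ∀ (L : List (List ℕ)) (s : ℕ), checkStart (adjTable E) n s L = true → ∀ w, s ≤ w → w < 3 →
      ∃ t, t + 1 ≠ n ∧ HamPath (listGraph E) (range n) w t
  | [], s, h, w, hv, hw => by
    rw [checkStart, Nat.beq_eq] at h
    omega
  | l :: L, s, h, w, hv, hw => by
    simp only [checkStart, Bool.and_eq_true, Bool.not_eq_true', ← Bool.not_eq_true, Nat.beq_eq] at h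
    obtain ⟨⟨h1, h2⟩, h3⟩ := h
    rcases hv.eq_or_lt with rfl | hv
    · exact ⟨_, h2, hamPath_of_checkPath hE (fun i hi => (testBit_fullBits.1 hi).trans_le hn)
        (fun i => by rw [testBit_fullBits, mem_range]) h1⟩
    · exact of_checkStart hE hn L (s + 1) h3 w hv hw

theorem not_hamPath_of_searchPath (hE : ∀ e ∈ E, e.1 < 64 ∧ e.2 < 64) {s t : ℕ} (hs : s < n)
    (h : searchPath (adjTable E) t 64 s (Nat.xor (fullBits n) (Nat.pow 2 s)) = false) :
    ¬ HamPath (listGraph E) (range n) s t := fun k => by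
  rw [searchPath_eq_true (fun u v => testBit_of_listGraph_adj hE) 64 s _ (range n)
    (fun i => by rw [testBit_xor_two_pow (testBit_fullBits.2 hs), testBit_fullBits, mem_range]) k] at h
  exact Bool.noConfusion h

theorem mem_terminals {s : ℕ} : s ∈ ({0, 1, 2} : Finset ℕ) ↔ s < 3 := by
  simp only [mem_insert, mem_singleton]; omega

theorem of_checkFragment (h : checkFragment n E del start = true) :
    checkEdges n E = true ∧ checkDel (adjTable E) n 0 del = true ∧
      checkStart (adjTable E) n 0 start = true ∧
      searchPath (adjTable E) 1 64 0 (Nat.xor (fullBits n) 1) = false ∧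
      searchPath (adjTable E) 2 64 0 (Nat.xor (fullBits n) 1) = false ∧
      searchPath (adjTable E) 2 64 1 (Nat.xor (fullBits n) 2) = false := by
  simp only [checkFragment, withNumeral_eq, Bool.and_eq_true, Bool.not_eq_true'] at h
  obtain ⟨h1, ⟨⟨⟨h2, h3⟩, h4⟩, h5⟩, h6⟩ := h
  exact ⟨h1, h2, h3, h4, h5, h6⟩

theorem isFragment_of_check (h : checkFragment n E del start = true) :
    IsFragment (listGraph E) (range n) {0, 1, 2} := by
  obtain ⟨h1, h2, h3, h4, h5, h6⟩ := of_checkFragment h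
  obtain ⟨n1, n2, hlt⟩ := of_checkEdges h1
  have hE := checkEdges_lt h1
  refine ⟨fun s hs => ?_, by simp, ⟨3, mem_range.2 n1, by simp⟩, fun s hs t ht a => ?_,
    fun s hs t ht hst => ?_, fun v hv => ?_, fun s hs => ?_⟩
  · exact mem_range.2 ((mem_terminals.1 hs).trans n1)
  · rw [mem_terminals] at hs ht
    rcases (listGraph_adj.1 a).2 with a | a <;> have := hlt _ a <;> dsimp only at this <;> omega
  · have k01 := not_hamPath_of_searchPath hE (by omega) h4
    have k02 := not_hamPath_of_searchPath hE (by omega) h5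
    have k12 := not_hamPath_of_searchPath hE (by omega) h6
    simp only [mem_insert, mem_singleton] at hs ht
    rcases hs with rfl | rfl | rfl <;> rcases ht with rfl | rfl | rfl
    · exact absurd rfl hst
    · exact k01
    · exact k02
    · exact fun h => k01 h.symm
    · exact absurd rfl hst
    · exact k12
    · exact fun h => k02 h.symm
    · exact fun h => k12 h.symm
    · exact absurd rfl hst
  · obtain ⟨s, hs, t, ht, k⟩ := of_checkDel hE n2 del 0 h2 v (Nat.zero_le v) (mem_range.1 hv)
    exact ⟨s, mem_terminals.2 hs, t, mem_terminals.2 ht, k⟩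
  · obtain ⟨t, -, k⟩ := of_checkStart hE n2 start 0 h3 s (Nat.zero_le s) (mem_terminals.1 hs)
    exact ⟨t, k⟩

/-- Whether `n` has exactly the neighbors `p`, `q`, `r`, which are distinct, no terminals and
pairwise not adjacent. -/
def checkNbrs (n : ℕ) (E : List (ℕ × ℕ)) (p q r : ℕ) : Bool :=
  Nat.blt 2 p && Nat.blt p q && Nat.blt q r && Nat.blt r n &&
    E.contains (p, n) && E.contains (q, n) && E.contains (r, n) &&
    !E.contains (p, q) && !E.contains (p, r) && !E.contains (q, r) &&
    E.all fun e => !Nat.beq e.2 n || Nat.beq e.1 p || Nat.beq e.1 q || Nat.beq e.1 r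

theorem isHost_of_check {p q r : ℕ} (h : checkFragment (n + 1) E del start = true)
    (k : checkNbrs n E p q r = true) :
    IsHost (listGraph E) (range (n + 1)) {0, 1, 2} n {p, q, r} := by
  have h' := of_checkFragment h
  obtain ⟨n1, n2, hlt⟩ := of_checkEdges h'.1
  have hE := checkEdges_lt h'.1
  simp only [checkNbrs, Bool.and_eq_true, Nat.blt_eq, Bool.not_eq_true', ← Bool.not_eq_true,
    List.all_eq_true, Bool.or_eq_true, Nat.beq_eq, List.contains_iff_mem] at k
  obtain ⟨⟨⟨⟨⟨⟨⟨⟨⟨⟨hp, hpq⟩, hqr⟩, hrn⟩, ep⟩, eq⟩, er⟩, epq⟩, epr⟩, eqr⟩, hN⟩ := k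
  refine ⟨isFragment_of_check h, by simp, ?_, fun w hw => ?_, fun w hw => ?_, ?_, ?_,
    fun u hu v hv a => ?_, fun s hs => ?_⟩
  · rw [mem_terminals]; omega
  · rw [listGraph_adj]
    simp only [mem_insert, mem_singleton]
    constructor
    · rintro ⟨-, a | a⟩
      · have := hlt _ a
        have := mem_range.1 hw
        dsimp only at *
        omega
      · have := hN _ a
        tauto
    · rintro (rfl | rfl | rfl)
      · exact ⟨by omega, .inr ep⟩
      · exact ⟨by omega, .inr eq⟩
      · exact ⟨by omega, .inr er⟩
  · simp only [mem_insert, mem_singleton] at hw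
    rw [mem_range]; omega
  · rw [card_eq_three]
    exact ⟨p, q, r, by omega, by omega, by omega, rfl⟩
  · rw [disjoint_left]
    intro s hs hs'
    rw [mem_terminals] at hs
    simp only [mem_insert, mem_singleton] at hs'
    omega
  · obtain ⟨hne, a⟩ := listGraph_adj.1 a
    simp only [mem_insert, mem_singleton] at hu hv
    have key : ∀ i j, (i = p ∨ i = q ∨ i = r) → (j = p ∨ j = q ∨ j = r) → (i, j) ∉ E :=
      fun i j hi hj a => by
        have := (hlt _ a).1
        dsimp only at this
        rcases hi with rfl | rfl | rfl <;> rcases hj with rfl | rfl | rfl <;>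
          first | omega | contradiction
    exact a.elim (key u v hu hv) (key v u hv hu)
  · obtain ⟨t, ht, k⟩ := of_checkStart hE n2 start 0 h'.2.2.1 s (Nat.zero_le s) (mem_terminals.1 hs)
    exact ⟨t, fun e => ht (congrArg (· + 1) e), k⟩

end

/-! ### Certificates for drawings -/

/-- The point with natural coordinates that represents the vertex `i`. -/
def natPoint (x y : ℕ → ℕ) (i : ℕ) : ℝ × ℝ := ((x i : ℝ), (y i : ℝ))

/-- Whether the point of `c` lies strictly to the left of the line from `a` to `b`. -/
def isLeft (x y : ℕ → ℕ) (a b c : ℕ) : Bool :=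
  Nat.blt (Nat.add (Nat.add (Nat.mul (y a) (x b)) (Nat.mul (y b) (x c))) (Nat.mul (y c) (x a)))
    (Nat.add (Nat.add (Nat.mul (x a) (y b)) (Nat.mul (x b) (y c))) (Nat.mul (x c) (y a)))

/-- Whether the relation holds for each two members of the list, in one of the two orders. -/
def allPairs {α : Type*} (R : α → α → Bool) : List α → Bool
  | [] => true
  | a :: l => l.all (R a) && allPairs R l

/-- Whether `c` and `d` lie strictly on the same side of the line through `a` and `b`. -/
def sameSide (x y : ℕ → ℕ) (a b c d : ℕ) : Bool :=
  isLeft x y a b c && isLeft x y a b d || isLeft x y b a c && isLeft x y b a d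

/-- Whether no vertex `i < n` is on the line of an edge that does not contain it, and each two
disjoint edges are separated by the line of one of them. -/
def checkPlane (x y : ℕ → ℕ) (n : ℕ) (E : List (ℕ × ℕ)) : Bool :=
  E.all (fun e => (List.range n).all fun v =>
    Nat.beq v e.1 || Nat.beq v e.2 || isLeft x y e.1 e.2 v || isLeft x y e.2 e.1 v) &&
  allPairs (fun e f => Nat.beq e.1 f.1 || Nat.beq e.1 f.2 || Nat.beq e.2 f.1 || Nat.beq e.2 f.2 ||
    sameSide x y e.1 e.2 f.1 f.2 || sameSide x y f.1 f.2 e.1 e.2) E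

/-- Whether the points of `0, …, n - 1` are distinct and in the triangle with corners `(0, 0)`,
`(r, 0)`, `(0, r)`, and the first three are its corners. -/
def checkFrame (x y : ℕ → ℕ) (n r : ℕ) : Bool :=
  Nat.blt 0 r && Nat.beq (x 0) 0 && Nat.beq (y 0) 0 && Nat.beq (x 1) r && Nat.beq (y 1) 0 &&
    Nat.beq (x 2) 0 && Nat.beq (y 2) r && (List.range n).all (fun i => Nat.ble (x i + y i) r) &&
    allPairs (fun i j => !(Nat.beq (x i) (x j) && Nat.beq (y i) (y j))) (List.range n)

/-- Whether the line from `u` to `w` has the edge from `a` to `b` on its right, where `a` may be `u`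
or `w`. -/
def isRightOf (x y : ℕ → ℕ) (u w a b : ℕ) : Bool :=
  isLeft x y w u b && (isLeft x y w u a || Nat.beq a u || Nat.beq a w)

/-- Whether the triangle of `p`, `q`, `r` contains no other vertex `i < n`, and meets edges between
vertices that are less than `n` at most in its corners. -/
def checkFree (x y : ℕ → ℕ) (n : ℕ) (E : List (ℕ × ℕ)) (p q r : ℕ) : Bool :=
  isLeft x y p q r &&
  (List.range n).all (fun v => Nat.beq v p || Nat.beq v q || Nat.beq v r ||
    isLeft x y q p v || isLeft x y r q v || isLeft x y p r v) &&
  E.all fun e => Nat.ble n e.2 ||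
    isRightOf x y p q e.1 e.2 || isRightOf x y p q e.2 e.1 ||
    isRightOf x y q r e.1 e.2 || isRightOf x y q r e.2 e.1 ||
    isRightOf x y r p e.1 e.2 || isRightOf x y r p e.2 e.1 ||
    isLeft x y e.1 e.2 p && isLeft x y e.1 e.2 q && isLeft x y e.1 e.2 r ||
    isLeft x y e.2 e.1 p && isLeft x y e.2 e.1 q && isLeft x y e.2 e.1 r

theorem allPairs_spec {α : Type*} {R : α → α → Bool} : ∀ {l : List α}, allPairs R l = true →
    ∀ a ∈ l, ∀ b ∈ l, a ≠ b → R a b = true ∨ R b a = true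
  | [], _, a, ha, _, _, _ => by simp at ha
  | c :: l, h, a, ha, b, hb, hab => by
    simp only [allPairs, Bool.and_eq_true, List.all_eq_true] at h
    rcases List.mem_cons.1 ha with rfl | ha' <;> rcases List.mem_cons.1 hb with rfl | hb'
    · exact absurd rfl hab
    · exact .inl (h.1 b hb')
    · exact .inr (h.1 a ha')
    · exact allPairs_spec h.2 a ha' b hb' hab

section area

variable {a b c d p : ℝ × ℝ}

theorem area_swap : area b a p = -area a b p := by unfold area; ring

theorem area_combo {s t : ℝ} (h : s + t = 1) :
    area a b (s • c + t • d) = s * area a b c + t * area a b d := by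
  obtain rfl : s = 1 - t := by linarith
  simp only [area, Prod.fst_add, Prod.snd_add, Prod.smul_fst, Prod.smul_snd, smul_eq_mul]
  ring

theorem area_left : area a b a = 0 := by unfold area; ring

theorem area_right : area a b b = 0 := by unfold area; ring

theorem area_of_mem_segment (h : p ∈ segment ℝ a b) : area a b p = 0 := by
  obtain ⟨s, t, -, -, hst, rfl⟩ := h
  rw [area_combo hst, area_left, area_right]; ring

theorem area_pos_of_mem_segment (hc : 0 < area a b c) (hd : 0 < area a b d)
    (h : p ∈ segment ℝ c d) : 0 < area a b p := by
  obtain ⟨s, t, hs, ht, hst, rfl⟩ := h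
  rw [area_combo hst]
  rcases hs.eq_or_lt with rfl | hs
  · obtain rfl : t = 1 := by linarith
    simpa using hd
  · exact add_pos_of_pos_of_nonneg (mul_pos hs hc) (mul_nonneg ht hd.le)

theorem eq_of_mem_segments (h : area c a b ≠ 0) (ha : p ∈ segment ℝ c a)
    (hb : p ∈ segment ℝ c b) : p = c := by
  have h0 := area_of_mem_segment ha
  obtain ⟨s, t, -, -, hst, rfl⟩ := hb
  rw [area_combo hst, area_left, mul_zero, zero_add, mul_eq_zero] at h0
  obtain rfl := h0.resolve_right h
  obtain rfl : s = 1 := by linarith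
  simp

theorem area_nonneg_of_mem_triangle {u w q r : ℝ × ℝ} (hp : 0 ≤ area u w p) (hq : 0 ≤ area u w q)
    (hr : 0 ≤ area u w r) {z : ℝ × ℝ} (hz : z ∈ convexHull ℝ {p, q, r}) : 0 ≤ area u w z := by
  have := le_of_mem_triangle (w.2 - u.2) (u.1 - w.1)
    ((w.2 - u.2) * u.1 + (u.1 - w.1) * u.2) hz (by unfold area at hp; linarith)
    (by unfold area at hq; linarith) (by unfold area at hr; linarith)
  unfold area
  linarith

theorem area_pos_of_mem_triangle {u w q r : ℝ × ℝ} (hp : 0 < area u w p) (hq : 0 < area u w q)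
    (hr : 0 < area u w r) {z : ℝ × ℝ} (hz : z ∈ convexHull ℝ {p, q, r}) : 0 < area u w z := by
  obtain ⟨ε, h0, h⟩ : ∃ ε, 0 < ε ∧ ε ≤ area u w p ∧ ε ≤ area u w q ∧ ε ≤ area u w r :=
    ⟨min (area u w p) (min (area u w q) (area u w r)), lt_min hp (lt_min hq hr), by simp⟩
  have := le_of_mem_triangle (w.2 - u.2) (u.1 - w.1)
    ((w.2 - u.2) * u.1 + (u.1 - w.1) * u.2 - ε) hz (by unfold area at h; linarith)
    (by unfold area at h; linarith) (by unfold area at h; linarith)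
  unfold area
  linarith

/-- A segment on the right of a line can meet a set on the left only in an end on the line. -/
theorem eq_of_mem_segment_of_right {u w : ℝ × ℝ} (ha : area u w a ≤ 0) (hb : area u w b < 0)
    (hp : p ∈ segment ℝ a b) (h : 0 ≤ area u w p) : p = a ∧ area u w a = 0 := by
  obtain ⟨s, t, hs, ht, hst, rfl⟩ := hp
  rw [area_combo hst] at h
  have h1 : s * area u w a ≤ 0 := mul_nonpos_of_nonneg_of_nonpos hs ha
  have h2 : t = 0 := by
    by_contra h2
    have := mul_neg_of_pos_of_neg (lt_of_le_of_ne ht (Ne.symm h2)) hb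
    linarith
  subst h2
  obtain rfl : s = 1 := by linarith
  exact ⟨by simp, by linarith⟩

theorem mem_triangle {x y r : ℝ} (hx : 0 ≤ x) (hy : 0 ≤ y) (hr : 0 < r) (h : x + y ≤ r) :
    ((x, y) : ℝ × ℝ) ∈ convexHull ℝ {(0, 0), (r, 0), (0, r)} := by
  have hc := convex_convexHull ℝ ({(0, 0), (r, 0), (0, r)} : Set (ℝ × ℝ))
  have h0 : ((0, 0) : ℝ × ℝ) ∈ convexHull ℝ ({(0, 0), (r, 0), (0, r)} : Set (ℝ × ℝ)) :=
    subset_convexHull _ _ (by simp)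
  have h1 : ((r, 0) : ℝ × ℝ) ∈ convexHull ℝ ({(0, 0), (r, 0), (0, r)} : Set (ℝ × ℝ)) :=
    subset_convexHull _ _ (by simp)
  have h2 : ((0, r) : ℝ × ℝ) ∈ convexHull ℝ ({(0, 0), (r, 0), (0, r)} : Set (ℝ × ℝ)) :=
    subset_convexHull _ _ (by simp)
  have := hc.sum_mem (t := Finset.univ) (w := ![(r - x - y) / r, x / r, y / r])
    (z := ![(0, 0), (r, 0), (0, r)])
    (fun i _ => by
      fin_cases i
      · exact div_nonneg (by linarith) hr.le
      · exact div_nonneg hx hr.le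
      · exact div_nonneg hy hr.le)
    (by simp [Fin.sum_univ_three]; field_simp; ring)
    (fun i _ => by fin_cases i <;> assumption)
  simpa [Fin.sum_univ_three, hr.ne'] using this

theorem isLeft_iff {x y : ℕ → ℕ} {a b c : ℕ} : isLeft x y a b c = true ↔
    0 < area (natPoint x y a) (natPoint x y b) (natPoint x y c) := by
  rw [isLeft, Nat.blt_eq, ← Nat.cast_lt (α := ℝ), ← sub_pos]
  have : ((Nat.add (Nat.add (Nat.mul (x a) (y b)) (Nat.mul (x b) (y c))) (Nat.mul (x c) (y a)) : ℕ)
      : ℝ) - (Nat.add (Nat.add (Nat.mul (y a) (x b)) (Nat.mul (y b) (x c))) (Nat.mul (y c) (x a)) : ℕ)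
      = area (natPoint x y a) (natPoint x y b) (natPoint x y c) := by
    simp only [Nat.add_eq, Nat.mul_eq, Nat.cast_add, Nat.cast_mul, area, natPoint]
    ring
  rw [this]

end area

section drawing

variable {x y : ℕ → ℕ} {n r : ℕ} {E : List (ℕ × ℕ)} {f : ℕ ↪ ℝ × ℝ}

theorem exists_edge_of_adj {a b : ℝ × ℝ} (h : ((listGraph E).map f).Adj a b) :
    ∃ e ∈ E, s(a, b) = s(f e.1, f e.2) ∧ segment ℝ a b = segment ℝ (f e.1) (f e.2) := by
  obtain ⟨-, i, j, a, rfl, rfl⟩ := h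
  rcases (listGraph_adj.1 a).2 with h | h
  · exact ⟨_, h, rfl, rfl⟩
  · exact ⟨_, h, Sym2.eq_swap, segment_symm ..⟩

theorem exists_embedding (h : checkFrame x y n r = true) :
    ∃ f : ℕ ↪ ℝ × ℝ, ∀ i < n, f i = natPoint x y i := by
  simp only [checkFrame, Bool.and_eq_true] at h
  have hne := allPairs_spec h.2
  have hne' : ∀ i < n, ∀ j < n, i ≠ j → ¬ (x i = x j ∧ y i = y j) := fun i hi j hj hij he => by
    have := hne i (List.mem_range.2 hi) j (List.mem_range.2 hj) hij
    simp [he.1, he.2] at this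
  refine ⟨⟨fun i => if i < n then natPoint x y i else (-(i + 1), 0), fun i j hij => ?_⟩,
    fun i hi => if_pos hi⟩
  by_contra hne
  by_cases hi : i < n <;> by_cases hj : j < n <;> simp only [hi, hj, if_true, if_false, natPoint,
    Prod.mk.injEq, Nat.cast_inj] at hij
  · exact hne' i hi j hj hne hij
  · have : (0 : ℝ) ≤ x i := Nat.cast_nonneg _
    have : (0 : ℝ) ≤ j := Nat.cast_nonneg _
    linarith [hij.1]
  · have : (0 : ℝ) ≤ x j := Nat.cast_nonneg _
    have : (0 : ℝ) ≤ i := Nat.cast_nonneg _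
    linarith [hij.1]
  · apply hne
    have := hij.1
    exact_mod_cast (by linarith : (i : ℝ) = j)

theorem sameSide_disjoint {a b c d : ℕ} (h : sameSide x y a b c d = true) {p : ℝ × ℝ}
    (hp : p ∈ segment ℝ (natPoint x y a) (natPoint x y b)) :
    p ∉ segment ℝ (natPoint x y c) (natPoint x y d) := fun hp' => by
  simp only [sameSide, Bool.or_eq_true, Bool.and_eq_true, isLeft_iff] at h
  rcases h with h | h
  · exact (area_pos_of_mem_segment h.1 h.2 hp').ne' (area_of_mem_segment hp)
  · rw [segment_symm] at hp
    exact (area_pos_of_mem_segment h.1 h.2 hp').ne' (area_of_mem_segment hp)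

theorem isStraightPlane_of_check (hE : checkEdges n E = true) (h : checkPlane x y n E = true)
    (hf : ∀ i < n, f i = natPoint x y i) :
    IsStraightPlane ((listGraph E).map f) ((range n).map f) := by
  obtain ⟨-, -, hlt⟩ := of_checkEdges hE
  have f₁ : ∀ e ∈ E, f e.1 = natPoint x y e.1 := fun e he => hf _ (by have := hlt e he; omega)
  have f₂ : ∀ e ∈ E, f e.2 = natPoint x y e.2 := fun e he => hf _ (by have := hlt e he; omega)
  simp only [checkPlane, Bool.and_eq_true, List.all_eq_true, List.mem_range, Bool.or_eq_true,
    Nat.beq_eq, isLeft_iff] at h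
  obtain ⟨h1, h2⟩ := h
  have gen : ∀ e ∈ E, ∀ v < n, v ≠ e.1 → v ≠ e.2 → area (f e.1) (f e.2) (f v) ≠ 0 := by
    intro e he v hv n1 n2
    rw [f₁ e he, f₂ e he, hf v hv]
    rcases h1 e he v hv with ((h | h) | h) | h
    · exact absurd h n1
    · exact absurd h n2
    · exact h.ne'
    · rw [area_swap] at h
      exact fun h0 => by simp [h0] at h
  refine ⟨?_, ?_, ?_⟩
  · rintro _ _ ⟨-, i, j, a, rfl, rfl⟩
    refine mem_map_of_mem f (mem_range.2 ?_)
    rcases (listGraph_adj.1 a).2 with a | a <;> have := hlt _ a <;> dsimp only at this <;> omega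
  · intro a b v hab hv hs
    obtain ⟨e, he, hab, seg⟩ := exists_edge_of_adj hab
    obtain ⟨v, hvn, rfl⟩ := mem_map.1 hv
    rw [← Sym2.mem_iff, hab, Sym2.mem_iff]
    by_contra! hne
    exact gen e he v (mem_range.1 hvn) (fun h => hne.1 (h ▸ rfl)) (fun h => hne.2 (h ▸ rfl))
      (area_of_mem_segment (seg ▸ hs))
  · intro a b c d p hab hcd hne hp hp'
    obtain ⟨e, he, hab, seg⟩ := exists_edge_of_adj hab
    obtain ⟨e', he', hcd, seg'⟩ := exists_edge_of_adj hcd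
    rw [seg] at hp
    rw [seg'] at hp'
    have l := hlt e he
    have l' := hlt e' he'
    have hee : e ≠ e' := fun h => hne (by rw [hab, hcd, h])
    have mem : ∀ i < n, f i ∈ (range n).map f := fun i hi => mem_map_of_mem f (mem_range.2 hi)
    have ar : ∀ i j k, area i j k ≠ 0 → area j i k ≠ 0 := fun i j k h => by
      rw [area_swap]; exact neg_ne_zero.2 h
    by_cases c1 : e.1 = e'.1
    · have : e'.2 ≠ e.2 := fun h => hee (Prod.ext c1 h.symm)
      rw [← c1] at hp'
      exact eq_of_mem_segments (gen e he _ l'.2.1 (by omega) this) hp hp' ▸ mem _ (by omega)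
    by_cases c2 : e.1 = e'.2
    · rw [← c2, segment_symm] at hp'
      exact eq_of_mem_segments (gen e he e'.1 (by omega) (by omega) (by omega)) hp hp' ▸
        mem _ (by omega)
    by_cases c3 : e.2 = e'.1
    · rw [segment_symm] at hp
      rw [← c3] at hp'
      exact eq_of_mem_segments (ar _ _ _ (gen e he e'.2 (by omega) (by omega) (by omega))) hp hp' ▸
        mem _ (by omega)
    by_cases c4 : e.2 = e'.2
    · rw [segment_symm] at hp
      rw [← c4, segment_symm] at hp'
      exact eq_of_mem_segments (ar _ _ _ (gen e he e'.1 (by omega) (by omega) (by omega))) hp hp' ▸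
        mem _ (by omega)
    exfalso
    rw [f₁ e he, f₂ e he] at hp
    rw [f₁ e' he', f₂ e' he'] at hp'
    rcases allPairs_spec h2 e he e' he' hee with h | h
    · simp only [Bool.or_eq_true, Nat.beq_eq, c1, c2, c3, c4, false_or] at h
      rcases h with h | h
      · exact sameSide_disjoint h hp hp'
      · exact sameSide_disjoint h hp' hp
    · simp only [Bool.or_eq_true, Nat.beq_eq, Ne.symm c1, Ne.symm c2, Ne.symm c3, Ne.symm c4,
        false_or] at h
      rcases h with h | h
      · exact sameSide_disjoint h hp' hp
      · exact sameSide_disjoint h hp hp'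

theorem of_checkFrame (h : checkFrame x y n r = true) (hn : 3 < n)
    (hf : ∀ i < n, f i = natPoint x y i) :
    (0 : ℝ) < r ∧ f 0 = (0, 0) ∧ f 1 = ((r : ℝ), 0) ∧ f 2 = (0, (r : ℝ)) ∧
      (((range n).map f : Finset (ℝ × ℝ)) : Set (ℝ × ℝ)) ⊆
        convexHull ℝ {(0, 0), ((r : ℝ), 0), (0, (r : ℝ))} := by
  simp only [checkFrame, Bool.and_eq_true, Nat.blt_eq, Nat.beq_eq, List.all_eq_true,
    List.mem_range, Nat.ble_eq] at h
  obtain ⟨⟨⟨⟨⟨⟨⟨⟨hr, hx0⟩, hy0⟩, hx1⟩, hy1⟩, hx2⟩, hy2⟩, hle⟩, -⟩ := h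
  have hr' : (0 : ℝ) < r := by exact_mod_cast hr
  refine ⟨hr', ?_, ?_, ?_, fun p hp => ?_⟩
  · rw [hf 0 (by omega), natPoint, hx0, hy0]; simp
  · rw [hf 1 (by omega), natPoint, hx1, hy1]; simp
  · rw [hf 2 (by omega), natPoint, hx2, hy2]; simp
  · obtain ⟨i, hi, rfl⟩ := mem_map.1 hp
    rw [mem_range] at hi
    rw [hf i hi]
    exact mem_triangle (Nat.cast_nonneg _) (Nat.cast_nonneg _) hr' (by exact_mod_cast hle i hi)

theorem hasDrawnFragment_of_check {del start : List (List ℕ)}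
    (h : checkFragment n E del start = true)
    (hd : (checkPlane x y n E && checkFrame x y n r) = true) : HasDrawnFragment n := by
  rw [Bool.and_eq_true] at hd
  have hE := (of_checkFragment h).1
  obtain ⟨f, hf⟩ := exists_embedding hd.2
  obtain ⟨hr, f0, f1, f2, hull⟩ := of_checkFrame hd.2 (of_checkEdges hE).1 hf
  refine ⟨r, _, _, hr, (card_map f).trans (card_range n), ?_,
    isStraightPlane_of_check hE hd.1 hf, hull⟩
  simpa [f0, f1, f2] using (isFragment_of_check h).map f

theorem IsStraightPlane.isolate {G : SimpleGraph (ℝ × ℝ)} {P : Finset (ℝ × ℝ)}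
    (h : IsStraightPlane G P) {v : ℝ × ℝ} (hv : v ∈ P) : IsStraightPlane (G.isolate v) (P.erase v)
    where
  mem _ _ e := mem_erase.2 ⟨e.2.1, h.mem e.1⟩
  eq_or_eq _ _ _ e hw hs := h.eq_or_eq e.1 (mem_of_mem_erase hw) hs
  cross _ _ _ _ p e e' hne hp hp' := by
    refine mem_erase.2 ⟨?_, h.cross e.1 e'.1 hne hp hp'⟩
    rintro rfl
    exact (h.eq_or_eq e.1 hv hp).elim (fun i => e.2.1 i.symm) fun i => e.2.2 i.symm

theorem mem_of_isRightOf {u w a b p q k : ℕ} {z : ℝ × ℝ}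
    (hu : u = p ∨ u = q ∨ u = k) (hw : w = p ∨ w = q ∨ w = k)
    (h : isRightOf x y u w a b = true)
    (hz : z ∈ segment ℝ (natPoint x y a) (natPoint x y b))
    (h0 : 0 ≤ area (natPoint x y u) (natPoint x y w) z) :
    ∃ i, (i = p ∨ i = q ∨ i = k) ∧ z = natPoint x y i := by
  simp only [isRightOf, Bool.and_eq_true, Bool.or_eq_true, Nat.beq_eq, isLeft_iff] at h
  obtain ⟨hb, ha⟩ := h
  rw [area_swap, neg_pos] at hb
  rcases ha with (ha | rfl) | rfl
  · rw [area_swap, neg_pos] at ha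
    exact absurd (eq_of_mem_segment_of_right ha.le hb hz h0).2 ha.ne
  · exact ⟨a, hu, (eq_of_mem_segment_of_right area_left.le hb hz h0).1⟩
  · exact ⟨a, hw, (eq_of_mem_segment_of_right area_right.le hb hz h0).1⟩

/-- A vertex in the free triangle or a point of the free triangle on an edge is a corner. -/
theorem mem_of_checkFree {p q k : ℕ} (hE : ∀ e ∈ E, e.1 < e.2) (hf : ∀ i < n, f i = natPoint x y i)
    (hp : p < n) (hq : q < n) (hk : k < n) (h : checkFree x y n E p q k = true) {z : ℝ × ℝ}
    (hz : z ∈ convexHull ℝ {f p, f q, f k})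
    (hz' : (∃ i < n, z = f i) ∨ ∃ e ∈ E, e.2 < n ∧ z ∈ segment ℝ (f e.1) (f e.2)) :
    z ∈ ({f p, f q, f k} : Finset (ℝ × ℝ)) := by
  simp only [checkFree, Bool.and_eq_true, List.all_eq_true, List.mem_range, Bool.or_eq_true,
    Nat.beq_eq, Nat.ble_eq] at h
  obtain ⟨⟨h0, h1⟩, h2⟩ := h
  suffices ∃ i, (i = p ∨ i = q ∨ i = k) ∧ z = natPoint x y i by
    obtain ⟨i, hi, rfl⟩ := this
    rcases hi with rfl | rfl | rfl
    · rw [← hf i hp]; simp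
    · rw [← hf i hq]; simp
    · rw [← hf i hk]; simp
  rw [hf p hp, hf q hq, hf k hk] at hz
  rw [isLeft_iff] at h0
  have e₁ : area (natPoint x y q) (natPoint x y k) (natPoint x y p) =
    area (natPoint x y p) (natPoint x y q) (natPoint x y k) := by unfold area; ring
  have e₂ : area (natPoint x y k) (natPoint x y p) (natPoint x y q) =
    area (natPoint x y p) (natPoint x y q) (natPoint x y k) := by unfold area; ring
  have z₁ : 0 ≤ area (natPoint x y p) (natPoint x y q) z :=
    area_nonneg_of_mem_triangle area_left.ge area_right.ge h0.le hz
  have z₂ : 0 ≤ area (natPoint x y q) (natPoint x y k) z :=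
    area_nonneg_of_mem_triangle (e₁ ▸ h0.le) area_left.ge area_right.ge hz
  have z₃ : 0 ≤ area (natPoint x y k) (natPoint x y p) z :=
    area_nonneg_of_mem_triangle area_right.ge (e₂ ▸ h0.le) area_left.ge hz
  rcases hz' with ⟨i, hi, rfl⟩ | ⟨e, he, hen, hs⟩
  · have := h1 i hi
    simp only [isLeft_iff] at this
    rw [hf i hi] at z₁ z₂ z₃ ⊢
    rcases this with ((((h | h) | h) | h) | h) | h
    · exact ⟨i, .inl h, rfl⟩
    · exact ⟨i, .inr (.inl h), rfl⟩
    · exact ⟨i, .inr (.inr h), rfl⟩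
    all_goals
      rw [area_swap, neg_pos] at h
      linarith
  · rw [hf e.1 ((hE e he).trans hen), hf e.2 hen] at hs
    have hs' := hs
    rw [segment_symm] at hs'
    have key : ∀ {a b : ℕ}, z ∈ segment ℝ (natPoint x y a) (natPoint x y b) →
        (isLeft x y a b p = true ∧ isLeft x y a b q = true) ∧ isLeft x y a b k = true → False :=
      fun hs h => by
        simp only [isLeft_iff] at h
        exact (area_pos_of_mem_triangle h.1.1 h.1.2 h.2 hz).ne' (area_of_mem_segment hs)
    rcases h2 e he with (((((((h | h) | h) | h) | h) | h) | h) | h) | h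
    · omega
    · exact mem_of_isRightOf (.inl rfl) (.inr (.inl rfl)) h hs z₁
    · exact mem_of_isRightOf (.inl rfl) (.inr (.inl rfl)) h hs' z₁
    · exact mem_of_isRightOf (.inr (.inl rfl)) (.inr (.inr rfl)) h hs z₂
    · exact mem_of_isRightOf (.inr (.inl rfl)) (.inr (.inr rfl)) h hs' z₂
    · exact mem_of_isRightOf (.inr (.inr rfl)) (.inl rfl) h hs z₃
    · exact mem_of_isRightOf (.inr (.inr rfl)) (.inl rfl) h hs' z₃
    · exact (key hs h).elim
    · exact (key hs' h).elim

theorem isDrawnHost_of_check {del start : List (List ℕ)} {p q k : ℕ}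
    (h : checkFragment (n + 1) E del start = true)
    (hd : (checkPlane x y (n + 1) E && checkFrame x y (n + 1) r) = true)
    (hN : (checkFree x y n E p q k && checkNbrs n E p q k) = true) :
    (0 : ℝ) < r ∧ ∃ G P y₀ p₀ q₀ k₀, #P = n + 1 ∧
      IsDrawnHost G P (0, 0) ((r : ℝ), 0) (0, (r : ℝ)) y₀ p₀ q₀ k₀ := by
  rw [Bool.and_eq_true] at hd hN
  have hE := (of_checkFragment h).1
  obtain ⟨n1, -, hlt⟩ := of_checkEdges hE
  obtain ⟨f, hf⟩ := exists_embedding hd.2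
  obtain ⟨hr, f0, f1, f2, hull⟩ := of_checkFrame hd.2 n1 hf
  have plane := isStraightPlane_of_check hE hd.1 hf
  have host := isHost_of_check h hN.2
  have hf' : ∀ i < n, f i = natPoint x y i := fun i hi => hf i (by omega)
  obtain ⟨hp, hq, hk⟩ : p < n ∧ q < n ∧ k < n := by
    have hne : ∀ i ∈ ({p, q, k} : Finset ℕ), i < n := fun i hi => by
      have := host.mem_erase_of_mem_nbr hi
      rw [mem_range] at this
      omega
    exact ⟨hne p (by simp), hne q (by simp), hne k (by simp)⟩
  refine ⟨hr, _, _, f n, f p, f q, f k, (card_map f).trans (card_range (n + 1)), ?_,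
    fun u v e => plane.mem e, plane.isolate (mem_map_of_mem f (by simp)), ?_, ?_, ?_⟩
  · simpa [f0, f1, f2] using host.map f
  · exact (coe_subset.2 (erase_subset _ _)).trans hull
  · intro z hz hz'
    refine mem_of_checkFree (fun e he => (hlt e he).1) hf' hp hq hk hN.1 hz' ?_
    have hlt_n : ∀ i < n + 1, f i ≠ f n → i < n := fun i hi hne =>
      lt_of_le_of_ne (by omega) fun e => hne (e ▸ rfl)
    rcases hz with hz | ⟨a, b, e, hz⟩
    · obtain ⟨hz1, hz2⟩ := mem_erase.1 (mem_coe.1 hz)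
      obtain ⟨i, hi, rfl⟩ := mem_map.1 hz2
      exact .inl ⟨i, hlt_n i (mem_range.1 hi) hz1, rfl⟩
    · obtain ⟨e', he', hab, seg⟩ := exists_edge_of_adj e.1
      refine .inr ⟨e', he', hlt_n _ (hlt e' he').2.1 fun h => ?_, seg ▸ hz⟩
      have : f n ∈ s(a, b) := by rw [hab, ← h]; simp
      rcases Sym2.mem_iff.1 this with h | h
      · exact e.2.1 h.symm
      · exact e.2.2 h.symm
  · have := hN.1
    simp only [checkFree, Bool.and_eq_true, isLeft_iff] at this
    rw [hf' p hp, hf' q hq, hf' k hk]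
    exact this.1.1.ne'

end drawing

/-- The numbers of a list, as digits in base `2 ^ 16`. -/
def pack (l : List ℕ) : ℕ := l.foldr (fun a N => a + 65536 * N) 0

/-- The digit with index `i` in base `2 ^ 16`. -/
def digit (N i : ℕ) : ℕ := Nat.land (Nat.shiftRight N (Nat.mul 16 i)) 65535

/-- `f`, applied to the coordinate functions of a list of points. -/
def withCoords (pts : List (ℕ × ℕ)) (f : (ℕ → ℕ) → (ℕ → ℕ) → Bool) : Bool :=
  withNumeral (fun X => withNumeral (fun Y => f (digit X) (digit Y)) (pack (pts.map Prod.snd)))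
    (pack (pts.map Prod.fst))

/-- A certificate that the points, joined according to `E`, form a plane drawing in the triangle with
corners `(0, 0)`, `(r, 0)`, `(0, r)`. -/
def checkDrawing (n r : ℕ) (E : List (ℕ × ℕ)) (pts : List (ℕ × ℕ)) : Bool :=
  withCoords pts fun x y => checkPlane x y n E && checkFrame x y n r

/-- A certificate that the vertex `n`, with neighbors `p`, `q`, `r`, can be replaced by a drawing in
the triangle of its neighbors. -/
def checkHost (n : ℕ) (E : List (ℕ × ℕ)) (pts : List (ℕ × ℕ)) (p q r : ℕ) : Bool :=
  withCoords pts fun x y => checkFree x y n E p q r && checkNbrs n E p q r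

theorem withCoords_eq (pts : List (ℕ × ℕ)) (f : (ℕ → ℕ) → (ℕ → ℕ) → Bool) :
    withCoords pts f =
      f (digit (pack (pts.map Prod.fst))) (digit (pack (pts.map Prod.snd))) := by
  rw [withCoords, withNumeral_eq, withNumeral_eq]

theorem hasDrawnFragment_of_checkDrawing {n r : ℕ} {E pts : List (ℕ × ℕ)} {del start : List (List ℕ)}
    (h : checkFragment n E del start = true) (hd : checkDrawing n r E pts = true) :
    HasDrawnFragment n := by
  rw [checkDrawing, withCoords_eq] at hd
  exact hasDrawnFragment_of_check h hd

/-- The fragment of the certificate serves as a host for any other fragment. -/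
theorem hasDrawnFragment_of_checkHost {n r : ℕ} {E pts : List (ℕ × ℕ)} {del start : List (List ℕ)}
    {p q k : ℕ} (h : checkFragment (n + 1) E del start = true)
    (hd : checkDrawing (n + 1) r E pts = true) (hN : checkHost n E pts p q k = true) {m : ℕ}
    (hm : HasDrawnFragment m) : HasDrawnFragment (n + m - 3) := by
  rw [checkDrawing, withCoords_eq] at hd
  rw [checkHost, withCoords_eq] at hN
  obtain ⟨hr, G, P, y₀, p₀, q₀, k₀, hP, host⟩ := isDrawnHost_of_check h hd hN
  have := host.hasDrawnFragment hr hm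
  rw [hP] at this
  exact (show n + 1 + m - 4 = n + m - 3 by omega) ▸ this

/-! ### Five planar fragments -/

/-- The edges of a fragment on 33 vertices with terminals `0`, `1`, `2`. -/
def edges₃₃ : List (ℕ × ℕ) :=
  [(0, 7), (0, 25), (0, 28), (1, 9), (1, 10), (2, 11), (2, 19), (3, 5), (3, 11), (3, 19), (4, 15),
  (4, 24), (4, 32), (5, 10), (5, 14), (5, 22), (6, 18), (6, 20), (6, 21), (7, 9), (7, 16),
  (8, 17), (8, 22), (8, 26), (9, 15), (9, 29), (10, 19), (10, 26), (11, 14), (11, 28), (12, 13),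
  (12, 21), (12, 22), (13, 18), (13, 28), (14, 31), (15, 30), (16, 23), (16, 30), (17, 21),
  (17, 24), (18, 25), (20, 23), (20, 27), (21, 32), (22, 31), (23, 25), (24, 29), (26, 29),
  (27, 30), (27, 32), (28, 31)]

/-- The positions of the 33 vertices. -/
def points₃₃ : List (ℕ × ℕ) :=
  [(0, 0), (160, 0), (0, 160), (29, 108), (75, 25), (45, 79), (51, 28), (39, 9), (69, 53),
  (132, 9), (64, 72), (14, 123), (47, 51), (33, 40), (38, 80), (111, 14), (49, 14), (73, 46),
  (33, 32), (36, 108), (48, 22), (63, 32), (46, 61), (43, 19), (89, 33), (25, 17), (73, 57),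
  (66, 23), (17, 46), (111, 24), (61, 18), (39, 67), (68, 27)]

/-- Paths between terminals that avoid `0`, …, `32`, respectively. -/
def delPaths₃₃ : List (List ℕ) :=
  [[1, 10, 26, 8, 17, 24, 29, 9, 7, 16, 23, 25, 18, 6, 20, 27, 30, 15, 4, 32, 21, 12, 13, 28, 31,
    22, 5, 14, 11, 3, 19, 2],
  [0, 25, 23, 16, 7, 9, 15, 30, 27, 20, 6, 18, 13, 12, 22, 8, 17, 21, 32, 4, 24, 29, 26, 10, 19,
    3, 5, 14, 31, 28, 11, 2],
  [0, 25, 18, 6, 20, 23, 16, 7, 9, 15, 30, 27, 32, 4, 24, 29, 26, 8, 17, 21, 12, 13, 28, 31, 22,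
    5, 14, 11, 3, 19, 10, 1],
  [0, 25, 18, 6, 20, 23, 16, 7, 9, 15, 30, 27, 32, 4, 24, 29, 26, 8, 17, 21, 12, 13, 28, 31, 22,
    5, 14, 11, 2, 19, 10, 1],
  [0, 25, 18, 6, 20, 23, 16, 7, 9, 15, 30, 27, 32, 21, 12, 13, 28, 31, 14, 11, 2, 19, 3, 5, 22,
    8, 17, 24, 29, 26, 10, 1],
  [0, 25, 23, 16, 7, 9, 1, 10, 26, 29, 24, 17, 8, 22, 12, 21, 32, 4, 15, 30, 27, 20, 6, 18, 13,
    28, 31, 14, 11, 3, 19, 2],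
  [0, 25, 18, 13, 28, 31, 14, 11, 2, 19, 3, 5, 10, 26, 29, 24, 17, 8, 22, 12, 21, 32, 4, 15, 30,
    27, 20, 23, 16, 7, 9, 1],
  [0, 25, 23, 16, 30, 15, 4, 32, 27, 20, 6, 18, 13, 28, 31, 14, 11, 2, 19, 3, 5, 10, 26, 8, 22,
    12, 21, 17, 24, 29, 9, 1],
  [0, 28, 13, 12, 22, 31, 14, 5, 3, 11, 2, 19, 10, 26, 29, 24, 17, 21, 32, 4, 15, 30, 27, 20, 6,
    18, 25, 23, 16, 7, 9, 1],
  [0, 7, 16, 23, 25, 18, 6, 20, 27, 30, 15, 4, 32, 21, 12, 13, 28, 31, 14, 11, 2, 19, 3, 5, 22,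
    8, 17, 24, 29, 26, 10, 1],
  [1, 9, 7, 0, 25, 23, 16, 30, 15, 4, 32, 27, 20, 6, 18, 13, 12, 21, 17, 24, 29, 26, 8, 22, 31,
    28, 11, 14, 5, 3, 19, 2],
  [0, 28, 13, 12, 21, 32, 4, 15, 30, 27, 20, 6, 18, 25, 23, 16, 7, 9, 1, 10, 26, 29, 24, 17, 8,
    22, 31, 14, 5, 3, 19, 2],
  [0, 25, 23, 16, 7, 9, 15, 30, 27, 20, 6, 18, 13, 28, 31, 14, 11, 2, 19, 3, 5, 22, 8, 17, 21,
    32, 4, 24, 29, 26, 10, 1],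
  [0, 28, 31, 14, 11, 2, 19, 3, 5, 10, 26, 29, 24, 17, 8, 22, 12, 21, 32, 4, 15, 30, 27, 20, 6,
    18, 25, 23, 16, 7, 9, 1],
  [0, 25, 18, 6, 20, 23, 16, 7, 9, 15, 30, 27, 32, 4, 24, 29, 26, 8, 17, 21, 12, 13, 28, 31, 22,
    5, 3, 11, 2, 19, 10, 1],
  [0, 7, 16, 30, 27, 20, 23, 25, 18, 6, 21, 32, 4, 24, 17, 8, 22, 12, 13, 28, 31, 14, 5, 3, 11,
    2, 19, 10, 26, 29, 9, 1],
  [1, 10, 19, 3, 5, 14, 31, 22, 12, 13, 18, 25, 23, 20, 6, 21, 32, 27, 30, 15, 4, 24, 17, 8, 26,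
    29, 9, 7, 0, 28, 11, 2],
  [0, 25, 18, 6, 20, 23, 16, 7, 9, 29, 24, 4, 15, 30, 27, 32, 21, 12, 13, 28, 31, 14, 11, 2, 19,
    3, 5, 22, 8, 26, 10, 1],
  [1, 10, 26, 8, 17, 24, 29, 9, 7, 0, 25, 23, 16, 30, 15, 4, 32, 27, 20, 6, 21, 12, 13, 28, 31,
    22, 5, 14, 11, 3, 19, 2],
  [0, 25, 23, 16, 7, 9, 1, 10, 26, 29, 24, 17, 8, 22, 12, 21, 32, 4, 15, 30, 27, 20, 6, 18, 13,
    28, 31, 14, 5, 3, 11, 2],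
  [0, 7, 16, 23, 25, 18, 6, 21, 32, 27, 30, 15, 4, 24, 17, 8, 22, 12, 13, 28, 31, 14, 5, 3, 11,
    2, 19, 10, 26, 29, 9, 1],
  [1, 10, 26, 8, 17, 24, 29, 9, 7, 0, 25, 23, 16, 30, 15, 4, 32, 27, 20, 6, 18, 13, 12, 22, 31,
    28, 11, 14, 5, 3, 19, 2],
  [0, 25, 18, 6, 20, 23, 16, 7, 9, 15, 30, 27, 32, 4, 24, 29, 26, 8, 17, 21, 12, 13, 28, 31, 14,
    5, 3, 11, 2, 19, 10, 1],
  [0, 25, 18, 13, 28, 31, 14, 11, 2, 19, 3, 5, 10, 26, 29, 24, 17, 8, 22, 12, 21, 6, 20, 27, 32,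
    4, 15, 30, 16, 7, 9, 1],
  [0, 7, 16, 23, 25, 18, 6, 20, 27, 30, 15, 4, 32, 21, 17, 8, 22, 12, 13, 28, 31, 14, 5, 3, 11,
    2, 19, 10, 26, 29, 9, 1],
  [0, 28, 31, 14, 11, 2, 19, 3, 5, 10, 26, 29, 24, 4, 15, 30, 27, 32, 21, 17, 8, 22, 12, 13, 18,
    6, 20, 23, 16, 7, 9, 1],
  [0, 25, 23, 16, 7, 9, 29, 24, 17, 8, 22, 12, 21, 32, 4, 15, 30, 27, 20, 6, 18, 13, 28, 31, 14,
    5, 3, 11, 2, 19, 10, 1],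
  [0, 25, 23, 20, 6, 18, 13, 28, 31, 14, 11, 2, 19, 3, 5, 10, 26, 29, 24, 17, 8, 22, 12, 21, 32,
    4, 15, 30, 16, 7, 9, 1],
  [1, 9, 7, 0, 25, 23, 16, 30, 15, 4, 32, 27, 20, 6, 18, 13, 12, 21, 17, 24, 29, 26, 8, 22, 31,
    14, 5, 10, 19, 3, 11, 2],
  [0, 25, 23, 16, 7, 9, 15, 30, 27, 20, 6, 18, 13, 28, 31, 14, 11, 2, 19, 3, 5, 22, 12, 21, 32,
    4, 24, 17, 8, 26, 10, 1],
  [0, 7, 16, 23, 25, 18, 13, 28, 31, 14, 11, 2, 19, 3, 5, 10, 26, 29, 24, 17, 8, 22, 12, 21, 6,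
    20, 27, 32, 4, 15, 9, 1],
  [0, 28, 13, 12, 22, 8, 26, 29, 24, 17, 21, 32, 4, 15, 30, 27, 20, 6, 18, 25, 23, 16, 7, 9, 1,
    10, 19, 3, 5, 14, 11, 2],
  [0, 25, 23, 16, 7, 9, 29, 24, 4, 15, 30, 27, 20, 6, 18, 13, 28, 31, 14, 11, 2, 19, 3, 5, 22,
    12, 21, 17, 8, 26, 10, 1]]

/-- Hamiltonian paths from the terminals that do not end in the last vertex. -/
def startPaths₃₃ : List (List ℕ) :=
  [[0, 25, 23, 16, 7, 9, 1, 10, 19, 2, 11, 3, 5, 14, 31, 28, 13, 18, 6, 20, 27, 30, 15, 4, 32, 21,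
    12, 22, 8, 26, 29, 24, 17],
  [1, 10, 19, 2, 11, 3, 5, 14, 31, 28, 13, 18, 6, 20, 27, 32, 21, 12, 22, 8, 26, 29, 9, 7, 0, 25,
    23, 16, 30, 15, 4, 24, 17],
  [2, 19, 3, 11, 14, 5, 10, 1, 9, 7, 0, 28, 31, 22, 12, 13, 18, 25, 23, 16, 30, 15, 4, 32, 27,
    20, 6, 21, 17, 24, 29, 26, 8]]

theorem checkFragment₃₃ : checkFragment 33 edges₃₃ delPaths₃₃ startPaths₃₃ = true := by
  decide +kernel

theorem checkDrawing₃₃ : checkDrawing 33 160 edges₃₃ points₃₃ = true := by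
  decide +kernel

theorem checkHost₃₃ : checkHost 32 edges₃₃ points₃₃ 4 21 27 = true := by
  decide +kernel

/-- The edges of a fragment on 35 vertices with terminals `0`, `1`, `2`. -/
def edges₃₅ : List (ℕ × ℕ) :=
  [(0, 10), (0, 29), (1, 18), (1, 26), (2, 3), (2, 23), (3, 12), (3, 20), (3, 29), (4, 5),
  (4, 13), (4, 29), (5, 8), (5, 10), (6, 17), (6, 18), (6, 28), (7, 11), (7, 20), (7, 31),
  (8, 14), (8, 15), (8, 22), (9, 27), (9, 30), (9, 31), (10, 18), (11, 19), (11, 30), (12, 13),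
  (12, 24), (13, 22), (14, 30), (14, 32), (15, 18), (15, 34), (16, 17), (16, 25), (16, 27),
  (17, 26), (19, 21), (19, 32), (20, 21), (20, 23), (21, 24), (22, 33), (23, 25), (23, 26),
  (24, 33), (25, 31), (27, 28), (28, 34), (30, 34), (32, 33)]

/-- The positions of the 35 vertices. -/
def points₃₅ : List (ℕ × ℕ) :=
  [(0, 0), (160, 0), (0, 160), (10, 126), (15, 34), (34, 28), (87, 29), (58, 63), (41, 41),
  (63, 54), (35, 14), (55, 61), (20, 103), (23, 77), (43, 51), (73, 27), (77, 51), (105, 33),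
  (81, 17), (41, 71), (45, 85), (40, 82), (31, 72), (65, 73), (28, 88), (66, 65), (116, 31),
  (75, 49), (80, 34), (7, 28), (61, 48), (62, 60), (38, 67), (32, 76), (70, 35)]

/-- Paths between terminals that avoid `0`, …, `34`, respectively. -/
def delPaths₃₅ : List (List ℕ) :=
  [[1, 26, 17, 16, 27, 28, 6, 18, 10, 5, 4, 29, 3, 12, 13, 22, 33, 24, 21, 20, 7, 11, 19, 32, 14,
    8, 15, 34, 30, 9, 31, 25, 23, 2],
  [0, 29, 4, 13, 12, 24, 21, 19, 11, 7, 31, 25, 16, 27, 9, 30, 14, 32, 33, 22, 8, 5, 10, 18, 15,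
    34, 28, 6, 17, 26, 23, 20, 3, 2],
  [0, 29, 3, 12, 13, 4, 5, 10, 18, 6, 28, 27, 9, 31, 7, 11, 19, 32, 14, 30, 34, 15, 8, 22, 33,
    24, 21, 20, 23, 25, 16, 17, 26, 1],
  [0, 29, 4, 5, 10, 18, 1, 26, 17, 6, 28, 27, 16, 25, 31, 9, 30, 34, 15, 8, 14, 32, 33, 22, 13,
    12, 24, 21, 19, 11, 7, 20, 23, 2],
  [0, 29, 3, 2, 23, 25, 16, 27, 9, 31, 7, 20, 21, 24, 12, 13, 22, 33, 32, 19, 11, 30, 14, 8, 5,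
    10, 18, 15, 34, 28, 6, 17, 26, 1],
  [0, 10, 18, 1, 26, 17, 6, 28, 27, 16, 25, 31, 9, 30, 34, 15, 8, 14, 32, 33, 22, 13, 4, 29, 3,
    12, 24, 21, 19, 11, 7, 20, 23, 2],
  [0, 29, 4, 13, 12, 3, 2, 23, 25, 31, 9, 30, 14, 32, 19, 11, 7, 20, 21, 24, 33, 22, 8, 5, 10,
    18, 15, 34, 28, 27, 16, 17, 26, 1],
  [0, 29, 4, 5, 10, 18, 6, 28, 34, 15, 8, 22, 13, 12, 24, 33, 32, 14, 30, 11, 19, 21, 20, 3, 2,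
    23, 25, 31, 9, 27, 16, 17, 26, 1],
  [0, 10, 5, 4, 29, 3, 2, 23, 20, 7, 11, 19, 21, 24, 12, 13, 22, 33, 32, 14, 30, 9, 31, 25, 16,
    27, 28, 34, 15, 18, 6, 17, 26, 1],
  [0, 29, 4, 13, 12, 3, 2, 23, 20, 21, 24, 33, 22, 8, 5, 10, 18, 15, 34, 30, 14, 32, 19, 11, 7,
    31, 25, 16, 27, 28, 6, 17, 26, 1],
  [0, 29, 4, 5, 8, 22, 13, 12, 3, 2, 23, 20, 7, 11, 19, 21, 24, 33, 32, 14, 30, 9, 31, 25, 16,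
    27, 28, 34, 15, 18, 6, 17, 26, 1],
  [0, 29, 4, 13, 12, 3, 2, 23, 20, 7, 31, 25, 16, 27, 9, 30, 14, 32, 19, 21, 24, 33, 22, 8, 5,
    10, 18, 15, 34, 28, 6, 17, 26, 1],
  [0, 29, 3, 2, 23, 25, 16, 27, 28, 34, 15, 8, 14, 32, 19, 11, 30, 9, 31, 7, 20, 21, 24, 33, 22,
    13, 4, 5, 10, 18, 6, 17, 26, 1],
  [0, 29, 4, 5, 10, 18, 1, 26, 17, 6, 28, 34, 15, 8, 22, 33, 24, 12, 3, 20, 21, 19, 32, 14, 30,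
    11, 7, 31, 9, 27, 16, 25, 23, 2],
  [0, 29, 4, 13, 22, 33, 32, 19, 11, 7, 20, 21, 24, 12, 3, 2, 23, 25, 31, 9, 30, 34, 15, 8, 5,
    10, 18, 6, 28, 27, 16, 17, 26, 1],
  [0, 29, 4, 13, 12, 3, 20, 21, 24, 33, 22, 8, 5, 10, 18, 1, 26, 17, 6, 28, 34, 30, 14, 32, 19,
    11, 7, 31, 9, 27, 16, 25, 23, 2],
  [0, 29, 4, 13, 22, 33, 32, 14, 30, 34, 15, 8, 5, 10, 18, 1, 26, 17, 6, 28, 27, 9, 31, 25, 23,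
    20, 7, 11, 19, 21, 24, 12, 3, 2],
  [0, 29, 4, 5, 10, 18, 6, 28, 27, 16, 25, 31, 9, 30, 34, 15, 8, 14, 32, 33, 22, 13, 12, 24, 21,
    19, 11, 7, 20, 3, 2, 23, 26, 1],
  [0, 10, 5, 4, 29, 3, 2, 23, 25, 16, 27, 9, 31, 7, 20, 21, 24, 12, 13, 22, 33, 32, 19, 11, 30,
    14, 8, 15, 34, 28, 6, 17, 26, 1],
  [0, 29, 4, 13, 12, 24, 21, 20, 3, 2, 23, 25, 16, 27, 9, 31, 7, 11, 30, 14, 32, 33, 22, 8, 5,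
    10, 18, 15, 34, 28, 6, 17, 26, 1],
  [0, 29, 3, 2, 23, 25, 16, 27, 28, 34, 15, 8, 22, 33, 32, 14, 30, 9, 31, 7, 11, 19, 21, 24, 12,
    13, 4, 5, 10, 18, 6, 17, 26, 1],
  [0, 29, 4, 13, 22, 33, 24, 12, 3, 2, 23, 20, 7, 11, 19, 32, 14, 8, 5, 10, 18, 15, 34, 30, 9,
    31, 25, 16, 27, 28, 6, 17, 26, 1],
  [0, 29, 4, 13, 12, 3, 2, 23, 25, 16, 27, 9, 31, 7, 20, 21, 24, 33, 32, 19, 11, 30, 14, 8, 5,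
    10, 18, 15, 34, 28, 6, 17, 26, 1],
  [0, 29, 4, 5, 10, 18, 1, 26, 17, 6, 28, 27, 16, 25, 31, 9, 30, 34, 15, 8, 14, 32, 33, 22, 13,
    12, 24, 21, 19, 11, 7, 20, 3, 2],
  [0, 29, 4, 13, 12, 3, 2, 23, 25, 16, 27, 9, 31, 7, 20, 21, 19, 11, 30, 14, 32, 33, 22, 8, 5,
    10, 18, 15, 34, 28, 6, 17, 26, 1],
  [0, 29, 4, 13, 12, 24, 21, 19, 11, 30, 14, 32, 33, 22, 8, 5, 10, 18, 15, 34, 28, 6, 17, 16, 27,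
    9, 31, 7, 20, 3, 2, 23, 26, 1],
  [1, 18, 6, 17, 16, 27, 28, 34, 15, 8, 5, 10, 0, 29, 4, 13, 22, 33, 32, 14, 30, 9, 31, 25, 23,
    20, 7, 11, 19, 21, 24, 12, 3, 2],
  [0, 29, 4, 5, 10, 18, 6, 28, 34, 15, 8, 22, 13, 12, 3, 2, 23, 20, 7, 11, 19, 21, 24, 33, 32,
    14, 30, 9, 31, 25, 16, 17, 26, 1],
  [1, 26, 17, 6, 18, 10, 0, 29, 4, 5, 8, 15, 34, 30, 14, 32, 33, 22, 13, 12, 24, 21, 19, 11, 7,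
    31, 9, 27, 16, 25, 23, 20, 3, 2],
  [0, 10, 5, 4, 13, 12, 3, 20, 7, 11, 30, 14, 32, 19, 21, 24, 33, 22, 8, 15, 34, 28, 27, 9, 31,
    25, 16, 17, 6, 18, 1, 26, 23, 2],
  [0, 29, 4, 5, 10, 18, 6, 28, 34, 15, 8, 14, 32, 33, 22, 13, 12, 24, 21, 19, 11, 7, 20, 3, 2,
    23, 25, 31, 9, 27, 16, 17, 26, 1],
  [0, 29, 4, 13, 12, 3, 2, 23, 25, 16, 27, 9, 30, 14, 32, 19, 11, 7, 20, 21, 24, 33, 22, 8, 5,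
    10, 18, 15, 34, 28, 6, 17, 26, 1],
  [0, 29, 4, 13, 22, 33, 24, 12, 3, 2, 23, 25, 16, 27, 9, 31, 7, 20, 21, 19, 11, 30, 14, 8, 5,
    10, 18, 15, 34, 28, 6, 17, 26, 1],
  [0, 29, 4, 5, 10, 18, 6, 28, 27, 9, 31, 7, 11, 19, 32, 14, 30, 34, 15, 8, 22, 13, 12, 24, 21,
    20, 3, 2, 23, 25, 16, 17, 26, 1],
  [0, 29, 4, 5, 10, 18, 15, 8, 22, 13, 12, 3, 2, 23, 20, 7, 11, 19, 21, 24, 33, 32, 14, 30, 9,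
    31, 25, 16, 27, 28, 6, 17, 26, 1]]

/-- Hamiltonian paths from the terminals that do not end in the last vertex. -/
def startPaths₃₅ : List (List ℕ) :=
  [[0, 29, 4, 5, 10, 18, 1, 26, 17, 6, 28, 27, 16, 25, 23, 2, 3, 20, 7, 31, 9, 30, 34, 15, 8, 14,
    32, 33, 22, 13, 12, 24, 21, 19, 11],
  [1, 26, 17, 16, 27, 28, 6, 18, 10, 0, 29, 4, 5, 8, 15, 34, 30, 9, 31, 25, 23, 2, 3, 20, 7, 11,
    19, 21, 24, 12, 13, 22, 33, 32, 14],
  [2, 23, 25, 16, 27, 28, 6, 17, 26, 1, 18, 15, 34, 30, 9, 31, 7, 11, 19, 32, 14, 8, 5, 10, 0,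
    29, 4, 13, 22, 33, 24, 21, 20, 3, 12]]

theorem checkFragment₃₅ : checkFragment 35 edges₃₅ delPaths₃₅ startPaths₃₅ = true := by
  decide +kernel

theorem checkDrawing₃₅ : checkDrawing 35 160 edges₃₅ points₃₅ = true := by
  decide +kernel

/-- The edges of a fragment on 36 vertices with terminals `0`, `1`, `2`. -/
def edges₃₆ : List (ℕ × ℕ) :=
  [(0, 5), (0, 9), (1, 22), (1, 30), (2, 6), (2, 31), (3, 8), (3, 19), (3, 35), (4, 10), (4, 19),
  (4, 29), (5, 13), (5, 31), (6, 10), (6, 22), (6, 23), (6, 29), (7, 16), (7, 21), (7, 34),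
  (8, 10), (8, 12), (9, 28), (9, 30), (10, 18), (11, 24), (11, 26), (11, 35), (12, 14), (12, 21),
  (13, 26), (13, 28), (14, 16), (14, 35), (15, 19), (15, 23), (15, 29), (16, 24), (17, 18),
  (17, 22), (17, 34), (18, 21), (19, 26), (20, 27), (20, 28), (20, 33), (22, 25), (23, 31),
  (24, 32), (25, 32), (25, 33), (26, 27), (27, 32), (30, 33), (32, 34)]

/-- The positions of the 36 vertices. -/
def points₃₆ : List (ℕ × ℕ) :=
  [(0, 0), (300, 0), (0, 300), (102, 125), (94, 142), (38, 91), (85, 171), (121, 110), (105, 129),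
  (93, 31), (101, 141), (108, 108), (111, 120), (78, 86), (112, 116), (83, 152), (117, 110),
  (139, 104), (119, 121), (95, 131), (121, 71), (117, 117), (168, 89), (68, 170), (118, 104),
  (149, 82), (99, 104), (116, 90), (98, 63), (88, 155), (181, 31), (35, 187), (128, 95),
  (150, 61), (129, 103), (107, 116)]

/-- Paths between terminals that avoid `0`, …, `35`, respectively. -/
def delPaths₃₆ : List (List ℕ) :=
  [[1, 30, 9, 28, 20, 33, 25, 22, 17, 34, 32, 27, 26, 13, 5, 31, 23, 15, 19, 3, 8, 12, 14, 35, 11,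
    24, 16, 7, 21, 18, 10, 4, 29, 6, 2],
  [0, 5, 13, 28, 9, 30, 33, 20, 27, 26, 11, 35, 14, 16, 24, 32, 25, 22, 6, 29, 4, 10, 18, 17, 34,
    7, 21, 12, 8, 3, 19, 15, 23, 31, 2],
  [0, 5, 31, 23, 15, 29, 4, 19, 3, 8, 12, 14, 35, 11, 24, 16, 7, 21, 18, 10, 6, 22, 17, 34, 32,
    25, 33, 20, 27, 26, 13, 28, 9, 30, 1],
  [0, 5, 13, 28, 9, 30, 33, 20, 27, 26, 19, 15, 23, 31, 2, 6, 29, 4, 10, 8, 12, 14, 35, 11, 24,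
    16, 7, 21, 18, 17, 34, 32, 25, 22, 1],
  [0, 5, 13, 28, 9, 30, 1, 22, 17, 34, 7, 21, 18, 10, 8, 12, 14, 16, 24, 32, 25, 33, 20, 27, 26,
    11, 35, 3, 19, 15, 29, 6, 23, 31, 2],
  [0, 9, 30, 1, 22, 25, 33, 20, 28, 13, 26, 27, 32, 24, 11, 35, 14, 16, 7, 34, 17, 18, 21, 12, 8,
    3, 19, 15, 29, 4, 10, 6, 23, 31, 2],
  [0, 5, 13, 28, 9, 30, 1, 22, 17, 34, 7, 21, 18, 10, 8, 12, 14, 16, 24, 32, 25, 33, 20, 27, 26,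
    11, 35, 3, 19, 4, 29, 15, 23, 31, 2],
  [0, 5, 13, 28, 9, 30, 33, 20, 27, 26, 11, 24, 16, 14, 35, 3, 19, 15, 23, 31, 2, 6, 29, 4, 10,
    8, 12, 21, 18, 17, 34, 32, 25, 22, 1],
  [0, 5, 13, 28, 9, 30, 33, 20, 27, 26, 11, 35, 3, 19, 15, 23, 31, 2, 6, 29, 4, 10, 18, 17, 34,
    7, 21, 12, 14, 16, 24, 32, 25, 22, 1],
  [0, 5, 13, 28, 20, 27, 26, 11, 35, 14, 16, 24, 32, 34, 7, 21, 12, 8, 3, 19, 15, 23, 31, 2, 6,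
    29, 4, 10, 18, 17, 22, 25, 33, 30, 1],
  [0, 5, 13, 26, 27, 20, 28, 9, 30, 33, 25, 32, 24, 11, 35, 14, 16, 7, 34, 17, 18, 21, 12, 8, 3,
    19, 4, 29, 15, 23, 31, 2, 6, 22, 1],
  [0, 5, 13, 26, 19, 15, 23, 31, 2, 6, 29, 4, 10, 18, 17, 34, 7, 21, 12, 8, 3, 35, 14, 16, 24,
    32, 27, 20, 28, 9, 30, 33, 25, 22, 1],
  [0, 5, 31, 2, 6, 23, 15, 29, 4, 19, 3, 8, 10, 18, 21, 7, 16, 14, 35, 11, 24, 32, 34, 17, 22,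
    25, 33, 20, 27, 26, 13, 28, 9, 30, 1],
  [0, 5, 31, 2, 6, 23, 15, 29, 4, 10, 18, 17, 34, 7, 21, 12, 8, 3, 19, 26, 11, 35, 14, 16, 24,
    32, 27, 20, 28, 9, 30, 33, 25, 22, 1],
  [0, 5, 13, 28, 9, 30, 33, 20, 27, 26, 11, 35, 3, 19, 15, 23, 31, 2, 6, 29, 4, 10, 8, 12, 21,
    18, 17, 34, 7, 16, 24, 32, 25, 22, 1],
  [0, 5, 13, 28, 9, 30, 1, 22, 17, 34, 7, 21, 18, 10, 8, 12, 14, 16, 24, 32, 25, 33, 20, 27, 26,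
    11, 35, 3, 19, 4, 29, 6, 23, 31, 2],
  [0, 5, 13, 26, 27, 20, 28, 9, 30, 33, 25, 32, 24, 11, 35, 14, 12, 21, 7, 34, 17, 18, 10, 8, 3,
    19, 4, 29, 15, 23, 31, 2, 6, 22, 1],
  [0, 5, 13, 26, 27, 20, 28, 9, 30, 33, 25, 32, 34, 7, 21, 18, 10, 8, 12, 14, 16, 24, 11, 35, 3,
    19, 4, 29, 15, 23, 31, 2, 6, 22, 1],
  [0, 5, 13, 28, 9, 30, 1, 22, 17, 34, 7, 21, 12, 14, 16, 24, 32, 25, 33, 20, 27, 26, 11, 35, 3,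
    8, 10, 4, 19, 15, 29, 6, 23, 31, 2],
  [0, 5, 31, 2, 6, 23, 15, 29, 4, 10, 18, 17, 34, 7, 21, 12, 8, 3, 35, 14, 16, 24, 11, 26, 13,
    28, 9, 30, 33, 20, 27, 32, 25, 22, 1],
  [0, 9, 28, 13, 5, 31, 2, 6, 23, 15, 29, 4, 10, 18, 21, 12, 8, 3, 19, 26, 27, 32, 24, 11, 35,
    14, 16, 7, 34, 17, 22, 25, 33, 30, 1],
  [0, 5, 13, 28, 9, 30, 33, 20, 27, 26, 11, 35, 14, 12, 8, 3, 19, 15, 23, 31, 2, 6, 29, 4, 10,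
    18, 17, 34, 7, 16, 24, 32, 25, 22, 1],
  [1, 30, 9, 0, 5, 13, 28, 20, 33, 25, 32, 27, 26, 11, 24, 16, 14, 35, 3, 8, 12, 21, 7, 34, 17,
    18, 10, 4, 19, 15, 29, 6, 23, 31, 2],
  [0, 5, 31, 2, 6, 29, 15, 19, 4, 10, 18, 17, 34, 7, 21, 12, 8, 3, 35, 14, 16, 24, 11, 26, 13,
    28, 9, 30, 33, 20, 27, 32, 25, 22, 1],
  [0, 5, 13, 28, 9, 30, 33, 20, 27, 26, 11, 35, 14, 16, 7, 21, 12, 8, 3, 19, 15, 23, 31, 2, 6,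
    29, 4, 10, 18, 17, 34, 32, 25, 22, 1],
  [0, 5, 13, 28, 9, 30, 33, 20, 27, 32, 24, 16, 14, 12, 21, 7, 34, 17, 18, 10, 8, 3, 35, 11, 26,
    19, 4, 29, 15, 23, 31, 2, 6, 22, 1],
  [0, 9, 30, 33, 25, 32, 27, 20, 28, 13, 5, 31, 2, 6, 23, 15, 29, 4, 19, 3, 8, 10, 18, 21, 12,
    14, 35, 11, 24, 16, 7, 34, 17, 22, 1],
  [0, 5, 13, 26, 11, 35, 14, 16, 24, 32, 34, 7, 21, 12, 8, 3, 19, 15, 23, 31, 2, 6, 29, 4, 10,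
    18, 17, 22, 25, 33, 20, 28, 9, 30, 1],
  [0, 9, 30, 1, 22, 17, 34, 7, 16, 14, 12, 21, 18, 10, 8, 3, 35, 11, 24, 32, 25, 33, 20, 27, 26,
    13, 5, 31, 23, 15, 19, 4, 29, 6, 2],
  [0, 5, 31, 2, 6, 23, 15, 19, 4, 10, 18, 17, 34, 7, 21, 12, 8, 3, 35, 14, 16, 24, 11, 26, 13,
    28, 9, 30, 33, 20, 27, 32, 25, 22, 1],
  [0, 9, 28, 20, 33, 25, 32, 27, 26, 13, 5, 31, 2, 6, 23, 15, 29, 4, 19, 3, 8, 10, 18, 21, 12,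
    14, 35, 11, 24, 16, 7, 34, 17, 22, 1],
  [0, 5, 13, 28, 9, 30, 1, 22, 17, 34, 7, 21, 18, 10, 8, 12, 14, 16, 24, 32, 25, 33, 20, 27, 26,
    11, 35, 3, 19, 4, 29, 15, 23, 6, 2],
  [0, 5, 31, 2, 6, 23, 15, 29, 4, 19, 3, 8, 10, 18, 21, 12, 14, 35, 11, 24, 16, 7, 34, 17, 22,
    25, 33, 20, 27, 26, 13, 28, 9, 30, 1],
  [0, 5, 13, 26, 27, 20, 28, 9, 30, 1, 22, 25, 32, 24, 11, 35, 14, 16, 7, 34, 17, 18, 21, 12, 8,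
    3, 19, 15, 29, 4, 10, 6, 23, 31, 2],
  [0, 5, 13, 26, 27, 32, 24, 11, 35, 14, 16, 7, 21, 12, 8, 3, 19, 15, 23, 31, 2, 6, 29, 4, 10,
    18, 17, 22, 25, 33, 20, 28, 9, 30, 1],
  [0, 5, 31, 2, 6, 23, 15, 29, 4, 19, 3, 8, 10, 18, 17, 34, 7, 21, 12, 14, 16, 24, 11, 26, 13,
    28, 9, 30, 33, 20, 27, 32, 25, 22, 1]]

/-- Hamiltonian paths from the terminals that do not end in the last vertex. -/
def startPaths₃₆ : List (List ℕ) :=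
  [[0, 5, 13, 28, 9, 30, 1, 22, 17, 34, 7, 21, 18, 10, 4, 29, 6, 2, 31, 23, 15, 19, 26, 11, 35, 3,
    8, 12, 14, 16, 24, 32, 27, 20, 33, 25],
  [1, 30, 9, 0, 5, 13, 28, 20, 33, 25, 22, 17, 34, 32, 27, 26, 11, 24, 16, 7, 21, 18, 10, 4, 29,
    6, 2, 31, 23, 15, 19, 3, 35, 14, 12, 8],
  [2, 31, 23, 15, 29, 4, 19, 3, 8, 12, 21, 7, 34, 17, 18, 10, 6, 22, 1, 30, 9, 0, 5, 13, 28, 20,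
    33, 25, 32, 27, 26, 11, 35, 14, 16, 24]]

theorem checkFragment₃₆ : checkFragment 36 edges₃₆ delPaths₃₆ startPaths₃₆ = true := by
  decide +kernel

theorem checkDrawing₃₆ : checkDrawing 36 300 edges₃₆ points₃₆ = true := by
  decide +kernel

/-- The edges of a fragment on 39 vertices with terminals `0`, `1`, `2`. -/
def edges₃₉ : List (ℕ × ℕ) :=
  [(0, 20), (0, 24), (1, 23), (1, 26), (2, 12), (2, 34), (3, 4), (3, 22), (3, 37), (4, 11),
  (4, 17), (5, 7), (5, 27), (5, 29), (6, 9), (6, 13), (6, 18), (7, 14), (7, 15), (8, 26), (8, 31),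
  (8, 38), (9, 16), (9, 21), (10, 11), (10, 15), (10, 27), (11, 28), (12, 24), (12, 37), (13, 19),
  (13, 24), (14, 32), (14, 33), (14, 36), (15, 17), (16, 19), (16, 25), (17, 36), (18, 22),
  (18, 33), (19, 20), (20, 23), (21, 30), (21, 33), (22, 36), (23, 35), (25, 30), (25, 38),
  (26, 35), (27, 34), (28, 34), (28, 37), (29, 31), (29, 32), (29, 38), (30, 32), (31, 34),
  (35, 38)]

/-- The positions of the 39 vertices. -/
def points₃₉ : List (ℕ × ℕ) :=
  [(0, 0), (250, 0), (0, 250), (35, 169), (36, 172), (47, 170), (51, 96), (48, 164), (164, 66),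
  (56, 93), (38, 179), (35, 179), (9, 169), (42, 79), (60, 138), (44, 168), (54, 85), (42, 165),
  (52, 121), (45, 69), (33, 17), (68, 109), (40, 160), (206, 16), (9, 84), (85, 103), (192, 43),
  (38, 184), (31, 186), (72, 144), (74, 112), (57, 169), (67, 131), (58, 126), (29, 203),
  (159, 62), (44, 159), (28, 176), (133, 83)]

/-- Paths between terminals that avoid `0`, …, `38`, respectively. -/
def delPaths₃₉ : List (List ℕ) :=
  [[1, 26, 8, 31, 34, 28, 37, 3, 22, 36, 14, 7, 15, 17, 4, 11, 10, 27, 5, 29, 32, 30, 21, 33, 18,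
    6, 9, 16, 25, 38, 35, 23, 20, 19, 13, 24, 12, 2],
  [0, 20, 23, 35, 26, 8, 38, 25, 30, 21, 33, 18, 6, 9, 16, 19, 13, 24, 12, 37, 28, 11, 10, 27, 5,
    7, 15, 17, 4, 3, 22, 36, 14, 32, 29, 31, 34, 2],
  [0, 20, 19, 13, 24, 12, 37, 3, 22, 36, 17, 4, 11, 28, 34, 31, 29, 5, 27, 10, 15, 7, 14, 32, 30,
    21, 33, 18, 6, 9, 16, 25, 38, 8, 26, 35, 23, 1],
  [0, 24, 13, 6, 18, 22, 36, 17, 4, 11, 28, 37, 12, 2, 34, 27, 10, 15, 7, 5, 29, 31, 8, 26, 35,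
    38, 25, 30, 32, 14, 33, 21, 9, 16, 19, 20, 23, 1],
  [0, 20, 19, 13, 24, 12, 2, 34, 31, 29, 32, 30, 21, 33, 14, 36, 17, 15, 7, 5, 27, 10, 11, 28,
    37, 3, 22, 18, 6, 9, 16, 25, 38, 8, 26, 35, 23, 1],
  [0, 24, 12, 2, 34, 27, 10, 11, 28, 37, 3, 4, 17, 15, 7, 14, 36, 22, 18, 33, 21, 30, 32, 29, 31,
    8, 26, 35, 38, 25, 16, 9, 6, 13, 19, 20, 23, 1],
  [0, 20, 19, 13, 24, 12, 2, 34, 28, 37, 3, 4, 11, 10, 27, 5, 7, 15, 17, 36, 22, 18, 33, 14, 32,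
    30, 21, 9, 16, 25, 38, 29, 31, 8, 26, 35, 23, 1],
  [0, 20, 19, 13, 24, 12, 2, 34, 31, 29, 5, 27, 10, 15, 17, 4, 11, 28, 37, 3, 22, 36, 14, 32, 30,
    21, 33, 18, 6, 9, 16, 25, 38, 8, 26, 35, 23, 1],
  [0, 20, 23, 1, 26, 35, 38, 25, 30, 21, 33, 18, 6, 9, 16, 19, 13, 24, 12, 37, 28, 11, 10, 27, 5,
    7, 15, 17, 4, 3, 22, 36, 14, 32, 29, 31, 34, 2],
  [0, 24, 13, 6, 18, 33, 21, 30, 25, 16, 19, 20, 23, 35, 38, 29, 32, 14, 7, 5, 27, 10, 15, 17,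
    36, 22, 3, 4, 11, 28, 37, 12, 2, 34, 31, 8, 26, 1],
  [0, 20, 19, 13, 24, 12, 2, 34, 27, 5, 7, 15, 17, 4, 11, 28, 37, 3, 22, 36, 14, 32, 30, 21, 33,
    18, 6, 9, 16, 25, 38, 29, 31, 8, 26, 35, 23, 1],
  [0, 24, 12, 2, 34, 28, 37, 3, 4, 17, 15, 10, 27, 5, 7, 14, 36, 22, 18, 33, 21, 30, 32, 29, 31,
    8, 26, 35, 38, 25, 16, 9, 6, 13, 19, 20, 23, 1],
  [0, 24, 13, 19, 20, 23, 1, 26, 35, 38, 8, 31, 29, 32, 14, 33, 21, 30, 25, 16, 9, 6, 18, 22, 36,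
    17, 15, 7, 5, 27, 10, 11, 4, 3, 37, 28, 34, 2],
  [0, 24, 12, 2, 34, 28, 37, 3, 4, 11, 10, 27, 5, 7, 15, 17, 36, 22, 18, 6, 9, 16, 19, 20, 23,
    35, 38, 25, 30, 21, 33, 14, 32, 29, 31, 8, 26, 1],
  [0, 24, 12, 2, 34, 28, 37, 3, 4, 11, 10, 27, 5, 7, 15, 17, 36, 22, 18, 33, 21, 30, 32, 29, 31,
    8, 26, 35, 38, 25, 16, 9, 6, 13, 19, 20, 23, 1],
  [0, 20, 19, 13, 24, 12, 2, 34, 28, 37, 3, 22, 36, 17, 4, 11, 10, 27, 5, 7, 14, 32, 30, 21, 33,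
    18, 6, 9, 16, 25, 38, 29, 31, 8, 26, 35, 23, 1],
  [0, 20, 19, 13, 24, 12, 2, 34, 28, 37, 3, 4, 11, 10, 27, 5, 7, 15, 17, 36, 22, 18, 6, 9, 21,
    33, 14, 32, 30, 25, 38, 29, 31, 8, 26, 35, 23, 1],
  [0, 24, 13, 19, 20, 23, 35, 38, 25, 16, 9, 6, 18, 33, 21, 30, 32, 29, 5, 27, 10, 15, 7, 14, 36,
    22, 3, 4, 11, 28, 37, 12, 2, 34, 31, 8, 26, 1],
  [0, 24, 13, 6, 9, 21, 33, 14, 7, 5, 27, 10, 15, 17, 36, 22, 3, 4, 11, 28, 37, 12, 2, 34, 31,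
    29, 32, 30, 25, 16, 19, 20, 23, 35, 38, 8, 26, 1],
  [0, 20, 23, 1, 26, 35, 38, 8, 31, 29, 32, 30, 25, 16, 9, 21, 33, 14, 7, 5, 27, 34, 28, 37, 3,
    4, 11, 10, 15, 17, 36, 22, 18, 6, 13, 24, 12, 2],
  [0, 24, 13, 19, 16, 25, 38, 29, 32, 30, 21, 9, 6, 18, 33, 14, 7, 5, 27, 10, 15, 17, 36, 22, 3,
    4, 11, 28, 37, 12, 2, 34, 31, 8, 26, 35, 23, 1],
  [0, 20, 19, 16, 9, 6, 13, 24, 12, 2, 34, 28, 37, 3, 4, 11, 10, 27, 5, 7, 15, 17, 36, 22, 18,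
    33, 14, 32, 30, 25, 38, 29, 31, 8, 26, 35, 23, 1],
  [0, 20, 19, 13, 24, 12, 2, 34, 28, 37, 3, 4, 11, 10, 27, 5, 7, 15, 17, 36, 14, 32, 30, 21, 33,
    18, 6, 9, 16, 25, 38, 29, 31, 8, 26, 35, 23, 1],
  [0, 20, 19, 13, 24, 12, 2, 34, 28, 37, 3, 4, 11, 10, 27, 5, 7, 15, 17, 36, 22, 18, 6, 9, 16,
    25, 30, 21, 33, 14, 32, 29, 31, 8, 38, 35, 26, 1],
  [0, 20, 19, 13, 6, 18, 33, 21, 9, 16, 25, 30, 32, 14, 7, 5, 27, 10, 15, 17, 36, 22, 3, 4, 11,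
    28, 37, 12, 2, 34, 31, 29, 38, 8, 26, 35, 23, 1],
  [0, 24, 13, 6, 18, 33, 14, 7, 5, 27, 10, 15, 17, 36, 22, 3, 4, 11, 28, 37, 12, 2, 34, 31, 29,
    32, 30, 21, 9, 16, 19, 20, 23, 35, 38, 8, 26, 1],
  [0, 20, 19, 13, 24, 12, 2, 34, 28, 37, 3, 4, 11, 10, 27, 5, 7, 15, 17, 36, 22, 18, 6, 9, 16,
    25, 30, 21, 33, 14, 32, 29, 31, 8, 38, 35, 23, 1],
  [0, 20, 19, 16, 25, 38, 29, 5, 7, 15, 10, 11, 28, 37, 3, 4, 17, 36, 22, 18, 33, 14, 32, 30, 21,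
    9, 6, 13, 24, 12, 2, 34, 31, 8, 26, 35, 23, 1],
  [0, 24, 13, 19, 20, 23, 35, 38, 25, 16, 9, 6, 18, 22, 3, 37, 12, 2, 34, 27, 5, 7, 15, 10, 11,
    4, 17, 36, 14, 33, 21, 30, 32, 29, 31, 8, 26, 1],
  [0, 24, 13, 19, 20, 23, 35, 38, 25, 16, 9, 6, 18, 33, 21, 30, 32, 14, 7, 5, 27, 10, 15, 17, 36,
    22, 3, 4, 11, 28, 37, 12, 2, 34, 31, 8, 26, 1],
  [0, 20, 23, 35, 38, 25, 16, 19, 13, 24, 12, 2, 34, 28, 37, 3, 4, 11, 10, 27, 5, 7, 15, 17, 36,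
    22, 18, 6, 9, 21, 33, 14, 32, 29, 31, 8, 26, 1],
  [0, 20, 19, 13, 24, 12, 2, 34, 28, 37, 3, 22, 36, 14, 7, 15, 17, 4, 11, 10, 27, 5, 29, 32, 30,
    21, 33, 18, 6, 9, 16, 25, 38, 8, 26, 35, 23, 1],
  [0, 20, 19, 16, 9, 6, 13, 24, 12, 2, 34, 31, 29, 5, 27, 10, 11, 28, 37, 3, 4, 17, 15, 7, 14,
    36, 22, 18, 33, 21, 30, 25, 38, 8, 26, 35, 23, 1],
  [0, 24, 12, 2, 34, 28, 37, 3, 4, 11, 10, 27, 5, 29, 31, 8, 26, 35, 38, 25, 16, 9, 21, 30, 32,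
    14, 7, 15, 17, 36, 22, 18, 6, 13, 19, 20, 23, 1],
  [1, 23, 20, 0, 24, 13, 19, 16, 25, 38, 35, 26, 8, 31, 29, 32, 30, 21, 9, 6, 18, 33, 14, 7, 5,
    27, 10, 15, 17, 36, 22, 3, 4, 11, 28, 37, 12, 2],
  [0, 20, 23, 1, 26, 8, 38, 25, 30, 21, 33, 18, 6, 9, 16, 19, 13, 24, 12, 37, 28, 11, 10, 27, 5,
    7, 15, 17, 4, 3, 22, 36, 14, 32, 29, 31, 34, 2],
  [0, 20, 19, 13, 24, 12, 2, 34, 31, 29, 32, 30, 21, 33, 14, 7, 5, 27, 10, 15, 17, 4, 11, 28, 37,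
    3, 22, 18, 6, 9, 16, 25, 38, 8, 26, 35, 23, 1],
  [0, 20, 19, 13, 24, 12, 2, 34, 28, 11, 10, 27, 5, 7, 15, 17, 4, 3, 22, 36, 14, 32, 30, 21, 33,
    18, 6, 9, 16, 25, 38, 29, 31, 8, 26, 35, 23, 1],
  [0, 20, 19, 13, 24, 12, 2, 34, 28, 37, 3, 4, 11, 10, 27, 5, 7, 15, 17, 36, 22, 18, 6, 9, 16,
    25, 30, 21, 33, 14, 32, 29, 31, 8, 26, 35, 23, 1]]

/-- Hamiltonian paths from the terminals that do not end in the last vertex. -/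
def startPaths₃₉ : List (List ℕ) :=
  [[0, 20, 19, 13, 24, 12, 2, 34, 28, 37, 3, 22, 18, 6, 9, 16, 25, 38, 35, 23, 1, 26, 8, 31, 29,
    32, 30, 21, 33, 14, 36, 17, 4, 11, 10, 27, 5, 7, 15],
  [1, 23, 35, 26, 8, 31, 34, 2, 12, 24, 0, 20, 19, 13, 6, 9, 16, 25, 38, 29, 32, 30, 21, 33, 18,
    22, 3, 37, 28, 11, 4, 17, 36, 14, 7, 5, 27, 10, 15],
  [2, 12, 24, 0, 20, 19, 13, 6, 18, 22, 3, 37, 28, 11, 4, 17, 36, 14, 33, 21, 9, 16, 25, 30, 32,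
    29, 38, 35, 23, 1, 26, 8, 31, 34, 27, 10, 15, 7, 5]]

theorem checkFragment₃₉ : checkFragment 39 edges₃₉ delPaths₃₉ startPaths₃₉ = true := by
  decide +kernel

theorem checkDrawing₃₉ : checkDrawing 39 250 edges₃₉ points₃₉ = true := by
  decide +kernel

/-- The edges of a fragment on 41 vertices with terminals `0`, `1`, `2`. -/
def edges₄₁ : List (ℕ × ℕ) :=
  [(0, 26), (0, 37), (1, 16), (1, 17), (2, 28), (2, 30), (3, 15), (3, 23), (3, 33), (4, 13),
  (4, 19), (4, 21), (5, 22), (5, 24), (5, 35), (6, 10), (6, 23), (6, 38), (7, 11), (7, 39),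
  (7, 40), (8, 17), (8, 22), (8, 35), (9, 14), (9, 20), (9, 36), (10, 25), (10, 40), (11, 18),
  (11, 24), (12, 13), (12, 18), (12, 28), (13, 30), (14, 21), (14, 39), (15, 36), (15, 38),
  (16, 32), (16, 37), (17, 32), (18, 19), (19, 39), (20, 25), (20, 38), (21, 29), (22, 28),
  (23, 27), (23, 31), (24, 28), (25, 39), (26, 30), (26, 34), (27, 34), (27, 37), (29, 33),
  (29, 36), (31, 35), (31, 40), (32, 35), (33, 34)]

/-- The positions of the 41 vertices. -/
def points₄₁ : List (ℕ × ℕ) :=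
  [(0, 0), (300, 0), (0, 300), (73, 99), (55, 187), (128, 138), (87, 109), (80, 161), (209, 64),
  (74, 136), (89, 117), (75, 177), (46, 220), (47, 205), (69, 159), (75, 122), (279, 7),
  (254, 32), (67, 186), (70, 171), (76, 134), (60, 171), (136, 133), (86, 77), (78, 182),
  (79, 142), (15, 44), (78, 58), (38, 241), (65, 137), (8, 256), (155, 86), (249, 31), (66, 104),
  (41, 56), (179, 79), (73, 135), (83, 40), (77, 127), (76, 158), (120, 112)]

/-- Paths between terminals that avoid `0`, …, `40`, respectively. -/
def delPaths₄₁ : List (List ℕ) :=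
  [[1, 17, 8, 22, 5, 24, 11, 18, 19, 4, 21, 14, 39, 7, 40, 31, 35, 32, 16, 37, 27, 23, 3, 15, 38,
    6, 10, 25, 20, 9, 36, 29, 33, 34, 26, 30, 13, 12, 28, 2],
  [0, 26, 30, 13, 12, 18, 19, 4, 21, 14, 39, 25, 10, 6, 23, 3, 15, 38, 20, 9, 36, 29, 33, 34, 27,
    37, 16, 32, 17, 8, 35, 31, 40, 7, 11, 24, 5, 22, 28, 2],
  [0, 26, 30, 13, 4, 19, 18, 12, 28, 22, 8, 17, 32, 35, 5, 24, 11, 7, 40, 31, 23, 6, 10, 25, 39,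
    14, 21, 29, 36, 9, 20, 38, 15, 3, 33, 34, 27, 37, 16, 1],
  [0, 26, 30, 2, 28, 22, 8, 17, 32, 35, 5, 24, 11, 18, 12, 13, 4, 19, 39, 7, 40, 31, 23, 6, 10,
    25, 20, 38, 15, 36, 9, 14, 21, 29, 33, 34, 27, 37, 16, 1],
  [0, 26, 34, 33, 3, 15, 38, 6, 10, 25, 20, 9, 36, 29, 21, 14, 39, 19, 18, 12, 13, 30, 2, 28, 22,
    8, 17, 32, 35, 5, 24, 11, 7, 40, 31, 23, 27, 37, 16, 1],
  [1, 17, 32, 16, 37, 0, 26, 34, 27, 23, 6, 38, 20, 25, 10, 40, 31, 35, 8, 22, 28, 24, 11, 7, 39,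
    14, 9, 36, 15, 3, 33, 29, 21, 4, 19, 18, 12, 13, 30, 2],
  [0, 26, 30, 2, 28, 12, 13, 4, 21, 14, 9, 36, 29, 33, 34, 27, 37, 16, 32, 35, 31, 23, 3, 15, 38,
    20, 25, 10, 40, 7, 39, 19, 18, 11, 24, 5, 22, 8, 17, 1],
  [0, 26, 30, 2, 28, 22, 8, 17, 32, 35, 5, 24, 11, 18, 12, 13, 4, 19, 39, 25, 10, 40, 31, 23, 6,
    38, 20, 9, 14, 21, 29, 36, 15, 3, 33, 34, 27, 37, 16, 1],
  [0, 26, 30, 13, 12, 18, 19, 4, 21, 14, 39, 25, 10, 6, 23, 3, 15, 38, 20, 9, 36, 29, 33, 34, 27,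
    37, 16, 1, 17, 32, 35, 31, 40, 7, 11, 24, 5, 22, 28, 2],
  [0, 26, 30, 2, 28, 24, 5, 22, 8, 35, 31, 40, 7, 11, 18, 12, 13, 4, 19, 39, 14, 21, 29, 36, 15,
    38, 20, 25, 10, 6, 23, 3, 33, 34, 27, 37, 16, 32, 17, 1],
  [0, 26, 30, 2, 28, 24, 5, 22, 8, 35, 31, 40, 7, 11, 18, 12, 13, 4, 19, 39, 25, 20, 38, 6, 23,
    3, 15, 36, 9, 14, 21, 29, 33, 34, 27, 37, 16, 32, 17, 1],
  [0, 26, 34, 33, 29, 36, 9, 20, 25, 10, 6, 38, 15, 3, 23, 27, 37, 16, 32, 35, 31, 40, 7, 39, 14,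
    21, 4, 19, 18, 12, 13, 30, 2, 28, 24, 5, 22, 8, 17, 1],
  [0, 26, 34, 33, 29, 36, 9, 20, 25, 10, 6, 38, 15, 3, 23, 27, 37, 16, 32, 35, 31, 40, 7, 11, 18,
    19, 39, 14, 21, 4, 13, 30, 2, 28, 24, 5, 22, 8, 17, 1],
  [0, 26, 30, 2, 28, 12, 18, 19, 4, 21, 14, 39, 25, 10, 6, 23, 3, 15, 38, 20, 9, 36, 29, 33, 34,
    27, 37, 16, 32, 35, 31, 40, 7, 11, 24, 5, 22, 8, 17, 1],
  [0, 26, 30, 2, 28, 22, 8, 17, 32, 35, 5, 24, 11, 7, 40, 31, 23, 6, 10, 25, 39, 19, 18, 12, 13,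
    4, 21, 29, 36, 9, 20, 38, 15, 3, 33, 34, 27, 37, 16, 1],
  [0, 26, 34, 27, 37, 16, 32, 35, 31, 23, 3, 33, 29, 36, 9, 14, 21, 4, 13, 30, 2, 28, 12, 18, 19,
    39, 25, 20, 38, 6, 10, 40, 7, 11, 24, 5, 22, 8, 17, 1],
  [0, 37, 27, 34, 26, 30, 2, 28, 12, 13, 4, 21, 14, 9, 36, 29, 33, 3, 15, 38, 20, 25, 10, 6, 23,
    31, 40, 7, 39, 19, 18, 11, 24, 5, 22, 8, 35, 32, 17, 1],
  [0, 37, 27, 34, 26, 30, 2, 28, 12, 13, 4, 21, 14, 9, 36, 29, 33, 3, 15, 38, 20, 25, 10, 6, 23,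
    31, 40, 7, 39, 19, 18, 11, 24, 5, 22, 8, 35, 32, 16, 1],
  [0, 26, 30, 2, 28, 12, 13, 4, 19, 39, 7, 11, 24, 5, 22, 8, 35, 31, 40, 10, 25, 20, 38, 6, 23,
    3, 15, 36, 9, 14, 21, 29, 33, 34, 27, 37, 16, 32, 17, 1],
  [0, 26, 30, 2, 28, 22, 8, 17, 32, 35, 5, 24, 11, 18, 12, 13, 4, 21, 14, 39, 7, 40, 31, 23, 3,
    15, 38, 6, 10, 25, 20, 9, 36, 29, 33, 34, 27, 37, 16, 1],
  [0, 26, 30, 2, 28, 22, 8, 17, 32, 35, 5, 24, 11, 7, 40, 31, 23, 3, 15, 38, 6, 10, 25, 39, 19,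
    18, 12, 13, 4, 21, 14, 9, 36, 29, 33, 34, 27, 37, 16, 1],
  [0, 37, 16, 32, 35, 31, 40, 7, 11, 18, 12, 13, 4, 19, 39, 14, 9, 36, 29, 33, 3, 15, 38, 20, 25,
    10, 6, 23, 27, 34, 26, 30, 2, 28, 24, 5, 22, 8, 17, 1],
  [0, 37, 27, 34, 26, 30, 2, 28, 12, 13, 4, 21, 14, 9, 36, 29, 33, 3, 15, 38, 20, 25, 10, 6, 23,
    31, 40, 7, 39, 19, 18, 11, 24, 5, 35, 8, 17, 32, 16, 1],
  [0, 26, 30, 2, 28, 24, 5, 22, 8, 35, 31, 40, 7, 11, 18, 12, 13, 4, 19, 39, 25, 10, 6, 38, 20,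
    9, 14, 21, 29, 36, 15, 3, 33, 34, 27, 37, 16, 32, 17, 1],
  [0, 26, 30, 2, 28, 12, 13, 4, 19, 18, 11, 7, 40, 31, 23, 6, 10, 25, 39, 14, 21, 29, 36, 9, 20,
    38, 15, 3, 33, 34, 27, 37, 16, 32, 35, 5, 22, 8, 17, 1],
  [0, 26, 30, 2, 28, 22, 8, 17, 32, 35, 5, 24, 11, 7, 39, 19, 18, 12, 13, 4, 21, 14, 9, 20, 38,
    6, 10, 40, 31, 23, 3, 15, 36, 29, 33, 34, 27, 37, 16, 1],
  [0, 37, 27, 34, 33, 29, 36, 9, 14, 21, 4, 19, 18, 12, 13, 30, 2, 28, 22, 5, 24, 11, 7, 39, 25,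
    20, 38, 15, 3, 23, 6, 10, 40, 31, 35, 8, 17, 32, 16, 1],
  [0, 37, 16, 1, 17, 32, 35, 8, 22, 5, 24, 11, 18, 19, 4, 21, 14, 39, 7, 40, 31, 23, 3, 15, 38,
    6, 10, 25, 20, 9, 36, 29, 33, 34, 26, 30, 13, 12, 28, 2],
  [1, 17, 32, 16, 37, 0, 26, 34, 27, 23, 6, 38, 20, 25, 10, 40, 31, 35, 8, 22, 5, 24, 11, 7, 39,
    14, 9, 36, 15, 3, 33, 29, 21, 4, 19, 18, 12, 13, 30, 2],
  [0, 26, 30, 2, 28, 12, 13, 4, 21, 14, 9, 36, 15, 38, 20, 25, 10, 6, 23, 3, 33, 34, 27, 37, 16,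
    32, 35, 31, 40, 7, 39, 19, 18, 11, 24, 5, 22, 8, 17, 1],
  [0, 26, 34, 33, 3, 15, 38, 6, 10, 25, 20, 9, 36, 29, 21, 14, 39, 19, 4, 13, 12, 18, 11, 7, 40,
    31, 23, 27, 37, 16, 1, 17, 32, 35, 8, 22, 5, 24, 28, 2],
  [0, 26, 30, 2, 28, 22, 8, 35, 5, 24, 11, 18, 12, 13, 4, 19, 39, 7, 40, 10, 25, 20, 38, 6, 23,
    3, 15, 36, 9, 14, 21, 29, 33, 34, 27, 37, 16, 32, 17, 1],
  [0, 26, 30, 13, 12, 18, 19, 4, 21, 14, 39, 25, 10, 6, 23, 3, 15, 38, 20, 9, 36, 29, 33, 34, 27,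
    37, 16, 1, 17, 8, 35, 31, 40, 7, 11, 24, 5, 22, 28, 2],
  [0, 37, 16, 32, 35, 31, 40, 7, 11, 18, 12, 13, 4, 19, 39, 25, 10, 6, 38, 20, 9, 14, 21, 29, 36,
    15, 3, 23, 27, 34, 26, 30, 2, 28, 24, 5, 22, 8, 17, 1],
  [0, 26, 30, 2, 28, 12, 13, 4, 21, 14, 9, 36, 29, 33, 3, 15, 38, 20, 25, 10, 6, 23, 27, 37, 16,
    32, 35, 31, 40, 7, 39, 19, 18, 11, 24, 5, 22, 8, 17, 1],
  [0, 37, 27, 34, 26, 30, 2, 28, 12, 13, 4, 21, 14, 9, 36, 29, 33, 3, 15, 38, 20, 25, 10, 6, 23,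
    31, 40, 7, 39, 19, 18, 11, 24, 5, 22, 8, 17, 32, 16, 1],
  [0, 26, 30, 2, 28, 22, 8, 17, 32, 35, 5, 24, 11, 18, 12, 13, 4, 19, 39, 7, 40, 31, 23, 3, 15,
    38, 6, 10, 25, 20, 9, 14, 21, 29, 33, 34, 27, 37, 16, 1],
  [0, 26, 34, 27, 23, 6, 38, 20, 25, 10, 40, 31, 35, 5, 24, 11, 7, 39, 14, 9, 36, 15, 3, 33, 29,
    21, 4, 19, 18, 12, 13, 30, 2, 28, 22, 8, 17, 32, 16, 1],
  [0, 26, 30, 2, 28, 22, 8, 17, 32, 35, 5, 24, 11, 18, 12, 13, 4, 19, 39, 7, 40, 31, 23, 6, 10,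
    25, 20, 9, 14, 21, 29, 36, 15, 3, 33, 34, 27, 37, 16, 1],
  [0, 26, 34, 27, 37, 16, 32, 35, 5, 24, 11, 7, 40, 31, 23, 6, 10, 25, 20, 38, 15, 3, 33, 29, 36,
    9, 14, 21, 4, 19, 18, 12, 13, 30, 2, 28, 22, 8, 17, 1],
  [0, 26, 34, 27, 37, 16, 32, 35, 31, 23, 6, 10, 25, 20, 38, 15, 3, 33, 29, 36, 9, 14, 21, 4, 13,
    30, 2, 28, 12, 18, 19, 39, 7, 11, 24, 5, 22, 8, 17, 1]]

/-- Hamiltonian paths from the terminals that do not end in the last vertex. -/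
def startPaths₄₁ : List (List ℕ) :=
  [[0, 26, 30, 2, 28, 24, 5, 22, 8, 35, 32, 17, 1, 16, 37, 27, 34, 33, 29, 36, 9, 20, 25, 10, 6,
    38, 15, 3, 23, 31, 40, 7, 11, 18, 12, 13, 4, 19, 39, 14, 21],
  [1, 17, 8, 22, 5, 35, 32, 16, 37, 0, 26, 30, 2, 28, 24, 11, 18, 12, 13, 4, 19, 39, 7, 40, 31,
    23, 27, 34, 33, 3, 15, 38, 6, 10, 25, 20, 9, 36, 29, 21, 14],
  [2, 30, 13, 4, 19, 18, 12, 28, 22, 8, 17, 1, 16, 32, 35, 5, 24, 11, 7, 40, 31, 23, 6, 10, 25,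
    39, 14, 21, 29, 36, 9, 20, 38, 15, 3, 33, 34, 27, 37, 0, 26]]

theorem checkFragment₄₁ : checkFragment 41 edges₄₁ delPaths₄₁ startPaths₄₁ = true := by
  decide +kernel

theorem checkDrawing₄₁ : checkDrawing 41 300 edges₄₁ points₄₁ = true := by
  decide +kernel

/-! ### All orders -/

/-- The orders of the five fragments, up to multiples of `29`, give all sums from `156` on. -/
theorem exists_four_orders : ∀ i < 29, ∃ a ∈ [33, 35, 36, 39, 41], ∃ b ∈ [33, 35, 36, 39, 41],
    ∃ c ∈ [33, 35, 36, 39, 41], ∃ d ∈ [33, 35, 36, 39, 41],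
      156 + i = a + b + c + d ∨ 156 + i = a + b + c + d + 29 := by
  decide +kernel

theorem hasDrawnFragment_add_29 {m : ℕ} (h : HasDrawnFragment m) : HasDrawnFragment (m + 29) := by
  have := hasDrawnFragment_of_checkHost checkFragment₃₃ checkDrawing₃₃ checkHost₃₃ h
  exact (show 32 + m - 3 = m + 29 by omega) ▸ this

theorem hasDrawnFragment_33 : HasDrawnFragment 33 :=
  hasDrawnFragment_of_checkDrawing checkFragment₃₃ checkDrawing₃₃

theorem hasDrawnFragment_of_mem {m : ℕ} (hm : m ∈ [33, 35, 36, 39, 41]) : HasDrawnFragment m := by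
  simp only [List.mem_cons, List.not_mem_nil, or_false] at hm
  rcases hm with rfl | rfl | rfl | rfl | rfl
  · exact hasDrawnFragment_33
  · exact hasDrawnFragment_of_checkDrawing checkFragment₃₅ checkDrawing₃₅
  · exact hasDrawnFragment_of_checkDrawing checkFragment₃₆ checkDrawing₃₆
  · exact hasDrawnFragment_of_checkDrawing checkFragment₃₉ checkDrawing₃₉
  · exact hasDrawnFragment_of_checkDrawing checkFragment₄₁ checkDrawing₄₁

theorem exists_hasDrawnFragment_sum : ∀ N, 156 ≤ N → ∃ m₁ m₂ m₃ m₄, HasDrawnFragment m₁ ∧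
    HasDrawnFragment m₂ ∧ HasDrawnFragment m₃ ∧ HasDrawnFragment m₄ ∧
      N = m₁ + m₂ + m₃ + m₄ := by
  intro N
  induction N using Nat.strong_induction_on with
  | _ N ih =>
    intro hN
    by_cases h : N < 185
    · obtain ⟨a, ha, b, hb, c, hc, d, hd, e⟩ := exists_four_orders (N - 156) (by omega)
      have ha := hasDrawnFragment_of_mem ha
      have hb := hasDrawnFragment_of_mem hb
      have hc := hasDrawnFragment_of_mem hc
      have hd := hasDrawnFragment_of_mem hd
      rcases e with e | e
      · exact ⟨a, b, c, d, ha, hb, hc, hd, by omega⟩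
      · exact ⟨a + 29, b, c, d, hasDrawnFragment_add_29 ha, hb, hc, hd, by omega⟩
    · obtain ⟨a, b, c, d, ha, hb, hc, hd, e⟩ := ih (N - 29) (by omega) (by omega)
      exact ⟨a + 29, b, c, d, hasDrawnFragment_add_29 ha, hb, hc, hd, by omega⟩

theorem theorem3p6 :
    (∃ G : SimpleGraph (Fin 130), G.IsPlanar ∧ G.IsHypotraceable) ∧
      ∀ n : ℕ, 154 ≤ n → ∃ G : SimpleGraph (Fin n), G.IsPlanar ∧ G.IsHypotraceable := by
  have h := hasDrawnFragment_33
  refine ⟨exists_planar_isHypotraceable h h h h rfl, fun n hn => ?_⟩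
  obtain ⟨m₁, m₂, m₃, m₄, h₁, h₂, h₃, h₄, e⟩ := exists_hasDrawnFragment_sum (n + 2) (by omega)
  exact exists_planar_isHypotraceable h₁ h₂ h₃ h₄ e
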